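/- Let $d\in\{2,3\}$, let $\Omega\subset\mathbb R^d$ be a bounded polygonal (polyhedral) domain, i.e. a connected set that is the interior of a finite union of nondegenerate closed simplices, and let $T>0$. Let $a_0,b_0,\gamma,\theta_f>0$, $\beta\ge 0$, $\lambda^*\ge 0$, let $K:\Omega\to\mathbb R^{d\times d}$ be measurable and symmetric with $K_1|\zeta|^2\le K(x)\zeta\cdot\zeta\le K_2|\zeta|^2$ for a.e. $x\in\Omega$ and all $\zeta\in\mathbb R^d$, where $K_1>0$, let $\rho_f\in L^\infty(\Omega)$ and $\mathbf g\in\mathbb R^d$. Put $$\chi_1=\frac{b_0}{b_0^2+\beta a_0},\qquad \chi_2=\frac{\beta}{b_0^2+\beta a_0},\qquad \chi_3=\frac{a_0}{b_0^2+\beta a_0}.$$ Write $(\cdot,\cdot)$ and $\langle\cdot,\cdot\rangle$ for the inner products of $L^2(\Omega)$ and $L^2(\partial\Omega)$, $\varepsilon(\mathbf v)=\frac12(\nabla \mathbf v+\nabla^T\mathbf v)$, $\mathbf{RM}$ for the space of infinitesimal rigid motions, and $\mathbf H^1_\perp(\Omega)$ for the set of $\mathbf v\in H^1(\Omega)^d$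 with $(\mathbf v,\mathbf r)=0$ for all $\mathbf r\in\mathbf{RM}$. The data are $\boldsymbol\tau_0\in H^1(\Omega)^d$, $p_0\in L^2(\Omega)$, $\mathbf F\in L^2(\Omega)^d$, $\mathbf F_1\in L^2(\partial\Omega)^d$, $\phi\in L^2(\Omega)$, $\phi_1\in L^2(\partial\Omega)$ (independent of time) with $(\mathbf F,\mathbf r)+\langle\mathbf F_1,\mathbf r\rangle=0$ for all $\mathbf r\in\mathbf{RM}$. A weak solution is a tuple $(\boldsymbol\tau,\delta,\varpi,p,q)$ with $\boldsymbol\tau\in L^\infty(0,T;\mathbf H^1_\perp(\Omega))$, $\delta,q\in L^\infty(0,T;L^2(\Omega))$, $\varpi\in L^\infty(0,T;L^2(\Omega))\cap H^1(0,T;H^1(\Omega)')$, $p\in L^\infty(0,T;L^2(\Omega))\cap L^2(0,T;H^1(\Omega))$ and, if $\lambda^*>0$, $(\operatorname{div}\boldsymbol\tau)_t\in L^2(0,T;L^2(\Omega))$, such that for a.e. $t\in(0,T)$ $$\gamma(\varepsilon(\boldsymbol\tau),\varepsilon(\mathbf v))-(\delta,\operatorname{div}\mathbf v)=(\mathbf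 F,\mathbf v)+\langle\mathbf F_1,\mathbf v\rangle\quad\forall\,\mathbf v\in H^1(\Omega)^d,$$ $$\chi_3(\delta,\eta)+(\operatorname{div}\boldsymbol\tau,\eta)+\lambda^*\chi_3((\operatorname{div}\boldsymbol\tau)_t,\eta)=\chi_1(\varpi,\eta)\quad\forall\,\eta\in L^2(\Omega),$$ $$\langle\varpi_t,\psi\rangle_{H^1(\Omega)'\times H^1(\Omega)}+\frac1{\theta_f}(K(\nabla p-\rho_f\mathbf g),\nabla\psi)=(\phi,\psi)+\langle\phi_1,\psi\rangle\quad\forall\,\psi\in H^1(\Omega),$$ $$p=\chi_1\delta+\chi_2\varpi+\lambda^*\chi_1(\operatorname{div}\boldsymbol\tau)_t,\qquad q=\chi_1\varpi-\chi_3\delta-\lambda^*\chi_3(\operatorname{div}\boldsymbol\tau)_t,$$ together with $\varpi(0)=a_0p_0+b_0\operatorname{div}\boldsymbol\tau_0$ and, if $\lambda^*>0$, $(\operatorname{div}\boldsymbol\tau)(0)=\operatorname{div}\boldsymbol\tau_0$. If $\lambda^*=0$, all terms with the factor $\lambda^*$ or $\sqrt{\lambda^*}$ are zero. Then there are positive constants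 $C_1=C_1(\|\boldsymbol\tau_0\|_{H^1(\Omega)},\|p_0\|_{L^2(\Omega)},\|\mathbf F\|_{L^2(\Omega)},\|\mathbf F_1\|_{L^2(\partial\Omega)},\|\phi\|_{L^2(\Omega)},\|\phi_1\|_{L^2(\partial\Omega)})$ and $C_2=C_2(C_1,\|\nabla p_0\|_{L^2(\Omega)})$ (with $\|\nabla p_0\|_{L^2(\Omega)}=\infty$ allowed if $p_0\notin H^1(\Omega)$), given by functions that depend otherwise only on $\Omega$, $T$ and the coefficients $a_0,b_0,\beta,\gamma,\lambda^*,\theta_f,K,K_1,K_2,\rho_f,\mathbf g$, such that for all such data every weak solution satisfies $$\sqrt{\lambda^*}\,\|(\operatorname{div}\boldsymbol\tau)_t\|_{L^2(0,T;L^2(\Omega))}+\sqrt\gamma\,\|\varepsilon(\boldsymbol\tau)\|_{L^\infty(0,T;L^2(\Omega))}+\sqrt{\chi_2}\,\|\varpi\|_{L^\infty(0,T;L^2(\Omega))}$$ $$+\sqrt{\chi_3}\,\|\lambda^*(\operatorname{div}\boldsymbol\tau)_t+\delta\|_{L^\infty(0,T;L^2(\Omega))}+\sqrt{\tfrac{K_1}{\theta_f}}\,\|\nabla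 p\|_{L^2(0,T;L^2(\Omega))}\le C_1,$$ $$\|\boldsymbol\tau\|_{L^\infty(0,T;L^2(\Omega))}\le C_1,\qquad \|p\|_{L^\infty(0,T;L^2(\Omega))}\le C_2\bigl(\chi_2^{1/2}+\chi_1\chi_3^{-1/2}\bigr),$$ $$\|p\|_{L^2(0,T;L^2(\Omega))}\le C_1,\qquad \|\delta\|_{L^2(0,T;L^2(\Omega))}\le C_2\chi_1^{-1}\bigl(1+\chi_2^{1/2}\bigr).$$ -/

import Mathlib

open MeasureTheory Set Filter Topology
open scoped ENNReal ContDiff Matrix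

noncomputable section

namespace Biot

/-! ### Geometry: polygonal (polyhedral) domains and their surface measure -/

/-- Points of `ℝ^d`. -/
abbrev Pt (d : ℕ) := EuclideanSpace ℝ (Fin d)

/-- A bounded polygonal (for `d = 3`: polyhedral) domain: a connected open set that is the interior
of a finite union of nondegenerate closed `d`-simplices (so there are no slits). -/
def IsPolygonalDomain {d : ℕ} (Ω : Set (Pt d)) : Prop :=
  IsConnected Ω ∧
    ∃ (n : ℕ) (s : Fin n → Fin (d + 1) → Pt d),
      (∀ k, AffineIndependent ℝ (s k)) ∧ Ω = interior (⋃ k, convexHull ℝ (range (s k)))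

/-- The surface measure on `∂Ω`: the normalised `(d-1)`-dimensional Hausdorff measure (length for
`d = 2`, area for `d = 3`). -/
def surfaceMeasure {d : ℕ} (Ω : Set (Pt d)) : Measure (Pt d) :=
  (Measure.euclideanHausdorffMeasure (d - 1) : Measure (Pt d)).restrict (frontier Ω)

/-! ### Function spaces in the space variable -/

/-- `L²(Ω)`. -/
abbrev L2 {d : ℕ} (Ω : Set (Pt d)) := Lp ℝ 2 ((volume : Measure (Pt d)).restrict Ω)

/-- `L²(Ω)^d` with its Hilbert norm. -/
abbrev L2Vec {d : ℕ} (Ω : Set (Pt d)) := PiLp 2 (fun _ : Fin d => L2 Ω)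

/-- `L²(∂Ω)`. -/
abbrev L2Bd {d : ℕ} (Ω : Set (Pt d)) := Lp ℝ 2 (surfaceMeasure Ω)

/-- `L²(∂Ω)^d` with its Hilbert norm. -/
abbrev L2BdVec {d : ℕ} (Ω : Set (Pt d)) := PiLp 2 (fun _ : Fin d => L2Bd Ω)

/-- The classical partial derivative `∂φ/∂x_i`. -/
def pderiv {d : ℕ} (i : Fin d) (φ : Pt d → ℝ) (x : Pt d) : ℝ :=
  fderiv ℝ φ x (EuclideanSpace.single i 1)

/-- `φ ∈ C_c^∞(Ω)`. -/
def IsTestFunction {d : ℕ} (Ω : Set (Pt d)) (φ : Pt d → ℝ) : Prop :=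
  ContDiff ℝ ∞ φ ∧ HasCompactSupport φ ∧ tsupport φ ⊆ Ω

/-- `h` is the weak partial derivative of `u` in direction `i` on `Ω`. -/
def IsWeakPartial {d : ℕ} (Ω : Set (Pt d)) (i : Fin d) (u h : L2 Ω) : Prop :=
  ∀ φ : Pt d → ℝ, IsTestFunction Ω φ →
    ∫ x in Ω, u x * pderiv i φ x = -∫ x in Ω, h x * φ x

theorem memLp_of_continuous {d : ℕ} {Ω : Set (Pt d)} {φ : Pt d → ℝ} (hc : Continuous φ)
    (hs : HasCompactSupport φ) : MemLp φ 2 ((volume : Measure (Pt d)).restrict Ω) :=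
  (hc.memLp_of_hasCompactSupport hs).restrict Ω

theorem IsTestFunction.memLp {d : ℕ} {Ω : Set (Pt d)} {φ : Pt d → ℝ} (h : IsTestFunction Ω φ) :
    MemLp φ 2 ((volume : Measure (Pt d)).restrict Ω) :=
  memLp_of_continuous h.1.continuous h.2.1

theorem IsTestFunction.memLp_pderiv {d : ℕ} {Ω : Set (Pt d)} {φ : Pt d → ℝ}
    (h : IsTestFunction Ω φ) (i : Fin d) :
    MemLp (pderiv i φ) 2 ((volume : Measure (Pt d)).restrict Ω) := by
  refine memLp_of_continuous ?_ (h.2.1.fderiv_apply ℝ _)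
  exact (h.1.continuous_fderiv (by simp)).clm_apply continuous_const

theorem integral_add_mul {d : ℕ} {Ω : Set (Pt d)} (u v : L2 Ω) {φ : Pt d → ℝ}
    (h : MemLp φ 2 ((volume : Measure (Pt d)).restrict Ω)) :
    ∫ x in Ω, (u + v : L2 Ω) x * φ x = (∫ x in Ω, u x * φ x) + ∫ x in Ω, v x * φ x := by
  have hu : Integrable (fun x => u x * φ x) (volume.restrict Ω) := (Lp.memLp u).integrable_mul h
  have hv : Integrable (fun x => v x * φ x) (volume.restrict Ω) := (Lp.memLp v).integrable_mul h
  rw [← integral_add hu hv]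
  refine integral_congr_ae ?_
  filter_upwards [Lp.coeFn_add u v] with x hx
  rw [hx, Pi.add_apply, add_mul]

theorem integral_smul_mul {d : ℕ} {Ω : Set (Pt d)} (c : ℝ) (u : L2 Ω) (φ : Pt d → ℝ) :
    ∫ x in Ω, (c • u : L2 Ω) x * φ x = c * ∫ x in Ω, u x * φ x := by
  rw [← integral_const_mul]
  refine integral_congr_ae ?_
  filter_upwards [Lp.coeFn_smul c u] with x hx
  rw [hx, Pi.smul_apply, smul_eq_mul, mul_assoc]

theorem integral_zero_mul {d : ℕ} {Ω : Set (Pt d)} (φ : Pt d → ℝ) :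
    ∫ x in Ω, (0 : L2 Ω) x * φ x = 0 := by
  have h := integral_smul_mul (0 : ℝ) (0 : L2 Ω) φ
  rwa [zero_smul, zero_mul] at h

/-- The Sobolev space `H¹(Ω)`: pairs `(u, ∇u)` of an `L²` function and its weak gradient, which lies
in `L²(Ω)^d`. Its norm is `(‖u‖² + ‖∇u‖²)^{1/2}`. -/
def H1 {d : ℕ} (Ω : Set (Pt d)) : Submodule ℝ (WithLp 2 (L2 Ω × L2Vec Ω)) where
  carrier := {w | ∀ i, IsWeakPartial Ω i w.fst (w.snd i)}
  add_mem' := by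
    intro a b ha hb i φ hφ
    have h1 := integral_add_mul a.fst b.fst (hφ.memLp_pderiv i)
    have h2 := integral_add_mul (a.snd i) (b.snd i) hφ.memLp
    simp only [WithLp.add_fst, WithLp.add_snd, PiLp.add_apply]
    rw [h1, h2, ha i φ hφ, hb i φ hφ]
    ring
  zero_mem' := by
    intro i φ _
    simp only [WithLp.zero_fst, WithLp.zero_snd, PiLp.zero_apply]
    rw [integral_zero_mul, integral_zero_mul, neg_zero]
  smul_mem' := by
    intro c a ha i φ hφ
    simp only [WithLp.smul_fst, WithLp.smul_snd, PiLp.smul_apply]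
    rw [integral_smul_mul, integral_smul_mul, ha i φ hφ]
    ring

/-- The underlying `L²` function of `u ∈ H¹(Ω)`. -/
def val {d : ℕ} {Ω : Set (Pt d)} : H1 Ω →L[ℝ] L2 Ω :=
  (WithLp.fstL 2 ℝ (L2 Ω) (L2Vec Ω)).comp (H1 Ω).subtypeL

/-- The weak gradient of `u ∈ H¹(Ω)`. -/
def grad {d : ℕ} {Ω : Set (Pt d)} : H1 Ω →L[ℝ] L2Vec Ω :=
  (WithLp.sndL 2 ℝ (L2 Ω) (L2Vec Ω)).comp (H1 Ω).subtypeL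

/-- `H¹(Ω)^d` with its Hilbert norm. -/
abbrev H1Vec {d : ℕ} (Ω : Set (Pt d)) := PiLp 2 (fun _ : Fin d => H1 Ω)

/-- The underlying `L²` vector field of `v ∈ H¹(Ω)^d`. -/
def valVec {d : ℕ} {Ω : Set (Pt d)} (v : H1Vec Ω) : L2Vec Ω :=
  WithLp.toLp 2 (fun i => val (v i))

/-- `div v = ∑_i ∂_i v_i`. -/
def div {d : ℕ} {Ω : Set (Pt d)} (v : H1Vec Ω) : L2 Ω :=
  ∑ i, grad (v i) i

/-- The strain `ε(v)_{ij} = (∂_j v_i + ∂_i v_j) / 2`, as an element of `L²(Ω)^{d × d}` with its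
Hilbert (Frobenius) norm and inner product. -/
def strain {d : ℕ} {Ω : Set (Pt d)} (v : H1Vec Ω) : PiLp 2 (fun _ : Fin d × Fin d => L2 Ω) :=
  WithLp.toLp 2 (fun ij => (1 / 2 : ℝ) • (grad (v ij.1) ij.2 + grad (v ij.2) ij.1))

/-- `h ∈ L²(∂Ω)` is the trace of `u ∈ H¹(Ω)`: there are smooth functions on `ℝ^d` that converge to
`u` in `H¹(Ω)` and whose restrictions to `∂Ω` converge to `h` in `L²(∂Ω)`. -/
def IsTrace {d : ℕ} {Ω : Set (Pt d)} (u : H1 Ω) (h : L2Bd Ω) : Prop :=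
  ∃ φ : ℕ → Pt d → ℝ, (∀ n, ContDiff ℝ ∞ (φ n)) ∧
    Tendsto (fun n => eLpNorm (fun x => φ n x - val u x) 2 (volume.restrict Ω)) atTop (𝓝 0) ∧
    (∀ i, Tendsto (fun n => eLpNorm (fun x => pderiv i (φ n) x - grad u i x) 2
      (volume.restrict Ω)) atTop (𝓝 0)) ∧
    Tendsto (fun n => eLpNorm (fun x => φ n x - h x) 2 (surfaceMeasure Ω)) atTop (𝓝 0)

/-- The componentwise trace of a vector field. -/
def IsTraceVec {d : ℕ} {Ω : Set (Pt d)} (v : H1Vec Ω) (h : L2BdVec Ω) : Prop :=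
  ∀ i, IsTrace (v i) (h i)

/-- An infinitesimal rigid motion `x ↦ a + B x` with `B` skew-symmetric (for `d = 3` these are the
maps `x ↦ a + b × x`). -/
def rigidMotion {d : ℕ} (a : Fin d → ℝ) (B : Matrix (Fin d) (Fin d) ℝ) (x : Pt d) (i : Fin d) : ℝ :=
  a i + ∑ j, B i j * x j

/-- `v` is `L²(Ω)`-orthogonal to all infinitesimal rigid motions. -/
def PerpRM {d : ℕ} {Ω : Set (Pt d)} (v : H1Vec Ω) : Prop :=
  ∀ (a : Fin d → ℝ) (B : Matrix (Fin d) (Fin d) ℝ), Bᵀ = -B →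
    ∑ i, ∫ x in Ω, val (v i) x * rigidMotion a B x i = 0

/-- The embedding `L²(Ω) → H¹(Ω)'`, `f ↦ (f, ·)`. -/
def toDual {d : ℕ} {Ω : Set (Pt d)} (f : L2 Ω) : H1 Ω →L[ℝ] ℝ :=
  (innerSL ℝ f).comp val

/-- `‖∇p₀‖_{L²(Ω)}`, with value `∞` if `p₀ ∉ H¹(Ω)`. -/
def gradNorm {d : ℕ} {Ω : Set (Pt d)} (p₀ : L2 Ω) : ℝ≥0∞ :=
  ⨅ (u : H1 Ω) (_ : val u = p₀), ENNReal.ofReal ‖grad u‖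

/-! ### Time dependence -/

/-- Lebesgue measure on `(0, T)`. -/
def timeMeasure (T : ℝ) : Measure ℝ := volume.restrict (Ioo 0 T)

/-- The `L^p(0, T; X)` norm, an extended nonnegative real. -/
def timeNorm {X : Type*} [NormedAddCommGroup X] (p : ℝ≥0∞) (T : ℝ) (w : ℝ → X) : ℝ≥0∞ :=
  eLpNorm w p (timeMeasure T)

/-- `w ∈ L^p(0, T; X)`. -/
def InLp {X : Type*} [NormedAddCommGroup X] (p : ℝ≥0∞) (T : ℝ) (w : ℝ → X) : Prop :=
  MemLp w p (timeMeasure T)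

/-- `w` has the (weak) time derivative `w'` on `(0, T)` and the initial value `w(0) = w₀`, that is,
(the absolutely continuous representative of) `w` is `w₀ + ∫₀ᵗ w'`. Meant for
`w' ∈ L¹(0, T; X)` and `X` complete. -/
def HasTimeDeriv {X : Type*} [NormedAddCommGroup X] [NormedSpace ℝ X] (T : ℝ) (w w' : ℝ → X)
    (w₀ : X) : Prop :=
  ∀ᵐ t ∂(timeMeasure T), w t = w₀ + ∫ s in (0 : ℝ)..t, w' s

/-! ### The Biot model with secondary consolidation -/

/-- The coefficients of the model: constrained specific storage coefficient `a₀`, Biot-Willis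
constant `b₀`, Lamé constants `β`, `γ`, secondary consolidation parameter `lamStar` (`λ*`), solvent
viscosity `θf`, permeability tensor `K` with ellipticity constants `K₁`, `K₂`, fluid density `ρf`
and gravitational acceleration `g`. -/
structure Coeffs (d : ℕ) where
  a₀ : ℝ
  b₀ : ℝ
  β : ℝ
  γ : ℝ
  lamStar : ℝ
  θf : ℝ
  K₁ : ℝ
  K₂ : ℝ
  K : Pt d → Matrix (Fin d) (Fin d) ℝ
  ρf : Pt d → ℝ
  g : Pt d

namespace Coeffs

variable {d : ℕ} (c : Coeffs d)

def χ₁ : ℝ := c.b₀ / (c.b₀ ^ 2 + c.β * c.a₀)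

def χ₂ : ℝ := c.β / (c.b₀ ^ 2 + c.β * c.a₀)

def χ₃ : ℝ := c.a₀ / (c.b₀ ^ 2 + c.β * c.a₀)

/-- The standing assumptions on the coefficients. -/
structure Admissible (Ω : Set (Pt d)) : Prop where
  a₀_pos : 0 < c.a₀
  b₀_pos : 0 < c.b₀
  β_nonneg : 0 ≤ c.β
  γ_pos : 0 < c.γ
  lamStar_nonneg : 0 ≤ c.lamStar
  θf_pos : 0 < c.θf
  K₁_pos : 0 < c.K₁
  K_meas : ∀ i j, AEStronglyMeasurable (fun x => c.K x i j) (volume.restrict Ω)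
  K_symm : ∀ᵐ x ∂(volume.restrict Ω), (c.K x).IsSymm
  K_bounds : ∀ᵐ x ∂(volume.restrict Ω), ∀ ζ : Fin d → ℝ,
    c.K₁ * (ζ ⬝ᵥ ζ) ≤ (c.K x *ᵥ ζ) ⬝ᵥ ζ ∧ (c.K x *ᵥ ζ) ⬝ᵥ ζ ≤ c.K₂ * (ζ ⬝ᵥ ζ)
  ρf_bdd : MemLp c.ρf ∞ (volume.restrict Ω)

/-- `(K (∇p - ρ_f g), ∇ψ)`. -/
def darcyForm {Ω : Set (Pt d)} (p ψ : H1 Ω) : ℝ :=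
  ∫ x in Ω, (c.K x *ᵥ fun j => grad p j x - c.ρf x * c.g j) ⬝ᵥ fun i => grad ψ i x

end Coeffs

/-- The (time-independent) data: initial displacement `τ₀ ∈ H¹(Ω)^d` and pressure `p₀ ∈ L²(Ω)`,
body force `F`, boundary traction `F₁`, source `φ` and boundary flux `φ₁`. -/
structure Data {d : ℕ} (Ω : Set (Pt d)) where
  τ₀ : H1Vec Ω
  p₀ : L2 Ω
  F : L2Vec Ω
  F₁ : L2BdVec Ω
  φ : L2 Ω
  φ₁ : L2Bd Ω

/-- `(F, r) + ⟨F₁, r⟩ = 0` for every infinitesimal rigid motion `r`. -/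
def Data.Compatible {d : ℕ} {Ω : Set (Pt d)} (D : Data Ω) : Prop :=
  ∀ (a : Fin d → ℝ) (B : Matrix (Fin d) (Fin d) ℝ), Bᵀ = -B →
    (∑ i, ∫ x in Ω, D.F i x * rigidMotion a B x i) +
      ∑ i, ∫ x, D.F₁ i x * rigidMotion a B x i ∂(surfaceMeasure Ω) = 0

/-- `(τ, δ, ϖ, p, q)` is a weak solution on `(0, T)` of the reformulated problem; `qt` stands for
`(div τ)_t` and `ϖt` for `ϖ_t`. The function `qt` enters the equations only through the product
`λ* qt`; accordingly it is tied to `div τ` only if `λ* > 0`. -/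
structure IsWeakSolution {d : ℕ} {Ω : Set (Pt d)} (T : ℝ) (c : Coeffs d) (D : Data Ω)
    (τ : ℝ → H1Vec Ω) (δ ϖ : ℝ → L2 Ω) (p : ℝ → H1 Ω) (q : ℝ → L2 Ω)
    (qt : ℝ → L2 Ω) (ϖt : ℝ → (H1 Ω →L[ℝ] ℝ)) : Prop where
  τ_mem : InLp ∞ T τ
  τ_perp : ∀ᵐ t ∂(timeMeasure T), PerpRM (τ t)
  δ_mem : InLp ∞ T δ
  ϖ_mem : InLp ∞ T ϖ
  ϖt_mem : InLp 2 T ϖt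
  p_mem : InLp ∞ T (fun t => val (p t))
  p_mem_H1 : InLp 2 T p
  q_mem : InLp ∞ T q
  qt_mem : InLp 2 T qt
  /-- `ϖ ∈ H¹(0, T; H¹(Ω)')` with derivative `ϖt` and `ϖ(0) = a₀ p₀ + b₀ div τ₀`. -/
  ϖ_deriv : HasTimeDeriv T (fun t => toDual (ϖ t)) ϖt (toDual (c.a₀ • D.p₀ + c.b₀ • div D.τ₀))
  /-- For `λ* > 0`, `div τ` has the derivative `qt` and `div τ(0) = div τ₀`. -/
  div_deriv : 0 < c.lamStar → HasTimeDeriv T (fun t => div (τ t)) qt (div D.τ₀)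
  momentum : ∀ᵐ t ∂(timeMeasure T), ∀ (v : H1Vec Ω) (h : L2BdVec Ω), IsTraceVec v h →
    c.γ * inner ℝ (strain (τ t)) (strain v) - inner ℝ (δ t) (div v) =
      inner ℝ D.F (valVec v) + inner ℝ D.F₁ h
  constraint : ∀ᵐ t ∂(timeMeasure T), ∀ η : L2 Ω,
    c.χ₃ * inner ℝ (δ t) η + inner ℝ (div (τ t)) η + c.lamStar * c.χ₃ * inner ℝ (qt t) η =
      c.χ₁ * inner ℝ (ϖ t) η
  diffusion : ∀ᵐ t ∂(timeMeasure T), ∀ (ψ : H1 Ω) (h : L2Bd Ω), IsTrace ψ h →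
    ϖt t ψ + 1 / c.θf * c.darcyForm (p t) ψ = inner ℝ D.φ (val ψ) + inner ℝ D.φ₁ h
  p_eq : ∀ᵐ t ∂(timeMeasure T),
    val (p t) = c.χ₁ • δ t + c.χ₂ • ϖ t + (c.lamStar * c.χ₁) • qt t
  q_eq : ∀ᵐ t ∂(timeMeasure T),
    q t = c.χ₁ • ϖ t - c.χ₃ • δ t - (c.lamStar * c.χ₃) • qt t

end Biot

end

open MeasureTheory Set Filter Topology
open scoped ENNReal ContDiff Matrix

noncomputable section

namespace Biot

/-! ### Averages over small translations -/

/-! The estimates come from one energy inequality. Inverting the two algebraic relations gives `ϖ =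
a₀ p + b₀ div τ` and `δ = b₀ p - β div τ - λ* (div τ)_t`. Formally one tests the momentum equation
with `τ_t` and the diffusion equation with `p`. The coupling terms `b₀ p div τ_t` cancel, and the
energy `γ/2 ‖ε(τ)‖² + β/2 ‖div τ‖² + a₀/2 ‖p‖² - ℓ(τ)`, with `ℓ` the time-independent load, has
derivative `⟨ϖ_t, p⟩ - λ* ‖(div τ)_t‖²`. Coercivity of `K` turns `⟨ϖ_t, p⟩` into a dissipation
`-‖∇p‖²` plus terms in the data. Everything is then absorbed by Young's inequality, and the norms in
the theorem are read off from `ε(τ)`, `p`, `(div τ)_t` and `∇p`.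

Since `τ_t` is not available, time derivatives are replaced by backward differences
(`ae_storedEnergy_le`). The solution is extended to `t ≤ 0` by the initial data. Convexity of the
quadratic energy gives the inequality for each step `h` (`storedEnergy_sub_le`), and the right-hand
sides are Steklov averages, which converge in `L²` as `h → 0`.

The load and the boundary flux are controlled by three facts about the domain: smooth functions are
dense in `H¹(Ω)`, so that every `H¹` function has a trace; traces are bounded; and Korn's inequality
holds on the complement of the rigid motions. A polygonal domain in the present sense need not be
Lipschitz, because simplices may touch at a vertex or along an edge, so these facts are proved
directly.

Density (`H1_le_closure_smoothSub`): call two facet hyperplanes independent if their normals are.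
Away from the intersections of independent facet hyperplanes the domain is locally a ball, a
half-ball or empty, hence stable under small shifts in an open set of directions, and a mollifier
supported in these directions never leaves the domain. The intersections have codimension two and
hence zero capacity in `L²`. Bounded functions do not see such sets, and a general function is
replaced by `N sin (v / N)`. All the limits here need only be weak, because a closed subspace of a
Hilbert space is its own double orthogonal.

Trace inequality and Korn: along a segment in direction `v` the derivative of `φ ⬝ v` involves only
the strain of `φ`. Joining a facet to `d + 1` points of the simplex bounds `φ` on the facet by `φ`
and its strain inside. On a convex set, `(φ(x) - φ(a)) ⬝ (x - a)` is controlled by the strain, and a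
field is recovered, up to such quantities and a rigid motion, from its values at `d + 1` points.
Connectedness of the domain and the finite number of simplices pass from convex sets to the whole
domain. -/

theorem eLpNorm_two_sq {α X : Type*} [MeasurableSpace α] [NormedAddCommGroup X] (f : α → X)
    (μ : Measure α) : eLpNorm f 2 μ ^ 2 = ∫⁻ x, ‖f x‖ₑ ^ 2 ∂μ := by
  have h := lintegral_rpow_enorm_eq_rpow_eLpNorm' (f := f) (μ := μ) (q := 2) (by norm_num)
  rw [eLpNorm_eq_eLpNorm' (by norm_num) (by norm_num)]
  simpa using h.symm

theorem eLpNorm_two_le_of_lintegral_le {α X : Type*} [MeasurableSpace α] [NormedAddCommGroup X]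
    {f : α → X} {μ : Measure α} {c : ℝ≥0∞} (h : ∫⁻ x, ‖f x‖ₑ ^ 2 ∂μ ≤ c ^ 2) :
    eLpNorm f 2 μ ≤ c := by
  rw [← eLpNorm_two_sq] at h
  exact (ENNReal.pow_le_pow_left_iff (by norm_num)).1 h

section Average

variable {G X : Type*} [NormedAddCommGroup G] [NormedSpace ℝ G] [FiniteDimensional ℝ G]
  [MeasurableSpace G] [BorelSpace G] [NormedAddCommGroup X]

/-- Translations act continuously on `L²`, and the orbit map `z ↦ f(· - z)` is continuous at `0`. -/
theorem tendsto_eLpNorm_translate (μ : Measure G) [μ.IsAddHaarMeasure] {f : G → X}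
    (hf : MemLp f 2 μ) :
    Tendsto (fun z => eLpNorm (fun x => f (x - z) - f x) 2 μ) (𝓝 0) (𝓝 0) := by
  have : Fact ((2 : ℝ≥0∞) ≠ (⊤ : ℝ≥0∞)) := ⟨by norm_num⟩
  have hcont : Continuous fun z : G => DomAddAct.mk (-z) +ᵥ hf.toLp f :=
    (DomAddAct.continuous_mk.comp continuous_neg).vadd continuous_const
  have h0 : Tendsto (fun z : G => edist (DomAddAct.mk (-z) +ᵥ hf.toLp f) (hf.toLp f)) (𝓝 0)
      (𝓝 0) := by
    have := (hcont.edist (continuous_const (y := hf.toLp f))).tendsto 0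
    simpa using this
  refine h0.congr fun z => ?_
  rw [Lp.edist_def]
  refine eLpNorm_congr_ae ?_
  have h1 := DomAddAct.vadd_Lp_ae_eq (DomAddAct.mk (-z)) (hf.toLp f)
  have h2 := hf.coeFn_toLp
  have h3 : ∀ᵐ x ∂μ, (hf.toLp f) (-z + x) = f (-z + x) :=
    (measurePreserving_add_left μ (-z)).quasiMeasurePreserving.ae h2
  filter_upwards [h1, h2, h3] with x hx1 hx2 hx3
  simp only [Pi.sub_apply, hx1, hx2]
  simp only [Equiv.symm_apply_apply, vadd_eq_add, hx3, sub_eq_neg_add x z]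

variable [NormedSpace ℝ X]

/-- Jensen's inequality for the square of the norm. No integrability of `f` is required. -/
theorem enorm_integral_sub_sq_le {α : Type*} [MeasurableSpace α] [CompleteSpace X] (ν : Measure α)
    [IsProbabilityMeasure ν] {f : α → X} (hf : AEStronglyMeasurable f ν) (c : X) :
    ‖(∫ z, f z ∂ν) - c‖ₑ ^ 2 ≤ ∫⁻ z, ‖f z - c‖ₑ ^ 2 ∂ν := by
  have hm : AEStronglyMeasurable (fun z => f z - c) ν := hf.sub aestronglyMeasurable_const
  by_cases hi : Integrable f ν
  · have h1 : (∫ z, f z ∂ν) - c = ∫ z, (f z - c) ∂ν := by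
      rw [integral_sub hi (integrable_const c)]; simp
    rw [h1, ← eLpNorm_two_sq]
    gcongr
    calc ‖∫ z, (f z - c) ∂ν‖ₑ ≤ ∫⁻ z, ‖f z - c‖ₑ ∂ν := enorm_integral_le_lintegral_enorm _
      _ = eLpNorm (fun z => f z - c) 1 ν := eLpNorm_one_eq_lintegral_enorm.symm
      _ ≤ _ := eLpNorm_le_eLpNorm_of_exponent_le (by norm_num) hm
  -- If `f` is not integrable, its integral has the default value `0`, but then the right-hand side
  -- is infinite: on a probability space a finite `L²` distance to a constant would make `f`
  -- integrable.
  · have : eLpNorm (fun z => f z - c) 2 ν = (⊤ : ℝ≥0∞) := by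
      by_contra h
      have hmem : MemLp (fun z => f z - c) 2 ν := ⟨hm, lt_top_iff_ne_top.2 h⟩
      have h2 := (hmem.integrable (by norm_num)).add (integrable_const c)
      exact hi (h2.congr (by filter_upwards with z; simp))
    rw [← eLpNorm_two_sq, this]
    simp

/-- Jensen in `z` for each fixed `x`, then Tonelli to integrate over `x` first. -/
theorem eLpNorm_average_sub_le [CompleteSpace X] (μ : Measure G) [μ.IsAddHaarMeasure] {f : G → X}
    (hf : StronglyMeasurable f) (ν : Measure G) [IsProbabilityMeasure ν] {c : ℝ≥0∞}
    (hc : ∀ᵐ z ∂ν, eLpNorm (fun x => f (x - z) - f x) 2 μ ≤ c) :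
    eLpNorm (fun x => (∫ z, f (x - z) ∂ν) - f x) 2 μ ≤ c := by
  refine eLpNorm_two_le_of_lintegral_le ?_
  have hm1 : StronglyMeasurable (fun q : G × G => f (q.1 - q.2)) :=
    hf.comp_measurable (measurable_fst.sub measurable_snd)
  have hm2 : StronglyMeasurable (fun q : G × G => f q.1) := hf.comp_measurable measurable_fst
  calc ∫⁻ x, ‖(∫ z, f (x - z) ∂ν) - f x‖ₑ ^ 2 ∂μ
      ≤ ∫⁻ x, ∫⁻ z, ‖f (x - z) - f x‖ₑ ^ 2 ∂ν ∂μ := lintegral_mono fun x =>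
        enorm_integral_sub_sq_le ν (hf.comp_measurable
          (measurable_const.sub measurable_id)).aestronglyMeasurable _
    _ = ∫⁻ z, ∫⁻ x, ‖f (x - z) - f x‖ₑ ^ 2 ∂μ ∂ν := by
        refine lintegral_lintegral_swap ?_
        exact ((hm1.sub hm2).enorm.pow_const 2).aemeasurable
    _ ≤ ∫⁻ _, c ^ 2 ∂ν := by
        refine lintegral_mono_ae ?_
        filter_upwards [hc] with z hz
        rw [← eLpNorm_two_sq]
        gcongr
    _ = c ^ 2 := by simp

/-- Averages of `f ∈ L²` over translations in a small ball are close to `f` in `L²`. -/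
theorem exists_eLpNorm_average_sub_le [CompleteSpace X] (μ : Measure G) [μ.IsAddHaarMeasure]
    {f : G → X} (hf : MemLp f 2 μ) {ε : ℝ≥0∞} (hε : 0 < ε) :
    ∃ δ > 0, ∀ ν : Measure G, IsProbabilityMeasure ν → ν ≪ μ →
      (∀ᵐ z ∂ν, ‖z‖ < δ) → eLpNorm (fun x => (∫ z, f (x - z) ∂ν) - f x) 2 μ ≤ ε := by
  have h1 := (tendsto_eLpNorm_translate μ hf).eventually (gt_mem_nhds hε)
  obtain ⟨δ, hδ, hball⟩ := Metric.eventually_nhds_iff.1 h1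
  refine ⟨δ, hδ, fun ν hν hac hz => ?_⟩
  obtain ⟨g, hg, hfg⟩ := hf.1
  -- Absolute continuity of `ν` lets the strongly measurable representative `g` replace `f` inside
  -- the average, for every `x`. Joint measurability in `(x, z)` is needed for Tonelli.
  have h2 : ∀ x, ∫ z, f (x - z) ∂ν = ∫ z, g (x - z) ∂ν := fun x => by
    refine integral_congr_ae (hac.ae_le ?_)
    exact (Measure.measurePreserving_sub_left μ x).quasiMeasurePreserving.ae hfg
  have h3 : ∀ z, eLpNorm (fun x => f (x - z) - f x) 2 μ =
      eLpNorm (fun x => g (x - z) - g x) 2 μ := fun z => by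
    refine eLpNorm_congr_ae ?_
    have h4 : ∀ᵐ x ∂μ, f (x - z) = g (x - z) :=
      (measurePreserving_sub_right μ z).quasiMeasurePreserving.ae hfg
    filter_upwards [hfg, h4] with x hx hx'
    rw [hx, hx']
  have h5 : eLpNorm (fun x => (∫ z, f (x - z) ∂ν) - f x) 2 μ =
      eLpNorm (fun x => (∫ z, g (x - z) ∂ν) - g x) 2 μ := by
    refine eLpNorm_congr_ae ?_
    filter_upwards [hfg] with x hx
    rw [h2, hx]
  rw [h5]
  refine eLpNorm_average_sub_le μ hg ν ?_
  filter_upwards [hz] with z hz'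
  rw [← h3]
  exact (hball (by simpa using hz')).le

end Average

/-! ### Smooth functions and multiplication by smooth functions in `L² × (L²)^d` -/

section Multiplication

variable {d : ℕ} {Ω : Set (Pt d)}

/-- The ambient Hilbert space of `H¹(Ω)`. -/
abbrev Jet {d : ℕ} (Ω : Set (Pt d)) := WithLp 2 (L2 Ω × L2Vec Ω)

theorem continuous_pderiv {φ : Pt d → ℝ} (h : ContDiff ℝ ∞ φ) (i : Fin d) :
    Continuous (pderiv i φ) :=
  (h.continuous_fderiv (by simp)).clm_apply continuous_const

theorem hasCompactSupport_pderiv {φ : Pt d → ℝ} (h : HasCompactSupport φ) (i : Fin d) :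
    HasCompactSupport (pderiv i φ) :=
  h.fderiv_apply ℝ _

theorem pderiv_add {φ ψ : Pt d → ℝ} (hφ : ContDiff ℝ ∞ φ) (hψ : ContDiff ℝ ∞ ψ) (i : Fin d)
    (x : Pt d) : pderiv i (fun y => φ y + ψ y) x = pderiv i φ x + pderiv i ψ x := by
  unfold pderiv
  rw [fderiv_fun_add (hφ.differentiable (by simp) x) (hψ.differentiable (by simp) x)]
  rfl

theorem pderiv_mul {φ ψ : Pt d → ℝ} (hφ : ContDiff ℝ ∞ φ) (hψ : ContDiff ℝ ∞ ψ) (i : Fin d)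
    (x : Pt d) :
    pderiv i (fun y => φ y * ψ y) x = pderiv i φ x * ψ x + φ x * pderiv i ψ x := by
  unfold pderiv
  rw [fderiv_fun_mul (hφ.differentiable (by simp) x) (hψ.differentiable (by simp) x)]
  simp only [add_apply, smul_apply, smul_eq_mul]
  ring

theorem pderiv_const_mul {φ : Pt d → ℝ} (hφ : ContDiff ℝ ∞ φ) (c : ℝ) (i : Fin d)
    (x : Pt d) : pderiv i (fun y => c * φ y) x = c * pderiv i φ x := by
  unfold pderiv
  rw [fderiv_const_mul (hφ.differentiable (by simp) x)]
  rfl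

/-- The restrictions to `Ω` of compactly supported smooth functions, with their gradients. -/
def smoothSub (Ω : Set (Pt d)) : Submodule ℝ (Jet Ω) where
  carrier := {w | ∃ φ : Pt d → ℝ, ContDiff ℝ ∞ φ ∧ HasCompactSupport φ ∧
    w.fst =ᵐ[volume.restrict Ω] φ ∧ ∀ i, w.snd i =ᵐ[volume.restrict Ω] pderiv i φ}
  add_mem' := by
    rintro a b ⟨φ, hφ, hφc, h1, h2⟩ ⟨ψ, hψ, hψc, h3, h4⟩
    refine ⟨fun x => φ x + ψ x, hφ.add hψ, hφc.add hψc, ?_, fun i => ?_⟩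
    · filter_upwards [Lp.coeFn_add a.fst b.fst, h1, h3] with x hx hx1 hx3
      rw [WithLp.add_fst, hx, Pi.add_apply, hx1, hx3]
    · filter_upwards [Lp.coeFn_add (a.snd i) (b.snd i), h2 i, h4 i] with x hx hx1 hx3
      rw [WithLp.add_snd, PiLp.add_apply, hx, Pi.add_apply, hx1, hx3, pderiv_add hφ hψ]
  zero_mem' := by
    refine ⟨fun _ => 0, contDiff_const, HasCompactSupport.zero, ?_, fun i => ?_⟩
    · exact Lp.coeFn_zero _ _ _
    · filter_upwards [Lp.coeFn_zero ℝ 2 (volume.restrict Ω)] with x hx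
      rw [WithLp.zero_snd, PiLp.zero_apply, hx]
      simp [pderiv]
  smul_mem' := by
    rintro c a ⟨φ, hφ, hφc, h1, h2⟩
    refine ⟨fun x => c * φ x, contDiff_const.mul hφ, hφc.mul_left, ?_, fun i => ?_⟩
    · filter_upwards [Lp.coeFn_smul c a.fst, h1] with x hx hx1
      rw [WithLp.smul_fst, hx, Pi.smul_apply, hx1, smul_eq_mul]
    · filter_upwards [Lp.coeFn_smul c (a.snd i), h2 i] with x hx hx1
      rw [WithLp.smul_snd, PiLp.smul_apply, hx, Pi.smul_apply, hx1, smul_eq_mul,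
        pderiv_const_mul hφ]

/-- The element of `smoothSub Ω` given by `φ`. -/
def jetOf (Ω : Set (Pt d)) (φ : Pt d → ℝ) (h : ContDiff ℝ ∞ φ) (hc : HasCompactSupport φ) :
    Jet Ω :=
  WithLp.toLp 2 ((memLp_of_continuous h.continuous hc).toLp φ, WithLp.toLp 2 fun i =>
    (memLp_of_continuous (continuous_pderiv h i) (hasCompactSupport_pderiv hc i)).toLp (pderiv i φ))

theorem jetOf_fst {φ : Pt d → ℝ} (h : ContDiff ℝ ∞ φ) (hc : HasCompactSupport φ) :
    (jetOf Ω φ h hc).fst =ᵐ[volume.restrict Ω] φ :=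
  MemLp.coeFn_toLp (memLp_of_continuous h.continuous hc)

theorem jetOf_snd {φ : Pt d → ℝ} (h : ContDiff ℝ ∞ φ) (hc : HasCompactSupport φ) (i : Fin d) :
    (jetOf Ω φ h hc).snd i =ᵐ[volume.restrict Ω] pderiv i φ :=
  MemLp.coeFn_toLp (memLp_of_continuous (continuous_pderiv h i) (hasCompactSupport_pderiv hc i))

theorem jetOf_mem {φ : Pt d → ℝ} (h : ContDiff ℝ ∞ φ) (hc : HasCompactSupport φ) :
    jetOf Ω φ h hc ∈ smoothSub Ω :=
  ⟨φ, h, hc, jetOf_fst h hc, jetOf_snd h hc⟩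

theorem tendsto_jet {ι : Type*} {l : Filter ι} {w : ι → Jet Ω} {w₀ : Jet Ω}
    (h1 : Tendsto (fun n => (w n).fst) l (𝓝 w₀.fst))
    (h2 : ∀ i, Tendsto (fun n => (w n).snd i) l (𝓝 (w₀.snd i))) : Tendsto w l (𝓝 w₀) := by
  have h3 : Tendsto (fun n => (w n).snd) l (𝓝 w₀.snd) := by
    have := (PiLp.continuous_toLp 2 (fun _ : Fin d => L2 Ω)).tendsto w₀.snd.ofLp
    exact this.comp (tendsto_pi_nhds.2 h2)
  have := (WithLp.prod_continuous_toLp 2 (L2 Ω) (L2Vec Ω)).tendsto (w₀.fst, w₀.snd)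
  exact this.comp (h1.prodMk_nhds h3)

theorem tendsto_L2_iff {μ : Measure (Pt d)} {ι : Type*} {l : Filter ι} {u : ι → Lp ℝ 2 μ}
    {φ : ι → Pt d → ℝ} {u₀ : Lp ℝ 2 μ} (h : ∀ n, u n =ᵐ[μ] φ n) :
    Tendsto u l (𝓝 u₀) ↔ Tendsto (fun n => eLpNorm (fun x => φ n x - u₀ x) 2 μ) l (𝓝 0) := by
  rw [Lp.tendsto_Lp_iff_tendsto_eLpNorm']
  have : ∀ n, eLpNorm (⇑(u n) - ⇑u₀) 2 μ = eLpNorm (fun x => φ n x - u₀ x) 2 μ := fun n => by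
    refine eLpNorm_congr_ae ?_
    filter_upwards [h n] with x hx
    rw [Pi.sub_apply, hx]
  simp only [this]

theorem mem_closure_smoothSub {w : Jet Ω}
    (h : ∀ ε : ℝ≥0∞, 0 < ε → ∃ φ : Pt d → ℝ, ContDiff ℝ ∞ φ ∧ HasCompactSupport φ ∧
      eLpNorm (fun x => φ x - w.fst x) 2 (volume.restrict Ω) ≤ ε ∧
      ∀ i, eLpNorm (fun x => pderiv i φ x - w.snd i x) 2 (volume.restrict Ω) ≤ ε) :
    w ∈ (smoothSub Ω).topologicalClosure := by
  have hpos : ∀ n : ℕ, (0 : ℝ≥0∞) < ((n : ℝ≥0∞) + 1)⁻¹ := fun n => by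
    rw [ENNReal.inv_pos]; finiteness
  choose φ hφ hc h1 h2 using fun n : ℕ => h _ (hpos n)
  have hlim : Tendsto (fun n : ℕ => ((n : ℝ≥0∞) + 1)⁻¹) atTop (𝓝 0) := by
    have := (tendsto_add_atTop_iff_nat 1).2 ENNReal.tendsto_inv_nat_nhds_zero
    simpa using this
  refine mem_closure_of_tendsto (b := atTop) (f := fun n => jetOf Ω (φ n) (hφ n) (hc n))
    (tendsto_jet ?_ fun i => ?_) (Eventually.of_forall fun n => jetOf_mem (hφ n) (hc n))
  · rw [tendsto_L2_iff fun n => jetOf_fst (hφ n) (hc n)]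
    exact tendsto_of_tendsto_of_tendsto_of_le_of_le tendsto_const_nhds hlim (fun _ => zero_le) h1
  · rw [tendsto_L2_iff fun n => jetOf_snd (hφ n) (hc n) i]
    exact tendsto_of_tendsto_of_tendsto_of_le_of_le tendsto_const_nhds hlim (fun _ => zero_le)
      fun n => h2 n i

theorem exists_seq_of_mem_closure_smoothSub {w : Jet Ω}
    (h : w ∈ (smoothSub Ω).topologicalClosure) :
    ∃ φ : ℕ → Pt d → ℝ, (∀ n, ContDiff ℝ ∞ (φ n)) ∧ (∀ n, HasCompactSupport (φ n)) ∧
      Tendsto (fun n => eLpNorm (fun x => φ n x - w.fst x) 2 (volume.restrict Ω)) atTop (𝓝 0) ∧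
      ∀ i, Tendsto (fun n => eLpNorm (fun x => pderiv i (φ n) x - w.snd i x) 2
        (volume.restrict Ω)) atTop (𝓝 0) := by
  obtain ⟨v, hv, hlim⟩ := mem_closure_iff_seq_limit.1 h
  choose φ h1 h2 h3 h4 using hv
  refine ⟨φ, h1, h2, ?_, fun i => ?_⟩
  · rw [← tendsto_L2_iff h3]
    exact ((WithLp.fstL 2 ℝ (L2 Ω) (L2Vec Ω)).continuous.tendsto w).comp hlim
  · rw [← tendsto_L2_iff fun n => h4 n i]
    exact ((PiLp.proj 2 (fun _ : Fin d => L2 Ω) i : L2Vec Ω →L[ℝ] L2 Ω).comp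
      (WithLp.sndL 2 ℝ (L2 Ω) (L2Vec Ω))).continuous.tendsto w |>.comp hlim

/-- The product of `u ∈ L²(Ω)` and a function that is bounded on `Ω`. -/
def mulL2 (η : Pt d → ℝ) (u : L2 Ω) : L2 Ω :=
  open scoped Classical in
  -- The value `0` is a default. It does not occur for continuous `η` on a bounded measurable `Ω`.
  if h : MemLp (fun x => η x * u x) 2 (volume.restrict Ω) then h.toLp _ else 0

theorem exists_bound_of_isBounded {η : Pt d → ℝ} (hη : Continuous η) (hΩ : Bornology.IsBounded Ω) :
    ∃ C > 0, ∀ x ∈ Ω, |η x| ≤ C := by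
  obtain ⟨C, hC⟩ := (hΩ.isCompact_closure).exists_bound_of_continuousOn hη.continuousOn
  refine ⟨max C 1, by positivity, fun x hx => (hC x (subset_closure hx)).trans (le_max_left _ _)⟩

theorem memLp_bdd_mul {μ : Measure (Pt d)} {η u : Pt d → ℝ} {C : ℝ} (hη : AEStronglyMeasurable η μ)
    (hC : ∀ᵐ x ∂μ, |η x| ≤ C) (hu : MemLp u 2 μ) : MemLp (fun x => η x * u x) 2 μ := by
  refine hu.of_le_mul (c := C) (hη.mul hu.1) ?_
  filter_upwards [hC] with x hx
  rw [norm_mul]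
  gcongr
  exact hx

theorem coeFn_mulL2 {η : Pt d → ℝ} (hη : Continuous η) (hΩ : Bornology.IsBounded Ω)
    (hm : MeasurableSet Ω) (u : L2 Ω) :
    mulL2 η u =ᵐ[volume.restrict Ω] fun x => η x * u x := by
  obtain ⟨C, -, hC⟩ := exists_bound_of_isBounded hη hΩ
  have h : MemLp (fun x => η x * u x) 2 (volume.restrict Ω) :=
    memLp_bdd_mul hη.aestronglyMeasurable (ae_restrict_of_forall_mem hm hC) (Lp.memLp u)
  rw [mulL2, dif_pos h]
  exact h.coeFn_toLp

/-- The product of `(u, g)` and a smooth function `η`: it is `(η u, η g + u ∇η)`. -/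
def mulJet (η : Pt d → ℝ) (w : Jet Ω) : Jet Ω :=
  WithLp.toLp 2 (mulL2 η w.fst,
    WithLp.toLp 2 fun i => mulL2 η (w.snd i) + mulL2 (pderiv i η) w.fst)

theorem mulJet_fst {η : Pt d → ℝ} (hη : ContDiff ℝ ∞ η) (hΩ : Bornology.IsBounded Ω)
    (hm : MeasurableSet Ω) (w : Jet Ω) :
    (mulJet η w).fst =ᵐ[volume.restrict Ω] fun x => η x * w.fst x :=
  coeFn_mulL2 hη.continuous hΩ hm _

theorem mulJet_snd {η : Pt d → ℝ} (hη : ContDiff ℝ ∞ η) (hΩ : Bornology.IsBounded Ω)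
    (hm : MeasurableSet Ω) (w : Jet Ω) (i : Fin d) :
    (mulJet η w).snd i =ᵐ[volume.restrict Ω]
      fun x => η x * w.snd i x + pderiv i η x * w.fst x := by
  filter_upwards [coeFn_mulL2 hη.continuous hΩ hm (w.snd i),
    coeFn_mulL2 (continuous_pderiv hη i) hΩ hm w.fst,
    Lp.coeFn_add (mulL2 η (w.snd i)) (mulL2 (pderiv i η) w.fst)] with x h1 h2 h3
  change (mulL2 η (w.snd i) + mulL2 (pderiv i η) w.fst : L2 Ω) x = _
  rw [h3, Pi.add_apply, h1, h2]

theorem jet_ext {v w : Jet Ω} (h1 : v.fst =ᵐ[volume.restrict Ω] w.fst)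
    (h2 : ∀ i, v.snd i =ᵐ[volume.restrict Ω] w.snd i) : v = w := by
  have h3 : v.fst = w.fst := Lp.ext h1
  have h4 : v.snd = w.snd := PiLp.ext fun i => Lp.ext (h2 i)
  exact (WithLp.ofLp_injective 2) (Prod.ext h3 h4)

theorem integrable_L2_mul {u : L2 Ω} {φ : Pt d → ℝ} (h : MemLp φ 2 (volume.restrict Ω)) :
    Integrable (fun x => u x * φ x) (volume.restrict Ω) :=
  (Lp.memLp u).integrable_mul h

end Multiplication

/-! ### Mollification in shifted directions -/

section LocalApproximation

variable {d : ℕ} {Ω : Set (Pt d)}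

theorem pderiv_comp_const_sub {k : Pt d → ℝ} (hk : ContDiff ℝ ∞ k) (x : Pt d) (i : Fin d) (y : Pt d) :
    pderiv i (fun t => k (x - t)) y = -pderiv i k (x - y) := by
  unfold pderiv
  have h := ((hk.differentiable (by simp) (x - y)).hasFDerivAt.comp y
    ((hasFDerivAt_id y).const_sub x)).fderiv
  change fderiv ℝ (k ∘ fun t => x - t) y _ = _
  rw [h]
  simp

/-- The kernel is a bump centred at `-s n` of radius smaller than `s κ`. If `x - y` lies in its
support, then `y = x + s z` with `‖z - n‖ < κ`, so averaging at `x` only uses values at points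
shifted from `x` in directions close to `n`. The measure `ν` has this kernel as its density. -/
theorem exists_shifted_mollifier (n : Pt d) {κ δ : ℝ} (hκ : 0 < κ) (hδ : 0 < δ) :
    ∃ (s : ℝ) (k : Pt d → ℝ) (ν : Measure (Pt d)), 0 < s ∧ ContDiff ℝ ∞ k ∧ HasCompactSupport k ∧
      (∀ z ∈ tsupport k, ‖z + s • n‖ < s * κ) ∧ (∀ z ∈ tsupport k, ‖z‖ < δ) ∧
      IsProbabilityMeasure ν ∧ ν ≪ volume ∧ (∀ᵐ z ∂ν, ‖z‖ < δ) ∧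
      ∀ (f : Pt d → ℝ) (x : Pt d), ∫ z, f (x - z) ∂ν = ∫ t, f t * k (x - t) := by
  -- This choice makes `s (‖n‖ + κ) < δ`, so the support of the kernel lies in the ball of radius
  -- `δ`.
  set s : ℝ := δ / (‖n‖ + κ + 1) with hs
  have hs0 : 0 < s := by positivity
  have hsδ : s * ‖n‖ + s * κ < δ := by
    have h1 : s * (‖n‖ + κ + 1) = δ := by rw [hs]; field_simp
    nlinarith
  let b : ContDiffBump (-(s • n)) := ⟨s * κ / 2 / 2, s * κ / 2, by positivity,
    half_lt_self (by positivity)⟩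
  set k : Pt d → ℝ := b.normed volume with hk
  have hkc : ContDiff ℝ ∞ k := b.contDiff_normed
  have hks : HasCompactSupport k := b.hasCompactSupport_normed
  have hk0 : ∀ z, 0 ≤ k z := fun z => b.nonneg_normed z
  have hksupp : tsupport k = Metric.closedBall (-(s • n)) (s * κ / 2) := b.tsupport_normed_eq
  have hkmem : ∀ z ∈ tsupport k, ‖z + s • n‖ ≤ s * κ / 2 := fun z hz => by
    rw [hksupp, Metric.mem_closedBall, dist_eq_norm, sub_neg_eq_add] at hz
    exact hz
  have hknorm : ∀ z ∈ tsupport k, ‖z‖ < δ := fun z hz => by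
    have h1 : ‖z‖ ≤ ‖z + s • n‖ + ‖s • n‖ := by
      simpa using norm_sub_le (z + s • n) (s • n)
    rw [norm_smul, Real.norm_of_nonneg hs0.le] at h1
    have := hkmem z hz
    have : 0 < s * κ := by positivity
    linarith
  let ν : Measure (Pt d) := volume.withDensity fun z => ENNReal.ofReal (k z)
  have hkmeas : Measurable fun z => ENNReal.ofReal (k z) :=
    (hkc.continuous.measurable).ennreal_ofReal
  have hν : IsProbabilityMeasure ν := ⟨by
    rw [withDensity_apply _ MeasurableSet.univ, Measure.restrict_univ,
      ← ofReal_integral_eq_lintegral_ofReal b.integrable_normed (Eventually.of_forall hk0),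
      b.integral_normed, ENNReal.ofReal_one]⟩
  have hac : ν ≪ volume := withDensity_absolutelyContinuous _ _
  have hνδ : ∀ᵐ z ∂ν, ‖z‖ < δ := by
    rw [ae_withDensity_iff hkmeas]
    refine Eventually.of_forall fun z hz => hknorm z (subset_tsupport _ ?_)
    intro h0
    exact hz (by simp [h0])
  have havg : ∀ (f : Pt d → ℝ) (x : Pt d), ∫ z, f (x - z) ∂ν = ∫ z, f (x - z) * k z := by
    intro f x
    rw [integral_withDensity_eq_integral_toReal_smul hkmeas (by simp)]
    refine integral_congr_ae (Eventually.of_forall fun z => ?_)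
    change (ENNReal.ofReal (k z)).toReal • f (x - z) = _
    rw [ENNReal.toReal_ofReal (hk0 z), smul_eq_mul, mul_comm]
  have hswap : ∀ (f : Pt d → ℝ) (x : Pt d), ∫ z, f (x - z) * k z = ∫ t, f t * k (x - t) := by
    intro f x
    rw [← integral_sub_left_eq_self (fun t => f t * k (x - t)) volume x]
    simp only [sub_sub_cancel]
  refine ⟨s, k, ν, hs0, hkc, hks, fun z hz => ?_, hknorm, hν, hac, hνδ, fun f x => ?_⟩
  · have := hkmem z hz
    have : 0 < s * κ := by positivity
    linarith
  · rw [havg, hswap]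

/-- The weak derivative is tested with `t ↦ η t * k (x - t)`. The derivative of `k (x - t)` in `t`
carries a minus sign and moves to the other side, and the derivative of `η` supplies the term `u ∇η`
of the product rule. -/
theorem integral_mollified_pderiv (hΩ : Bornology.IsBounded Ω) (hm : MeasurableSet Ω)
    {η : Pt d → ℝ} (hη : ContDiff ℝ ∞ η) (hηc : HasCompactSupport η) {w : Jet Ω} (hw : w ∈ H1 Ω)
    {k : Pt d → ℝ} (hkc : ContDiff ℝ ∞ k) (x : Pt d) (i : Fin d)
    (htest : IsTestFunction Ω fun t => η t * k (x - t)) :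
    ∫ t, Ω.indicator (mulJet η w).fst t * pderiv i k (x - t) =
      ∫ t, Ω.indicator ((mulJet η w).snd i) t * k (x - t) := by
  have hset : ∀ (f : Pt d → ℝ) (g : Pt d → ℝ), ∫ t, Ω.indicator f t * g t =
      ∫ t in Ω, f t * g t := fun f g => by
    rw [← integral_indicator hm]
    congr 1 with t
    by_cases ht : t ∈ Ω <;> simp [ht]
  have hkx : ContDiff ℝ ∞ fun t => k (x - t) := hkc.comp (contDiff_const.sub contDiff_id)
  have hweak := hw i _ htest
  have e1 : ∀ t, pderiv i (fun t => η t * k (x - t)) t =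
      pderiv i η t * k (x - t) - η t * pderiv i k (x - t) := fun t => by
    rw [pderiv_mul hη hkx, pderiv_comp_const_sub hkc]; ring
  have hkdx : Continuous fun t => pderiv i k (x - t) :=
    (continuous_pderiv hkc i).comp (continuous_const.sub continuous_id)
  have m1 : MemLp (fun t => pderiv i η t * k (x - t)) 2 (volume.restrict Ω) :=
    memLp_of_continuous ((continuous_pderiv hη i).mul hkx.continuous)
      (hasCompactSupport_pderiv hηc i).mul_right
  have m2 : MemLp (fun t => η t * pderiv i k (x - t)) 2 (volume.restrict Ω) :=
    memLp_of_continuous (hη.continuous.mul hkdx) hηc.mul_right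
  have e2 : ∫ t in Ω, w.fst t * pderiv i (fun t => η t * k (x - t)) t =
      (∫ t in Ω, w.fst t * (pderiv i η t * k (x - t))) -
        ∫ t in Ω, w.fst t * (η t * pderiv i k (x - t)) := by
    rw [← integral_sub (integrable_L2_mul m1) (integrable_L2_mul m2)]
    refine integral_congr_ae (Eventually.of_forall fun t => ?_)
    simp only [e1]; ring
  have e3 : ∫ t in Ω, (mulJet η w).fst t * pderiv i k (x - t) =
      ∫ t in Ω, w.fst t * (η t * pderiv i k (x - t)) := by
    refine integral_congr_ae ?_
    filter_upwards [mulJet_fst hη hΩ hm w] with t ht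
    rw [ht]; ring
  have e4 : ∫ t in Ω, (mulJet η w).snd i t * k (x - t) =
      (∫ t in Ω, w.snd i t * (η t * k (x - t))) +
        ∫ t in Ω, w.fst t * (pderiv i η t * k (x - t)) := by
    rw [← integral_add (integrable_L2_mul htest.memLp) (integrable_L2_mul m1)]
    refine integral_congr_ae ?_
    filter_upwards [mulJet_snd hη hΩ hm w i] with t ht
    rw [ht]; ring
  rw [hset, hset, e3, e4]
  linarith

/-- Near a point where `Ω` is stable under small shifts in the directions close to `n`, an `H¹`
function is approximated by mollifications. -/
theorem mulJet_mem_closure_of_shift (hΩ : Bornology.IsBounded Ω) (hm : MeasurableSet Ω)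
    {x₀ n : Pt d} {r κ : ℝ} (hκ : 0 < κ)
    (hshift : ∀ x ∈ Ω, x ∈ Metric.ball x₀ r → ∀ z : Pt d, ‖z - n‖ < κ → ∀ s : ℝ, 0 < s →
      x + s • z ∈ Metric.ball x₀ r → x + s • z ∈ Ω)
    {η : Pt d → ℝ} (hη : ContDiff ℝ ∞ η) (hηc : HasCompactSupport η)
    (hηs : tsupport η ⊆ Metric.ball x₀ r) {w : Jet Ω} (hw : w ∈ H1 Ω) :
    mulJet η w ∈ (smoothSub Ω).topologicalClosure := by
  refine mem_closure_smoothSub fun ε hε => ?_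
  set F : Pt d → ℝ := Ω.indicator (mulJet η w).fst with hF
  set G : Fin d → Pt d → ℝ := fun i => Ω.indicator ((mulJet η w).snd i) with hG
  have hFm : MemLp F 2 volume := (memLp_indicator_iff_restrict hm).2 (Lp.memLp _)
  have hGm : ∀ i, MemLp (G i) 2 volume := fun i => (memLp_indicator_iff_restrict hm).2 (Lp.memLp _)
  have hev : ∀ {f : Pt d → ℝ}, MemLp f 2 volume → ∀ᶠ δ in 𝓝[>] (0 : ℝ), ∀ ν : Measure (Pt d),
      IsProbabilityMeasure ν → ν ≪ volume → (∀ᵐ z ∂ν, ‖z‖ < δ) →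
        eLpNorm (fun x => (∫ z, f (x - z) ∂ν) - f x) 2 volume ≤ ε := fun hf => by
    obtain ⟨δ, hδ, h⟩ := exists_eLpNorm_average_sub_le volume hf hε
    filter_upwards [Ioo_mem_nhdsGT hδ] with δ' hδ' ν h1 h2 h3
    exact h ν h1 h2 (h3.mono fun z hz => hz.trans hδ'.2)
  -- A margin around the support of `η`: points within `ρ` of it are still in the ball where `Ω` is
  -- stable under shifts.
  obtain ⟨ρ, hρ, hρs⟩ := hηc.exists_thickening_subset_open Metric.isOpen_ball hηs
  have hρev : ∀ᶠ δ in 𝓝[>] (0 : ℝ), δ ∈ Ioo 0 ρ := Ioo_mem_nhdsGT hρ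
  obtain ⟨δ, ⟨hδF, hδG⟩, hδρ⟩ :=
    (((hev hFm).and (eventually_all.2 fun i => hev (hGm i))).and hρev).exists
  have hδ : 0 < δ := hδρ.1
  obtain ⟨s, k, ν, hs0, hkc, hks, hkmem, hknorm, hν, hac, hνδ, havg⟩ :=
    exists_shifted_mollifier n hκ hδ
  have hFloc : LocallyIntegrable F volume := hFm.locallyIntegrable (by norm_num)
  set φ : Pt d → ℝ := convolution F k (ContinuousLinearMap.mul ℝ ℝ) volume with hφ
  have hφx : ∀ x, φ x = ∫ z, F (x - z) ∂ν := fun x => by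
    rw [havg, hφ, convolution_mul]
  have hφd : ContDiff ℝ ∞ φ := hks.contDiff_convolution_right _ hFloc hkc
  have hφder : ∀ i x, pderiv i φ x = ∫ t, F t * pderiv i k (x - t) := by
    intro i x
    have h1 := (hks.hasFDerivAt_convolution_right (ContinuousLinearMap.mul ℝ ℝ) hFloc
      (hkc.of_le (by simp)) x).fderiv
    unfold pderiv
    rw [hφ, h1, convolution_precompR_apply _ hFloc (hks.fderiv ℝ)
      (hkc.continuous_fderiv (by simp)), convolution_mul]
  have hgrad : ∀ i, ∀ x ∈ Ω, pderiv i φ x = ∫ z, G i (x - z) ∂ν := by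
    intro i x hx
    rw [hφder, havg]
    have hkx : ContDiff ℝ ∞ fun t => k (x - t) := hkc.comp (contDiff_const.sub contDiff_id)
    -- This is where stability under shifts enters: for `x ∈ Ω`, a point `y` in both supports is `x
    -- + s z` with `z` close to `n`, hence lies in `Ω`. So the mollification of the extension by
    -- zero has, on `Ω`, the mollified gradient as its derivative, without a contribution of the
    -- jump across the boundary.
    have htest : IsTestFunction Ω fun t => η t * k (x - t) := by
      refine ⟨hη.mul hkx, hηc.mul_right, fun y hy => ?_⟩
      have hy1 : y ∈ tsupport η := tsupport_mul_subset_left hy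
      have hy2 : x - y ∈ tsupport k := by
        have h1 : y ∈ tsupport fun t => k (x - t) := tsupport_mul_subset_right hy
        have h2 : tsupport (fun t => k (x - t)) ⊆ (fun t => x - t) ⁻¹' tsupport k := by
          refine closure_minimal (fun t ht => subset_tsupport _ ht) ?_
          exact (isClosed_tsupport k).preimage (continuous_const.sub continuous_id)
        exact h2 h1
      have hxb : x ∈ Metric.ball x₀ r := by
        refine hρs (Metric.mem_thickening_iff.2 ⟨y, hy1, ?_⟩)
        rw [dist_eq_norm]
        exact (hknorm _ hy2).trans hδρ.2
      have hxy : x + s • (s⁻¹ • (y - x)) = y := by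
        rw [smul_inv_smul₀ hs0.ne']; abel
      have hz : ‖s⁻¹ • (y - x) - n‖ < κ := by
        have h1 : s⁻¹ • (y - x) - n = -(s⁻¹ • (x - y + s • n)) := by
          rw [smul_add, inv_smul_smul₀ hs0.ne', ← neg_sub y x, smul_neg]
          abel
        rw [h1, norm_neg, norm_smul, norm_inv, Real.norm_of_nonneg hs0.le, inv_mul_lt_iff₀ hs0]
        exact hkmem _ hy2
      have := hshift x hx hxb _ hz s hs0 (by rw [hxy]; exact hηs hy1)
      rwa [hxy] at this
    exact integral_mollified_pderiv hΩ hm hη hηc hw hkc x i htest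
  -- A cutoff equal to `1` on a ball containing `Ω` provides compact support and changes neither the
  -- values nor the derivatives on `Ω`.
  obtain ⟨θ, hθd, hθc, hθ1⟩ : ∃ θ : Pt d → ℝ, ContDiff ℝ ∞ θ ∧ HasCompactSupport θ ∧
      ∀ x ∈ Ω, θ =ᶠ[𝓝 x] φ := by
    obtain ⟨R, hR⟩ := hΩ.subset_ball (0 : Pt d)
    let c : ContDiffBump (0 : Pt d) := ⟨max R 1, max R 1 + 1, by positivity, by linarith⟩
    refine ⟨fun x => c x * φ x, c.contDiff.mul hφd, c.hasCompactSupport.mul_right, fun x hx => ?_⟩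
    have hxR : x ∈ Metric.ball (0 : Pt d) (max R 1) :=
      Metric.ball_subset_ball (le_max_left _ _) (hR hx)
    filter_upwards [Metric.isOpen_ball.mem_nhds hxR] with y hy
    rw [c.one_of_mem_closedBall (Metric.ball_subset_closedBall hy), one_mul]
  refine ⟨θ, hθd, hθc, ?_, fun i => ?_⟩
  · refine le_trans ?_ (hδF ν hν hac hνδ)
    refine le_trans (le_of_eq ?_) (eLpNorm_mono_measure _ (Measure.restrict_le_self (s := Ω)))
    refine eLpNorm_congr_ae ?_
    filter_upwards [ae_restrict_mem hm] with x hx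
    rw [(hθ1 x hx).self_of_nhds, hφx, hF, indicator_of_mem hx]
  · refine le_trans ?_ (hδG i ν hν hac hνδ)
    refine le_trans (le_of_eq ?_) (eLpNorm_mono_measure _ (Measure.restrict_le_self (s := Ω)))
    refine eLpNorm_congr_ae ?_
    filter_upwards [ae_restrict_mem hm] with x hx
    have h1 : pderiv i θ x = pderiv i φ x := by
      unfold pderiv
      rw [(hθ1 x hx).fderiv_eq]
    rw [h1, hgrad i x hx, hG]
    simp only [indicator_of_mem hx]

end LocalApproximation

/-! ### Partition of unity and removal of sets of zero capacity -/

section Patching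

open scoped Manifold

variable {d : ℕ} {Ω : Set (Pt d)}

/-- Near `x₀` the set `Ω` is stable under small shifts in an open set of directions. -/
def ShiftStable (Ω : Set (Pt d)) (x₀ : Pt d) : Prop :=
  ∃ r > 0, ∃ n : Pt d, ∃ κ > 0, ∀ x ∈ Ω, x ∈ Metric.ball x₀ r → ∀ z : Pt d, ‖z - n‖ < κ →
    ∀ s : ℝ, 0 < s → x + s • z ∈ Metric.ball x₀ r → x + s • z ∈ Ω

theorem mulJet_congr (hΩo : IsOpen Ω) {η η' : Pt d → ℝ} (h : ∀ x ∈ Ω, η x = η' x)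
    (hη : ContDiff ℝ ∞ η) (hη' : ContDiff ℝ ∞ η') (hΩ : Bornology.IsBounded Ω) (w : Jet Ω) :
    mulJet η w = mulJet η' w := by
  have hm := hΩo.measurableSet
  refine jet_ext ?_ fun i => ?_
  · filter_upwards [mulJet_fst hη hΩ hm w, mulJet_fst hη' hΩ hm w, ae_restrict_mem hm]
      with x h1 h2 h3
    rw [h1, h2, h x h3]
  · filter_upwards [mulJet_snd hη hΩ hm w i, mulJet_snd hη' hΩ hm w i, ae_restrict_mem hm]
      with x h1 h2 h3
    have h4 : pderiv i η x = pderiv i η' x := by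
      unfold pderiv
      rw [Filter.EventuallyEq.fderiv_eq (f := η')]
      filter_upwards [hΩo.mem_nhds h3] with y hy using h y hy
    rw [h1, h2, h x h3, h4]

theorem mulJet_add (hΩ : Bornology.IsBounded Ω) (hm : MeasurableSet Ω) {η η' : Pt d → ℝ}
    (hη : ContDiff ℝ ∞ η) (hη' : ContDiff ℝ ∞ η') (w : Jet Ω) :
    mulJet (fun x => η x + η' x) w = mulJet η w + mulJet η' w := by
  refine jet_ext ?_ fun i => ?_
  · rw [WithLp.add_fst]
    filter_upwards [mulJet_fst hη hΩ hm w, mulJet_fst hη' hΩ hm w, mulJet_fst (hη.add hη') hΩ hm w,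
      Lp.coeFn_add (mulJet η w).fst (mulJet η' w).fst] with x h1 h2 h3 h4
    rw [h4, Pi.add_apply, h1, h2, h3]; ring
  · rw [WithLp.add_snd, PiLp.add_apply]
    filter_upwards [mulJet_snd hη hΩ hm w i, mulJet_snd hη' hΩ hm w i,
      mulJet_snd (hη.add hη') hΩ hm w i,
      Lp.coeFn_add ((mulJet η w).snd i) ((mulJet η' w).snd i)] with x h1 h2 h3 h4
    rw [h4, Pi.add_apply, h1, h2, h3, pderiv_add hη hη']; ring

theorem mulJet_mul (hΩ : Bornology.IsBounded Ω) (hm : MeasurableSet Ω) {η η' : Pt d → ℝ}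
    (hη : ContDiff ℝ ∞ η) (hη' : ContDiff ℝ ∞ η') (w : Jet Ω) :
    mulJet (fun x => η x * η' x) w = mulJet η (mulJet η' w) := by
  refine jet_ext ?_ fun i => ?_
  · filter_upwards [mulJet_fst hη' hΩ hm w, mulJet_fst (hη.mul hη') hΩ hm w,
      mulJet_fst hη hΩ hm (mulJet η' w)] with x h2 h3 h4
    rw [h4, h2, h3]; ring
  · filter_upwards [mulJet_fst hη' hΩ hm w, mulJet_snd hη' hΩ hm w i,
      mulJet_snd (hη.mul hη') hΩ hm w i, mulJet_snd hη hΩ hm (mulJet η' w) i] with x h1 h2 h3 h4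
    rw [h4, h1, h2, h3, pderiv_mul hη hη']; ring

theorem mulJet_const (hΩ : Bornology.IsBounded Ω) (hm : MeasurableSet Ω) (c : ℝ) (w : Jet Ω) :
    mulJet (fun _ => c) w = c • w := by
  refine jet_ext ?_ fun i => ?_
  · rw [WithLp.smul_fst]
    filter_upwards [mulJet_fst contDiff_const hΩ hm w, Lp.coeFn_smul c w.fst] with x h1 h2
    rw [h1, h2, Pi.smul_apply, smul_eq_mul]
  · rw [WithLp.smul_snd, PiLp.smul_apply]
    filter_upwards [mulJet_snd contDiff_const hΩ hm w i, Lp.coeFn_smul c (w.snd i)] with x h1 h2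
    rw [h1, h2, Pi.smul_apply, smul_eq_mul]
    simp [pderiv]

/-- A smooth partition of unity on the compact set `closure Ω \ U`, subordinate to balls of shift
stability, reduces to the local result. The partition functions sum to `1` only off `U`, which
suffices because `χ` vanishes on `U`. -/
theorem mulJet_mem_closure_of_vanish (hΩ : Bornology.IsBounded Ω) (hΩo : IsOpen Ω)
    {U : Set (Pt d)} (hU : IsOpen U) (hst : ∀ x ∈ closure Ω, x ∉ U → ShiftStable Ω x)
    {χ : Pt d → ℝ} (hχ : ContDiff ℝ ∞ χ) (hχU : ∀ x ∈ U, χ x = 0) {w : Jet Ω} (hw : w ∈ H1 Ω) :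
    mulJet χ w ∈ (smoothSub Ω).topologicalClosure := by
  have hm := hΩo.measurableSet
  have hK : IsCompact (closure Ω \ U) := hΩ.isCompact_closure.diff hU
  choose! r hr n κ hκ hs using hst
  obtain ⟨t, htK, hcov⟩ := hK.elim_nhds_subcover (fun x => Metric.ball x (r x))
    fun x hx => Metric.ball_mem_nhds x (hr x hx.1 hx.2)
  obtain ⟨f, hf⟩ := SmoothPartitionOfUnity.exists_isSubordinate (I := 𝓘(ℝ, Pt d)) hK.isClosed
    (fun i : t => Metric.ball (i : Pt d) (r i)) (fun i => Metric.isOpen_ball) (by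
      intro x hx
      obtain ⟨y, hy, hxy⟩ := mem_iUnion₂.1 (hcov hx)
      exact mem_iUnion.2 ⟨⟨y, hy⟩, hxy⟩)
  have hfd : ∀ i, ContDiff ℝ ∞ (f i) := fun i => (f i).contMDiff.contDiff
  have hfc : ∀ i, HasCompactSupport (f i) := fun i =>
    (ProperSpace.isCompact_closedBall (i : Pt d) (r i)).of_isClosed_subset (isClosed_tsupport _)
      ((hf i).trans Metric.ball_subset_closedBall)
  have hpart : ∀ i, mulJet (fun x => f i x * χ x) w ∈ (smoothSub Ω).topologicalClosure := by
    intro i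
    have hi := htK i i.2
    refine mulJet_mem_closure_of_shift hΩ hm (hκ i hi.1 hi.2) (hs i hi.1 hi.2)
      ((hfd i).mul hχ) (hfc i).mul_right ?_ hw
    exact (tsupport_mul_subset_left).trans (hf i)
  have hsum : ∀ s : Finset t, ContDiff ℝ ∞ (fun x => ∑ i ∈ s, f i x * χ x) ∧
      mulJet (fun x => ∑ i ∈ s, f i x * χ x) w ∈ (smoothSub Ω).topologicalClosure := by
    classical
    intro s
    induction s using Finset.induction_on with
    | empty =>
      refine ⟨by simpa using contDiff_const, ?_⟩
      simp only [Finset.sum_empty]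
      rw [mulJet_const hΩ hm, zero_smul]
      exact Submodule.zero_mem _
    | insert a s ha ih =>
      simp only [Finset.sum_insert ha]
      refine ⟨((hfd a).mul hχ).add ih.1, ?_⟩
      rw [mulJet_add hΩ hm ((hfd a).mul hχ) ih.1]
      exact Submodule.add_mem _ (hpart a) ih.2
  rw [mulJet_congr hΩo (η' := fun x => ∑ i, f i x * χ x) ?_ hχ (hsum Finset.univ).1 hΩ]
  · exact (hsum Finset.univ).2
  · intro x hx
    rw [← Finset.sum_mul]
    by_cases hxU : x ∈ U
    · simp [hχU x hxU]
    · have h1 := f.sum_eq_one ⟨subset_closure hx, hxU⟩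
      rw [finsum_eq_sum_of_fintype] at h1
      rw [h1, one_mul]

/-- `Z` has zero capacity: there are cutoff functions that vanish near `Z`, tend to `1`, and whose
gradients are bounded in `L²(Ω)`. -/
def IsThin (Ω Z : Set (Pt d)) : Prop :=
  ∃ (ψ : ℕ → Pt d → ℝ) (C : ℝ≥0∞), C ≠ ⊤ ∧ (∀ n, ContDiff ℝ ∞ (ψ n)) ∧ (∀ n x, |ψ n x| ≤ 1) ∧
    (∀ n, ∃ U, IsOpen U ∧ Z ⊆ U ∧ ∀ x ∈ U, ψ n x = 0) ∧
    (∀ n i, eLpNorm (pderiv i (ψ n)) 2 (volume.restrict Ω) ≤ C) ∧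
    ∀ᵐ x ∂(volume.restrict Ω), ∀ᶠ n in atTop, ψ n x = 1 ∧ ∀ i, pderiv i (ψ n) x = 0

/-- A sequence bounded in `L²` that is eventually zero at almost every point converges weakly to
`0`. By Cauchy–Schwarz only the norm of `g` over `{h n ≠ 0}` matters, and this tends to `0` by
dominated convergence. -/
theorem tendsto_integral_mul_of_eventually_zero {α : Type*} [MeasurableSpace α] {μ : Measure α}
    {g : α → ℝ} (hg : MemLp g 2 μ) {h : ℕ → α → ℝ} (hh : ∀ n, StronglyMeasurable (h n))
    {C : ℝ≥0∞} (hC : C ≠ ⊤) (hb : ∀ n, eLpNorm (h n) 2 μ ≤ C)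
    (h0 : ∀ᵐ x ∂μ, ∀ᶠ n in atTop, h n x = 0) :
    Tendsto (fun n => ∫ x, g x * h n x ∂μ) atTop (𝓝 0) := by
  set S : ℕ → Set α := fun n => {x | h n x ≠ 0} with hS
  have hSm : ∀ n, MeasurableSet (S n) := fun n =>
    (hh n).measurable (measurableSet_singleton (0 : ℝ)).compl
  have hSg : Tendsto (fun n => eLpNorm ((S n).indicator g) 2 μ ^ 2) atTop (𝓝 0) := by
    simp only [eLpNorm_two_sq]
    have hlim : Tendsto (fun n => ∫⁻ x, ‖(S n).indicator g x‖ₑ ^ 2 ∂μ) atTop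
        (𝓝 (∫⁻ _, 0 ∂μ)) := by
      refine tendsto_lintegral_of_dominated_convergence' (fun x => ‖g x‖ₑ ^ 2)
        (fun n => ((hg.1.indicator (hSm n)).enorm.pow_const 2)) (fun n => ?_) ?_ ?_
      · refine Eventually.of_forall fun x => ?_
        exact pow_le_pow_left' (enorm_indicator_le_enorm_self _ _) 2
      · rw [← eLpNorm_two_sq]
        exact ENNReal.pow_ne_top hg.2.ne
      · filter_upwards [h0] with x hx
        refine tendsto_const_nhds.congr' ?_
        filter_upwards [hx] with n hn
        simp [hS, hn]
    simpa using hlim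
  have hle : ∀ n, ‖∫ x, g x * h n x ∂μ‖ₑ ≤ eLpNorm ((S n).indicator g) 2 μ * C := by
    intro n
    have h1 : ∀ x, g x * h n x = (S n).indicator g x * h n x := fun x => by
      by_cases hx : h n x = 0
      · simp [hx]
      · rw [indicator_of_mem (show x ∈ S n from hx)]
    calc ‖∫ x, g x * h n x ∂μ‖ₑ = ‖∫ x, (S n).indicator g x * h n x ∂μ‖ₑ := by simp only [h1]
      _ ≤ ∫⁻ x, ‖(S n).indicator g x * h n x‖ₑ ∂μ := enorm_integral_le_lintegral_enorm _
      _ = eLpNorm ((S n).indicator g • h n) 1 μ := by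
        rw [eLpNorm_one_eq_lintegral_enorm]; rfl
      _ ≤ eLpNorm ((S n).indicator g) 2 μ * eLpNorm (h n) 2 μ :=
        eLpNorm_smul_le_mul_eLpNorm (hh n).aestronglyMeasurable (hg.1.indicator (hSm n))
      _ ≤ _ := by gcongr; exact hb n
  have h2 : Tendsto (fun n => eLpNorm ((S n).indicator g) 2 μ) atTop (𝓝 0) := by
    have h4 : Tendsto (fun n => (eLpNorm ((S n).indicator g) 2 μ ^ 2) ^ (1 / 2 : ℝ)) atTop
        (𝓝 ((0 : ℝ≥0∞) ^ (1 / 2 : ℝ))) :=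
      ((ENNReal.continuous_rpow_const (y := 1 / 2)).tendsto 0).comp hSg
    rw [ENNReal.zero_rpow_of_pos (by norm_num)] at h4
    refine h4.congr fun n => ?_
    rw [← ENNReal.rpow_natCast, ← ENNReal.rpow_mul]
    norm_num
  have h3 : Tendsto (fun n => eLpNorm ((S n).indicator g) 2 μ * C) atTop (𝓝 0) := by
    simpa using ENNReal.Tendsto.mul_const h2 (Or.inr hC)
  rw [tendsto_zero_iff_enorm_tendsto_zero]
  exact tendsto_of_tendsto_of_tendsto_of_le_of_le tendsto_const_nhds h3 (fun _ => zero_le) hle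

theorem inner_jet (w z : Jet Ω) : inner ℝ w z =
    (∫ x in Ω, w.fst x * z.fst x) + ∑ i, ∫ x in Ω, w.snd i x * z.snd i x := by
  rw [WithLp.prod_inner_apply, PiLp.inner_apply]
  simp only [L2.inner_def]
  congr 1
  · refine integral_congr_ae (Eventually.of_forall fun x => ?_)
    simp [mul_comm]
  · refine Finset.sum_congr rfl fun i _ => integral_congr_ae (Eventually.of_forall fun x => ?_)
    simp [mul_comm]

theorem tendsto_integral_mul_of_dominated {w b : Pt d → ℝ} {μ : Measure (Pt d)}
    (hw : MemLp w 2 μ) (hb : MemLp b 2 μ) {a : ℕ → Pt d → ℝ} {a₀ : Pt d → ℝ}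
    (ha : ∀ n, AEStronglyMeasurable (a n) μ) (hab : ∀ n, ∀ᵐ x ∂μ, |a n x| ≤ |b x|)
    (hlim : ∀ᵐ x ∂μ, Tendsto (fun n => a n x) atTop (𝓝 (a₀ x))) :
    Tendsto (fun n => ∫ x, w x * a n x ∂μ) atTop (𝓝 (∫ x, w x * a₀ x ∂μ)) := by
  refine tendsto_integral_of_dominated_convergence (fun x => |w x * b x|)
    (fun n => hw.1.mul (ha n)) (hw.integrable_mul hb).abs (fun n => ?_) ?_
  · filter_upwards [hab n] with x hx
    rw [norm_mul, abs_mul, Real.norm_eq_abs, Real.norm_eq_abs]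
    gcongr
  · filter_upwards [hlim] with x hx
    exact hx.const_mul _

/-- Weak convergence of `ψ n * z` to `z`. In the gradient `ψ n ∇z + z ∇(ψ n)` the second term tends
weakly to `0` because `∇(ψ n)` is bounded in `L²` and eventually vanishes; boundedness of `z` keeps
its product with any `L²` function in `L²`. -/
theorem tendsto_inner_mulJet_thin (hΩ : Bornology.IsBounded Ω) (hm : MeasurableSet Ω)
    {ψ : ℕ → Pt d → ℝ} {C : ℝ≥0∞} (hC : C ≠ ⊤) (hψ : ∀ n, ContDiff ℝ ∞ (ψ n))
    (hψ1 : ∀ n x, |ψ n x| ≤ 1)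
    (hψC : ∀ n i, eLpNorm (pderiv i (ψ n)) 2 (volume.restrict Ω) ≤ C)
    (hψl : ∀ᵐ x ∂(volume.restrict Ω), ∀ᶠ n in atTop, ψ n x = 1 ∧ ∀ i, pderiv i (ψ n) x = 0)
    (w z : Jet Ω) {M : ℝ} (hz : ∀ᵐ x ∂(volume.restrict Ω), |z.fst x| ≤ M) :
    Tendsto (fun n => inner ℝ w (mulJet (ψ n) z)) atTop (𝓝 (inner ℝ w z)) := by
  have hle : ∀ n (u : Pt d → ℝ) x, |ψ n x * u x| ≤ |u x| := fun n u x => by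
    rw [abs_mul]
    exact mul_le_of_le_one_left (abs_nonneg _) (hψ1 n x)
  have hterm : ∀ u v : L2 Ω, Tendsto (fun n => ∫ x in Ω, u x * (ψ n x * v x)) atTop
      (𝓝 (∫ x in Ω, u x * v x)) := fun u v => by
    refine tendsto_integral_mul_of_dominated (Lp.memLp u) (Lp.memLp v)
      (fun n => (hψ n).continuous.aestronglyMeasurable.mul (Lp.memLp v).1)
      (fun n => Eventually.of_forall fun x => hle n v x) ?_
    filter_upwards [hψl] with x hx
    refine tendsto_const_nhds.congr' ?_
    filter_upwards [hx] with n hn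
    rw [hn.1, one_mul]
  have hgrad : ∀ i, Tendsto (fun n => ∫ x in Ω, (z.fst x * w.snd i x) * pderiv i (ψ n) x) atTop
      (𝓝 0) := fun i => by
    refine tendsto_integral_mul_of_eventually_zero
      (memLp_bdd_mul (Lp.memLp z.fst).1 hz (Lp.memLp (w.snd i)))
      (fun n => (continuous_pderiv (hψ n) i).stronglyMeasurable) hC (fun n => hψC n i) ?_
    filter_upwards [hψl] with x hx
    filter_upwards [hx] with n hn using hn.2 i
  have hψm : ∀ n (u : L2 Ω), MemLp (fun x => ψ n x * u x) 2 (volume.restrict Ω) := fun n u =>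
    memLp_bdd_mul (hψ n).continuous.aestronglyMeasurable (Eventually.of_forall (hψ1 n)) (Lp.memLp u)
  have hrew : ∀ n, inner ℝ w (mulJet (ψ n) z) = (∫ x in Ω, w.fst x * (ψ n x * z.fst x)) +
      ∑ i, ((∫ x in Ω, w.snd i x * (ψ n x * z.snd i x)) +
        ∫ x in Ω, (z.fst x * w.snd i x) * pderiv i (ψ n) x) := by
    intro n
    rw [inner_jet]
    congr 1
    · refine integral_congr_ae ?_
      filter_upwards [mulJet_fst (hψ n) hΩ hm z] with x hx
      rw [hx]
    · refine Finset.sum_congr rfl fun i _ => ?_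
      have hp : MemLp (pderiv i (ψ n)) 2 (volume.restrict Ω) :=
        ⟨(continuous_pderiv (hψ n) i).aestronglyMeasurable, (hψC n i).trans_lt hC.lt_top⟩
      have hi : Integrable (fun x => (z.fst x * w.snd i x) * pderiv i (ψ n) x)
          (volume.restrict Ω) :=
        (memLp_bdd_mul (Lp.memLp z.fst).1 hz (Lp.memLp (w.snd i))).integrable_mul hp
      rw [← integral_add (integrable_L2_mul (hψm n _)) hi]
      refine integral_congr_ae ?_
      filter_upwards [mulJet_snd (hψ n) hΩ hm z i] with x hx
      rw [hx]; ring
  simp only [hrew]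
  rw [inner_jet]
  refine (hterm _ _).add (tendsto_finsetSum _ fun i _ => ?_)
  simpa using (hterm (w.snd i) (z.snd i)).add (hgrad i)

/-- The closure of a subspace is its double orthogonal, so membership can be checked on weak limits.
-/
theorem mem_closure_of_orthogonal {v : Jet Ω}
    (h : ∀ w ∈ (smoothSub Ω)ᗮ, inner ℝ w v = 0) : v ∈ (smoothSub Ω).topologicalClosure := by
  rw [← Submodule.orthogonal_orthogonal_eq_closure, Submodule.mem_orthogonal]
  exact h

theorem inner_eq_zero_of_mem_closure {v w : Jet Ω} (hw : w ∈ (smoothSub Ω)ᗮ)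
    (hv : v ∈ (smoothSub Ω).topologicalClosure) : inner ℝ w v = 0 := by
  rw [← Submodule.orthogonal_orthogonal_eq_closure] at hv
  exact (Submodule.mem_orthogonal _ _).1 hv w hw

/-- Bounded `H¹` functions are limits of smooth functions if the bad part of the boundary is
a finite union of sets of zero capacity. -/
theorem mem_closure_of_bounded (hΩ : Bornology.IsBounded Ω) (hΩo : IsOpen Ω)
    {ι : Type*} (P : Finset ι) (Z : ι → Set (Pt d)) (hZ : ∀ p ∈ P, IsThin Ω (Z p))
    (hst : ∀ x ∈ closure Ω, (∀ p ∈ P, x ∉ Z p) → ShiftStable Ω x)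
    {v : Jet Ω} (hv : v ∈ H1 Ω) {M : ℝ} (hM : ∀ᵐ x ∂(volume.restrict Ω), |v.fst x| ≤ M) :
    v ∈ (smoothSub Ω).topologicalClosure := by
  classical
  have hm := hΩo.measurableSet
  -- Induction on the set `R` of bad pieces that are not yet cut out; those in `Q` are already
  -- covered by the open set `U` on which `χ` vanishes. With `R` empty, only shift-stable points
  -- remain outside `U`.
  have key : ∀ Q R : Finset ι, Q ∪ R = P → ∀ (χ : Pt d → ℝ) (U : Set (Pt d)), ContDiff ℝ ∞ χ →
      IsOpen U → (∀ p ∈ Q, Z p ⊆ U) → (∀ x ∈ U, χ x = 0) →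
      mulJet χ v ∈ (smoothSub Ω).topologicalClosure := by
    intro Q R
    induction R using Finset.induction_on generalizing Q with
    | empty =>
      intro hQ χ U hχ hU hQU hχU
      rw [Finset.union_empty] at hQ
      refine mulJet_mem_closure_of_vanish hΩ hΩo hU (fun x hx hxU => hst x hx fun p hp hxp => ?_)
        hχ hχU hv
      exact hxU (hQU p (hQ ▸ hp) hxp)
    | insert a R ha ih =>
      intro hQ χ U hχ hU hQU hχU
      have haP : a ∈ P := hQ ▸ Finset.mem_union_right _ (Finset.mem_insert_self a R)
      obtain ⟨ψ, C, hC, hψ, hψ1, hψU, hψC, hψl⟩ := hZ a haP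
      refine mem_closure_of_orthogonal fun w hw => ?_
      obtain ⟨B, hB, hχB⟩ := exists_bound_of_isBounded hχ.continuous hΩ
      have hz : ∀ᵐ x ∂(volume.restrict Ω), |(mulJet χ v).fst x| ≤ B * M := by
        filter_upwards [hM, mulJet_fst hχ hΩ hm v, ae_restrict_mem hm] with x h1 h2 h3
        rw [h2, abs_mul]
        exact mul_le_mul (hχB x h3) h1 (abs_nonneg _) hB.le
      -- The products `ψ n * χ * v` also vanish near the piece `a`, so the induction hypothesis
      -- applies to them, and they converge weakly to `χ * v`.
      have hlim := tendsto_inner_mulJet_thin hΩ hm hC hψ hψ1 hψC hψl w (mulJet χ v) hz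
      have h0 : ∀ n, inner ℝ w (mulJet (ψ n) (mulJet χ v)) = (0 : ℝ) := fun n => by
        refine inner_eq_zero_of_mem_closure hw ?_
        rw [← mulJet_mul hΩ hm (hψ n) hχ]
        obtain ⟨V, hV, hZV, hV0⟩ := hψU n
        refine ih (insert a Q) (by rw [← hQ]; ext; simp) _ (U ∪ V) ((hψ n).mul hχ)
          (hU.union hV) ?_ ?_
        · intro p hp
          rcases Finset.mem_insert.1 hp with rfl | hp
          · exact hZV.trans subset_union_right
          · exact (hQU p hp).trans subset_union_left
        · rintro x (hx | hx)
          · simp [hχU x hx]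
          · simp [hV0 x hx]
      exact tendsto_nhds_unique (hlim.congr h0) tendsto_const_nhds
  have h1 := key ∅ P (Finset.empty_union P) (fun _ => 1) ∅ contDiff_const isOpen_empty (by simp)
    (by simp)
  rwa [mulJet_const hΩ hm, one_smul] at h1

end Patching

/-! ### Truncation by `N sin (v / N)` and density of smooth functions -/

section ChainRule

open scoped Manifold

variable {d : ℕ} {Ω : Set (Pt d)}

theorem shiftStable_of_mem (hΩo : IsOpen Ω) {x : Pt d} (hx : x ∈ Ω) : ShiftStable Ω x := by
  obtain ⟨r, hr, hball⟩ := Metric.isOpen_iff.1 hΩo x hx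
  exact ⟨r, hr, 0, 1, one_pos, fun y _ _ z _ s _ h => hball h⟩

theorem tendsto_integral_of_le_mul {μ : Measure (Pt d)} {F : ℕ → Pt d → ℝ} {F₀ : Pt d → ℝ}
    {A B : ℕ → Pt d → ℝ} {a b : Pt d → ℝ} (hF : ∀ n, Integrable (F n) μ)
    (hF₀ : AEStronglyMeasurable F₀ μ) (hA : ∀ n, AEStronglyMeasurable (A n) μ)
    (hB : ∀ n, AEStronglyMeasurable (B n) μ) (ha : MemLp a 2 μ) (hb : MemLp b 2 μ)
    (hA0 : Tendsto (fun n => eLpNorm (A n) 2 μ) atTop (𝓝 0))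
    (hB0 : Tendsto (fun n => eLpNorm (B n) 2 μ) atTop (𝓝 0))
    (hle : ∀ n, ∀ᵐ x ∂μ, |F n x - F₀ x| ≤ |A n x| * |a x| + |B n x| * |b x|) :
    Tendsto (fun n => ∫ x, F n x ∂μ) atTop (𝓝 (∫ x, F₀ x ∂μ)) := by
  refine tendsto_integral_of_L1 F₀ hF₀ (Eventually.of_forall hF) ?_
  have hprod : ∀ {u v : Pt d → ℝ}, AEStronglyMeasurable u μ → AEStronglyMeasurable v μ →
      ∫⁻ x, ‖u x‖ₑ * ‖v x‖ₑ ∂μ ≤ eLpNorm u 2 μ * eLpNorm v 2 μ := fun {u v} hu hv => by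
    have h1 := eLpNorm_smul_le_mul_eLpNorm (p := 2) (q := 2) (r := 1) hv hu
    rw [eLpNorm_one_eq_lintegral_enorm] at h1
    simpa [enorm_mul] using h1
  have hbound : ∀ n, ∫⁻ x, ‖F n x - F₀ x‖ₑ ∂μ ≤
      eLpNorm (A n) 2 μ * eLpNorm a 2 μ + eLpNorm (B n) 2 μ * eLpNorm b 2 μ := fun n => by
    calc ∫⁻ x, ‖F n x - F₀ x‖ₑ ∂μ ≤ ∫⁻ x, (‖A n x‖ₑ * ‖a x‖ₑ + ‖B n x‖ₑ * ‖b x‖ₑ) ∂μ := by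
          refine lintegral_mono_ae ?_
          filter_upwards [hle n] with x hx
          simp only [Real.enorm_eq_ofReal_abs]
          rw [← ENNReal.ofReal_mul (abs_nonneg _), ← ENNReal.ofReal_mul (abs_nonneg _),
            ← ENNReal.ofReal_add (by positivity) (by positivity)]
          exact ENNReal.ofReal_le_ofReal hx
      _ = (∫⁻ x, ‖A n x‖ₑ * ‖a x‖ₑ ∂μ) + ∫⁻ x, ‖B n x‖ₑ * ‖b x‖ₑ ∂μ :=
          lintegral_add_left' ((hA n).enorm.mul ha.1.enorm) _
      _ ≤ _ := add_le_add (hprod (hA n) ha.1) (hprod (hB n) hb.1)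
  have hlim : Tendsto (fun n => eLpNorm (A n) 2 μ * eLpNorm a 2 μ +
      eLpNorm (B n) 2 μ * eLpNorm b 2 μ) atTop (𝓝 0) := by
    simpa using (ENNReal.Tendsto.mul_const hA0 (Or.inr ha.2.ne)).add
      (ENNReal.Tendsto.mul_const hB0 (Or.inr hb.2.ne))
  exact tendsto_of_tendsto_of_tendsto_of_le_of_le tendsto_const_nhds hlim (fun _ => zero_le) hbound

/-- The map `t ↦ N sin (t / N)` serves as a truncation: it is bounded by `N`, contracts distances,
tends to the identity as `N → ∞`, and is smooth, so that it maps smooth functions to smooth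
functions. -/
theorem abs_sin_div_sub_le {N : ℝ} (hN : 0 < N) (a b : ℝ) :
    |N * Real.sin (a / N) - N * Real.sin (b / N)| ≤ |a - b| := by
  have h := Real.abs_sin_sub_sin_le (a / N) (b / N)
  rw [← mul_sub, abs_mul, abs_of_pos hN]
  calc N * |Real.sin (a / N) - Real.sin (b / N)| ≤ N * |a / N - b / N| := by gcongr
    _ = |a - b| := by rw [← sub_div, abs_div, abs_of_pos hN]; field_simp

theorem memLp_sin_div {N : ℝ} (hN : 0 < N) (u : L2 Ω) :
    MemLp (fun x => N * Real.sin (u x / N)) 2 (volume.restrict Ω) := by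
  refine (Lp.memLp u).of_le ?_ (Eventually.of_forall fun x => ?_)
  · have hc : Continuous fun t : ℝ => N * Real.sin (t / N) := by fun_prop
    exact hc.comp_aestronglyMeasurable (Lp.memLp u).1
  · simpa using abs_sin_div_sub_le hN (u x) 0

theorem memLp_cos_div_mul (N : ℝ) (u v : L2 Ω) :
    MemLp (fun x => Real.cos (u x / N) * v x) 2 (volume.restrict Ω) := by
  refine memLp_bdd_mul (C := 1) ?_ (Eventually.of_forall fun x => Real.abs_cos_le_one _)
    (Lp.memLp v)
  have hc : Continuous fun t : ℝ => Real.cos (t / N) := by fun_prop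
  exact hc.comp_aestronglyMeasurable (Lp.memLp u).1

/-- The jet of `N sin (v / N)`. -/
def sinJet {N : ℝ} (hN : 0 < N) (v : Jet Ω) : Jet Ω :=
  WithLp.toLp 2 ((memLp_sin_div hN v.fst).toLp _,
    WithLp.toLp 2 fun i => (memLp_cos_div_mul N v.fst (v.snd i)).toLp _)

theorem sinJet_fst {N : ℝ} (hN : 0 < N) (v : Jet Ω) :
    (sinJet hN v).fst =ᵐ[volume.restrict Ω] fun x => N * Real.sin (v.fst x / N) :=
  (memLp_sin_div hN v.fst).coeFn_toLp

theorem sinJet_snd {N : ℝ} (hN : 0 < N) (v : Jet Ω) (i : Fin d) :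
    (sinJet hN v).snd i =ᵐ[volume.restrict Ω] fun x => Real.cos (v.fst x / N) * v.snd i x :=
  (memLp_cos_div_mul N v.fst (v.snd i)).coeFn_toLp

theorem pderiv_sin_div {N : ℝ} (hN : 0 < N) {f : Pt d → ℝ} (hf : ContDiff ℝ ∞ f) (i : Fin d)
    (x : Pt d) :
    pderiv i (fun y => N * Real.sin (f y / N)) x = Real.cos (f x / N) * pderiv i f x := by
  have h1 : HasFDerivAt f (fderiv ℝ f x) x := (hf.differentiable (by simp) x).hasFDerivAt
  have h2 := ((h1.mul_const N⁻¹).sin.const_mul N).fderiv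
  unfold pderiv
  simp only [div_eq_mul_inv]
  rw [h2]
  simp only [smul_apply, smul_eq_mul]
  field_simp

theorem setIntegral_mul_pderiv {f φ : Pt d → ℝ} (hf : ContDiff ℝ ∞ f) (hφ : IsTestFunction Ω φ)
    (i : Fin d) : ∫ x in Ω, f x * pderiv i φ x = -∫ x in Ω, pderiv i f x * φ x := by
  have hz : ∀ x, x ∉ Ω → φ x = 0 := fun x hx => by
    by_contra h
    exact hx (hφ.2.2 (subset_tsupport _ h))
  have hz' : ∀ x, x ∉ Ω → pderiv i φ x = 0 := fun x hx => by
    by_contra h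
    refine hx (hφ.2.2 (tsupport_fderiv_subset ℝ (subset_tsupport _ fun h0 => h ?_)))
    simp [pderiv, h0]
  rw [setIntegral_eq_integral_of_forall_compl_eq_zero fun x hx => by rw [hz' x hx, mul_zero],
    setIntegral_eq_integral_of_forall_compl_eq_zero fun x hx => by rw [hz x hx, mul_zero]]
  refine integral_mul_fderiv_eq_neg_fderiv_mul_of_integrable ?_ ?_ ?_
    (fun x _ => hf.differentiable (by simp) x) (fun x _ => hφ.1.differentiable (by simp) x)
  · exact ((continuous_pderiv hf i).mul hφ.1.continuous).integrable_of_hasCompactSupport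
      hφ.2.1.mul_left
  · exact (hf.continuous.mul (continuous_pderiv hφ.1 i)).integrable_of_hasCompactSupport
      (hasCompactSupport_pderiv hφ.2.1 i).mul_left
  · exact (hf.continuous.mul hφ.1.continuous).integrable_of_hasCompactSupport hφ.2.1.mul_left

theorem exists_cutoff {K : Set (Pt d)} (hK : IsCompact K) (hΩo : IsOpen Ω) (hKΩ : K ⊆ Ω) :
    ∃ (η : Pt d → ℝ) (t : Set (Pt d)), ContDiff ℝ ∞ η ∧ IsCompact t ∧ t ⊆ Ω ∧
      (∀ x ∉ t, η x = 0) ∧ ∀ x ∈ K, η =ᶠ[𝓝 x] fun _ => 1 := by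
  obtain ⟨t, ht, hKt, htΩ⟩ := exists_compact_between hK hΩo hKΩ
  obtain ⟨η, h1, h2, -⟩ := exists_contMDiffMap_one_nhds_of_subset_interior (n := (⊤ : ℕ∞)) 𝓘(ℝ, Pt d)
    hK.isClosed hKt
  exact ⟨η, t, η.contMDiff.contDiff, ht, htΩ, h2, fun x hx => h1.filter_mono (nhds_le_nhdsSet hx)⟩

/-- The chain rule is a statement on the support of a test function, a compact subset of `Ω`. After
a cutoff, the function is an `H¹` limit of smooth ones, for which the identity is classical
integration by parts, and both sides pass to the limit. -/
theorem sinJet_mem_H1 (hΩ : Bornology.IsBounded Ω) (hΩo : IsOpen Ω) {N : ℝ} (hN : 0 < N)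
    {v : Jet Ω} (hv : v ∈ H1 Ω) : sinJet hN v ∈ H1 Ω := by
  intro i φ hφ
  have hm := hΩo.measurableSet
  obtain ⟨η, t, hη, ht, htΩ, hηt, hηK⟩ := exists_cutoff hφ.2.1 hΩo hφ.2.2
  set z := mulJet η v with hz
  -- Only points of the compact set `t ⊆ Ω` are relevant, and interior points are trivially
  -- shift-stable, so no regularity of the boundary is used.
  have hzcl : z ∈ (smoothSub Ω).topologicalClosure :=
    mulJet_mem_closure_of_vanish hΩ hΩo ht.isClosed.isOpen_compl
      (fun x _ hx => shiftStable_of_mem hΩo (htΩ (not_not.1 hx))) hη (fun x hx => hηt x hx) hv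
  obtain ⟨f, hf, hfc, hf0, hf1⟩ := exists_seq_of_mem_closure_smoothSub hzcl
  obtain ⟨B, hB⟩ := hφ.2.1.exists_bound_of_continuous hφ.1.continuous
  have hc1 : Continuous fun s : ℝ => N * Real.sin (s / N) := by fun_prop
  have hc2 : Continuous fun s : ℝ => Real.cos (s / N) := by fun_prop
  have hmA : ∀ n, AEStronglyMeasurable (fun x => f n x - z.fst x) (volume.restrict Ω) := fun n =>
    (hf n).continuous.aestronglyMeasurable.sub (Lp.memLp _).1
  have hmB : ∀ n, AEStronglyMeasurable (fun x => pderiv i (f n) x - z.snd i x)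
      (volume.restrict Ω) := fun n =>
    (continuous_pderiv (hf n) i).aestronglyMeasurable.sub (Lp.memLp _).1
  have lim1 : Tendsto (fun n => ∫ x in Ω, (N * Real.sin (f n x / N)) * pderiv i φ x) atTop
      (𝓝 (∫ x in Ω, (N * Real.sin (z.fst x / N)) * pderiv i φ x)) := by
    refine tendsto_integral_of_le_mul (A := fun n x => f n x - z.fst x)
      (B := fun n x => f n x - z.fst x) (a := pderiv i φ) (b := fun _ => 0) (fun n => ?_)
      ?_ hmA hmA (hφ.memLp_pderiv i) MemLp.zero hf0 hf0 (fun n => Eventually.of_forall fun x => ?_)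
    · exact ((hc1.comp (hf n).continuous).mul (continuous_pderiv hφ.1 i)).integrable_of_hasCompactSupport
        (hasCompactSupport_pderiv hφ.2.1 i).mul_left |>.restrict
    · exact (hc1.comp_aestronglyMeasurable (Lp.memLp _).1).mul
        (continuous_pderiv hφ.1 i).aestronglyMeasurable
    · rw [← sub_mul, abs_mul]
      simp only [abs_zero, mul_zero, add_zero]
      exact mul_le_mul_of_nonneg_right (abs_sin_div_sub_le hN _ _) (abs_nonneg _)
  have lim2 : Tendsto (fun n => ∫ x in Ω, (Real.cos (f n x / N) * pderiv i (f n) x) * φ x) atTop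
      (𝓝 (∫ x in Ω, (Real.cos (z.fst x / N) * z.snd i x) * φ x)) := by
    refine tendsto_integral_of_le_mul (A := fun n x => pderiv i (f n) x - z.snd i x)
      (B := fun n x => f n x - z.fst x) (a := φ) (b := fun x => (B / N) * z.snd i x) (fun n => ?_)
      ?_ hmB hmA hφ.memLp ((Lp.memLp (z.snd i)).const_mul _) (hf1 i) hf0
      (fun n => Eventually.of_forall fun x => ?_)
    · exact (((hc2.comp (hf n).continuous).mul (continuous_pderiv (hf n) i)).mul
        hφ.1.continuous).integrable_of_hasCompactSupport hφ.2.1.mul_left |>.restrict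
    · exact ((hc2.comp_aestronglyMeasurable (Lp.memLp _).1).mul (Lp.memLp _).1).mul
        hφ.1.continuous.aestronglyMeasurable
    · have h1 : |Real.cos (f n x / N) - Real.cos (z.fst x / N)| ≤ |f n x - z.fst x| / N := by
        refine (Real.abs_cos_sub_cos_le _ _).trans_eq ?_
        rw [← sub_div, abs_div, abs_of_pos hN]
      -- The difference is split so that each summand contains one factor tending to `0` in `L²` and
      -- one fixed `L²` function; the prefactor cosine is bounded by `1`.
      have h2 : Real.cos (f n x / N) * pderiv i (f n) x * φ x -
          Real.cos (z.fst x / N) * z.snd i x * φ x =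
          Real.cos (f n x / N) * ((pderiv i (f n) x - z.snd i x) * φ x) +
            (Real.cos (f n x / N) - Real.cos (z.fst x / N)) * (z.snd i x * φ x) := by ring
      rw [h2]
      refine (abs_add_le _ _).trans (add_le_add ?_ ?_)
      · rw [abs_mul, abs_mul]
        exact mul_le_of_le_one_left (by positivity) (Real.abs_cos_le_one _)
      · have hB0 : 0 ≤ B := (norm_nonneg _).trans (hB x)
        rw [abs_mul, abs_mul, abs_mul, abs_of_nonneg (div_nonneg hB0 hN.le)]
        calc _ ≤ |f n x - z.fst x| / N * (|z.snd i x| * B) := by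
              gcongr
              exact hB x
          _ = _ := by ring
  have hibp : ∀ n, ∫ x in Ω, (N * Real.sin (f n x / N)) * pderiv i φ x =
      -∫ x in Ω, (Real.cos (f n x / N) * pderiv i (f n) x) * φ x := fun n => by
    have hg : ContDiff ℝ ∞ fun x => N * Real.sin (f n x / N) :=
      contDiff_const.mul (Real.contDiff_sin.comp ((hf n).div_const N))
    rw [setIntegral_mul_pderiv hg hφ]
    simp only [pderiv_sin_div hN (hf n)]
  have heq := tendsto_nhds_unique (lim1.congr hibp) lim2.neg
  have hK : ∀ x, x ∉ tsupport φ → φ x = 0 ∧ pderiv i φ x = 0 := fun x hx =>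
    ⟨image_eq_zero_of_notMem_tsupport hx, by
      have := image_eq_zero_of_notMem_tsupport (fun h => hx (tsupport_fderiv_subset ℝ h))
      simp [pderiv, this]⟩
  have e1 : ∫ x in Ω, (sinJet hN v).fst x * pderiv i φ x =
      ∫ x in Ω, (N * Real.sin (z.fst x / N)) * pderiv i φ x := by
    refine integral_congr_ae ?_
    filter_upwards [sinJet_fst hN v, mulJet_fst hη hΩ hm v] with x h1 h2
    by_cases hx : x ∈ tsupport φ
    · rw [h1, hz, h2, (hηK x hx).self_of_nhds, one_mul]
    · rw [(hK x hx).2, mul_zero, mul_zero]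
  have e2 : ∫ x in Ω, (sinJet hN v).snd i x * φ x =
      ∫ x in Ω, (Real.cos (z.fst x / N) * z.snd i x) * φ x := by
    refine integral_congr_ae ?_
    filter_upwards [sinJet_snd hN v i, mulJet_fst hη hΩ hm v, mulJet_snd hη hΩ hm v i]
      with x h1 h2 h3
    by_cases hx : x ∈ tsupport φ
    · have h4 : pderiv i η x = 0 := by
        unfold pderiv
        rw [(hηK x hx).fderiv_eq]
        simp
      rw [h1, hz, h2, h3, (hηK x hx).self_of_nhds, h4]
      ring_nf
    · rw [(hK x hx).1, mul_zero, mul_zero]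
  rw [e1, e2, heq]

/-- Smooth functions are dense in `H¹(Ω)` if the boundary is regular up to a finite union of sets of
zero capacity. -/
theorem H1_le_closure_smoothSub (hΩ : Bornology.IsBounded Ω) (hΩo : IsOpen Ω)
    {ι : Type*} (P : Finset ι) (Z : ι → Set (Pt d)) (hZ : ∀ p ∈ P, IsThin Ω (Z p))
    (hst : ∀ x ∈ closure Ω, (∀ p ∈ P, x ∉ Z p) → ShiftStable Ω x) :
    H1 Ω ≤ (smoothSub Ω).topologicalClosure := by
  intro v hv
  refine mem_closure_of_orthogonal fun w hw => ?_
  have hN : ∀ n : ℕ, (0 : ℝ) < n + 1 := fun n => by positivity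
  have h0 : ∀ n : ℕ, inner ℝ w (sinJet (hN n) v) = (0 : ℝ) := fun n => by
    refine inner_eq_zero_of_mem_closure hw (mem_closure_of_bounded hΩ hΩo P Z hZ hst
      (sinJet_mem_H1 hΩ hΩo (hN n) hv) (M := n + 1) ?_)
    filter_upwards [sinJet_fst (hN n) v] with x hx
    rw [hx, abs_mul, abs_of_pos (hN n)]
    exact mul_le_of_le_one_right (hN n).le (Real.abs_sin_le_one _)
  have hinv : ∀ a : ℝ, Tendsto (fun n : ℕ => a / ((n : ℝ) + 1)) atTop (𝓝 0) := fun a => by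
    simpa [div_eq_mul_inv] using
      (tendsto_one_div_add_atTop_nhds_zero_nat (𝕜 := ℝ)).const_mul a
  -- With `N = n + 1`, `N sin (a / N) = a sinc (a / N)`, and `sinc` is continuous with value `1` at
  -- `0`.
  have hsin : ∀ a : ℝ, Tendsto (fun n : ℕ => ((n : ℝ) + 1) * Real.sin (a / (n + 1))) atTop
      (𝓝 a) := fun a => by
    have h1 : Tendsto (fun n : ℕ => a * Real.sinc (a / ((n : ℝ) + 1))) atTop
        (𝓝 (a * Real.sinc 0)) :=
      ((Real.continuous_sinc.tendsto 0).comp (hinv a)).const_mul a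
    rw [Real.sinc_zero, mul_one] at h1
    refine h1.congr fun n => ?_
    by_cases ha : a = 0
    · simp [ha]
    · have := hN n
      rw [Real.sinc_of_ne_zero (div_ne_zero ha this.ne')]
      field_simp
  have hcos : ∀ a b : ℝ, Tendsto (fun n : ℕ => Real.cos (a / ((n : ℝ) + 1)) * b) atTop
      (𝓝 b) := fun a b => by
    simpa using ((Real.continuous_cos.tendsto 0).comp (hinv a)).mul_const b
  have hlim : Tendsto (fun n : ℕ => inner ℝ w (sinJet (hN n) v)) atTop (𝓝 (inner ℝ w v)) := by
    simp only [inner_jet]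
    refine Tendsto.add ?_ (tendsto_finsetSum _ fun i _ => ?_)
    · refine tendsto_integral_mul_of_dominated (Lp.memLp _) (Lp.memLp v.fst)
        (fun n => (Lp.memLp _).1) (fun n => ?_) ?_
      · filter_upwards [sinJet_fst (hN n) v] with x hx
        rw [hx]
        simpa using abs_sin_div_sub_le (hN n) (v.fst x) 0
      · filter_upwards [ae_all_iff.2 fun n => sinJet_fst (hN n) v] with x hx
        exact (hsin _).congr fun n => (hx n).symm
    · refine tendsto_integral_mul_of_dominated (Lp.memLp _) (Lp.memLp (v.snd i))
        (fun n => (Lp.memLp _).1) (fun n => ?_) ?_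
      · filter_upwards [sinJet_snd (hN n) v i] with x hx
        rw [hx, abs_mul]
        exact mul_le_of_le_one_left (abs_nonneg _) (Real.abs_cos_le_one _)
      · filter_upwards [ae_all_iff.2 fun n => sinJet_snd (hN n) v i] with x hx
        exact (hcos _ _).congr fun n => (hx n).symm
  exact tendsto_nhds_unique (hlim.congr h0) tendsto_const_nhds

end ChainRule

/-! ### Affine subspaces of codimension two have zero capacity -/

section Codimension

variable {d : ℕ} {Ω : Set (Pt d)}

theorem isClosed_abs_add_le (l : Pt d →L[ℝ] ℝ) (c r : ℝ) : IsClosed {x : Pt d | |l x + c| ≤ r} :=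
  isClosed_le (by fun_prop) continuous_const

theorem isOpen_abs_add_lt (l : Pt d →L[ℝ] ℝ) (c r : ℝ) : IsOpen {x : Pt d | |l x + c| < r} :=
  isOpen_lt (by fun_prop) continuous_const

/-- A packing argument: about `ε⁻²` disjoint translates of the tube, all of the same volume, fit
into a fixed ball. The dual vectors `u₁`, `u₂` translate the two coordinates `l₁`, `l₂`
independently. -/
theorem exists_volume_tube_le (hΩ : Bornology.IsBounded Ω) {l₁ l₂ : Pt d →L[ℝ] ℝ} (c₁ c₂ : ℝ)
    {u₁ u₂ : Pt d} (h₁₁ : l₁ u₁ = 1) (h₁₂ : l₁ u₂ = 0) (h₂₁ : l₂ u₁ = 0) (h₂₂ : l₂ u₂ = 1) :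
    ∃ C : ℝ≥0∞, C ≠ ⊤ ∧ ∀ ε : ℝ, 0 < ε → ε ≤ 1 →
      volume {x | x ∈ Ω ∧ |l₁ x + c₁| ≤ 2 * ε ∧ |l₂ x + c₂| ≤ 2 * ε} ≤ C * ENNReal.ofReal (ε ^ 2) := by
  obtain ⟨R, hR⟩ := hΩ.subset_closedBall (0 : Pt d)
  set R' : ℝ := R + 10 * (‖u₁‖ + ‖u₂‖) with hR'
  refine ⟨volume (Metric.closedBall (0 : Pt d) R'), measure_closedBall_lt_top.ne,
    fun ε hε hε1 => ?_⟩
  set T : Set (Pt d) :=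
    {x | x ∈ Metric.closedBall (0 : Pt d) R ∧ |l₁ x + c₁| ≤ 2 * ε ∧ |l₂ x + c₂| ≤ 2 * ε} with hT
  have hTm : MeasurableSet T := by
    exact Metric.isClosed_closedBall.measurableSet.inter
      ((isClosed_abs_add_le l₁ c₁ _).measurableSet.inter
        (isClosed_abs_add_le l₂ c₂ _).measurableSet)
  set m : ℕ := ⌈1 / ε⌉₊ with hm
  have hm1 : 1 / ε ≤ m := Nat.le_ceil _
  have hm2 : (m : ℝ) < 1 / ε + 1 := Nat.ceil_lt_add_one (by positivity)
  -- The spacing `5 ε` exceeds the width `4 ε` of the tube, which makes the translates disjoint.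
  -- With fewer than `1 / ε + 1` steps in each direction, the total shift stays bounded.
  let τ : ℕ × ℕ → Pt d := fun q => (5 * ε * q.1) • u₁ + (5 * ε * q.2) • u₂
  let S : ℕ × ℕ → Set (Pt d) := fun q => (fun x => x + -τ q) ⁻¹' T
  have hSm : ∀ q, MeasurableSet (S q) := fun q => hTm.preimage (measurable_add_const _)
  have hSv : ∀ q, volume (S q) = volume T := fun q => measure_preimage_add_right volume _ T
  have hl1 : ∀ q x, l₁ (x + -τ q) = l₁ x - 5 * ε * q.1 := fun q x => by
    simp [τ, h₁₁, h₁₂, sub_eq_add_neg]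
  have hl2 : ∀ q x, l₂ (x + -τ q) = l₂ x - 5 * ε * q.2 := fun q x => by
    simp [τ, h₂₁, h₂₂, sub_eq_add_neg]
  have hclose : ∀ (a : ℝ) (i j : ℕ), |a - 5 * ε * i| ≤ 2 * ε → |a - 5 * ε * j| ≤ 2 * ε → i = j := by
    have aux : ∀ (a : ℝ) (i j : ℕ), |a - 5 * ε * i| ≤ 2 * ε → |a - 5 * ε * j| ≤ 2 * ε → j ≤ i := by
      intro a i j hi hj
      by_contra hlt
      have h1 : (i : ℝ) + 1 ≤ j := by exact_mod_cast not_le.1 hlt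
      have h2 := (abs_le.1 hi).2
      have h3 := (abs_le.1 hj).1
      nlinarith
    exact fun a i j hi hj => le_antisymm (aux a j i hj hi) (aux a i j hi hj)
  have hdisj : (↑(Finset.range m ×ˢ Finset.range m) : Set (ℕ × ℕ)).PairwiseDisjoint S := by
    intro p _ q _ hpq
    refine Set.disjoint_left.2 fun x hxp hxq => hpq ?_
    have hp1 := hxp.2.1; have hp2 := hxp.2.2; have hq1 := hxq.2.1; have hq2 := hxq.2.2
    rw [hl1] at hp1 hq1
    rw [hl2] at hp2 hq2
    refine Prod.ext (hclose (l₁ x + c₁) _ _ ?_ ?_) (hclose (l₂ x + c₂) _ _ ?_ ?_)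
    · convert hp1 using 2; ring
    · convert hq1 using 2; ring
    · convert hp2 using 2; ring
    · convert hq2 using 2; ring
  have hsub : (⋃ q ∈ Finset.range m ×ˢ Finset.range m, S q) ⊆ Metric.closedBall (0 : Pt d) R' := by
    refine iUnion₂_subset fun q hq x hx => ?_
    have h1 := hx.1
    rw [mem_closedBall_zero_iff] at h1 ⊢
    have hb : ∀ i ∈ Finset.range m, |5 * ε * (i : ℝ)| ≤ 10 := fun i hi => by
      have h2 : (i : ℝ) + 1 ≤ m := by exact_mod_cast Finset.mem_range.1 hi
      have h3 : (i : ℝ) < 1 / ε := by linarith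
      rw [abs_of_nonneg (by positivity)]
      have h4 : ε * (i : ℝ) < 1 := by rwa [lt_div_iff₀' hε] at h3
      nlinarith
    have h2 : ‖τ q‖ ≤ 10 * (‖u₁‖ + ‖u₂‖) := by
      refine (norm_add_le _ _).trans ?_
      rw [norm_smul, norm_smul, mul_add]
      exact add_le_add (mul_le_mul_of_nonneg_right (hb _ (Finset.mem_product.1 hq).1)
        (norm_nonneg _)) (mul_le_mul_of_nonneg_right (hb _ (Finset.mem_product.1 hq).2)
        (norm_nonneg _))
    have h3 : x = (x + -τ q) + τ q := by abel
    rw [h3]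
    exact (norm_add_le _ _).trans (add_le_add h1 h2)
  have hcount : ((m : ℝ≥0∞) * m) * volume T ≤ volume (Metric.closedBall (0 : Pt d) R') := by
    refine le_trans (le_of_eq ?_) (measure_mono hsub)
    rw [measure_biUnion_finset hdisj fun q _ => hSm q]
    simp [hSv]
  have hmε : (1 : ℝ≥0∞) ≤ ENNReal.ofReal (ε ^ 2) * ((m : ℝ≥0∞) * m) := by
    have h1 : (1 : ℝ) ≤ ε ^ 2 * ((m : ℝ) * m) := by
      have h2 : 1 ≤ ε * m := by rwa [div_le_iff₀' hε] at hm1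
      nlinarith
    rw [← ENNReal.ofReal_natCast, ← ENNReal.ofReal_mul (by positivity),
      ← ENNReal.ofReal_mul (by positivity), ← ENNReal.ofReal_one]
    exact ENNReal.ofReal_le_ofReal h1
  calc volume {x | x ∈ Ω ∧ |l₁ x + c₁| ≤ 2 * ε ∧ |l₂ x + c₂| ≤ 2 * ε} ≤ volume T :=
        measure_mono fun x hx => ⟨hR hx.1, hx.2⟩
    _ = 1 * volume T := (one_mul _).symm
    _ ≤ ENNReal.ofReal (ε ^ 2) * ((m : ℝ≥0∞) * m) * volume T := by gcongr
    _ = ENNReal.ofReal (ε ^ 2) * (((m : ℝ≥0∞) * m) * volume T) := mul_assoc _ _ _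
    _ ≤ ENNReal.ofReal (ε ^ 2) * volume (Metric.closedBall (0 : Pt d) R') := by gcongr
    _ = _ := mul_comm _ _

/-- The cutoff at scale `e n` has gradient `O(1 / e n)` on a tube of volume `O((e n)²)`, so the
gradients are bounded in `L²`. They need not tend to `0`, since bounded gradients already give weak
convergence. -/
theorem isThin_of_dual (hΩ : Bornology.IsBounded Ω) (hm : MeasurableSet Ω)
    {l₁ l₂ : Pt d →L[ℝ] ℝ} (c₁ c₂ : ℝ)
    {u₁ u₂ : Pt d} (h₁₁ : l₁ u₁ = 1) (h₁₂ : l₁ u₂ = 0) (h₂₁ : l₂ u₁ = 0) (h₂₂ : l₂ u₂ = 1) :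
    IsThin Ω {x | l₁ x + c₁ = 0 ∧ l₂ x + c₂ = 0} := by
  obtain ⟨C, hC, hvol⟩ := exists_volume_tube_le hΩ c₁ c₂ h₁₁ h₁₂ h₂₁ h₂₂
  let θ : ContDiffBump (0 : ℝ) := ⟨1, 2, one_pos, by norm_num⟩
  have hθ : ContDiff ℝ ∞ θ := θ.contDiff
  have hθ0 : ∀ t, 0 ≤ θ t := fun t => θ.nonneg
  have hθ1 : ∀ t, θ t ≤ 1 := fun t => θ.le_one
  have hθin : ∀ t : ℝ, |t| < 1 → θ t = 1 := fun t ht => θ.one_of_mem_closedBall (by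
    simpa using ht.le)
  have hθout : ∀ t : ℝ, 2 ≤ |t| → θ t = 0 := fun t ht => θ.zero_of_le_dist (by simpa using ht)
  obtain ⟨M, hM⟩ := (θ.hasCompactSupport.deriv).exists_bound_of_continuous
    (hθ.continuous_deriv (by simp))
  have hM0 : 0 ≤ M := (norm_nonneg _).trans (hM 0)
  let e : ℕ → ℝ := fun n => 1 / ((n : ℝ) + 1)
  have he0 : ∀ n, 0 < e n := fun n => by positivity
  have he1 : ∀ n, e n ≤ 1 := fun n => by
    simp only [e]
    rw [div_le_one (by positivity)]
    linarith [Nat.cast_nonneg (α := ℝ) n]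
  have hlim : Tendsto e atTop (𝓝 0) := tendsto_one_div_add_atTop_nhds_zero_nat
  let a : ℕ → Pt d → ℝ := fun n x => (l₁ x + c₁) * (e n)⁻¹
  let b : ℕ → Pt d → ℝ := fun n x => (l₂ x + c₂) * (e n)⁻¹
  let ψ : ℕ → Pt d → ℝ := fun n x => 1 - θ (a n x) * θ (b n x)
  have ha : ∀ n, ContDiff ℝ ∞ (a n) := fun n => (l₁.contDiff.add contDiff_const).mul contDiff_const
  have hb : ∀ n, ContDiff ℝ ∞ (b n) := fun n => (l₂.contDiff.add contDiff_const).mul contDiff_const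
  have hψ : ∀ n, ContDiff ℝ ∞ (ψ n) := fun n =>
    contDiff_const.sub ((hθ.comp (ha n)).mul (hθ.comp (hb n)))
  have habs : ∀ n (t : ℝ), |t * (e n)⁻¹| = |t| / e n := fun n t => by
    rw [abs_mul, abs_inv, abs_of_pos (he0 n), div_eq_mul_inv]
  have hone : ∀ n x, (2 * e n < |l₁ x + c₁| ∨ 2 * e n < |l₂ x + c₂|) →
      ψ n =ᶠ[𝓝 x] fun _ => 1 := by
    rintro n x (h | h)
    · have hopen : IsOpen {y : Pt d | 2 * e n < |l₁ y + c₁|} :=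
        isOpen_lt continuous_const (by fun_prop)
      filter_upwards [hopen.mem_nhds h] with y hy
      have hy' : 2 * e n < |l₁ y + c₁| := hy
      have : θ (a n y) = 0 := hθout _ (by rw [habs, le_div_iff₀ (he0 n)]; exact hy'.le)
      simp [ψ, this]
    · have hopen : IsOpen {y : Pt d | 2 * e n < |l₂ y + c₂|} :=
        isOpen_lt continuous_const (by fun_prop)
      filter_upwards [hopen.mem_nhds h] with y hy
      have hy' : 2 * e n < |l₂ y + c₂| := hy
      have : θ (b n y) = 0 := hθout _ (by rw [habs, le_div_iff₀ (he0 n)]; exact hy'.le)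
      simp [ψ, this]
  have hder0 : ∀ n x, (2 * e n < |l₁ x + c₁| ∨ 2 * e n < |l₂ x + c₂|) →
      ψ n x = 1 ∧ ∀ i, pderiv i (ψ n) x = 0 := fun n x h => by
    refine ⟨(hone n x h).self_of_nhds, fun i => ?_⟩
    unfold pderiv
    rw [(hone n x h).fderiv_eq]
    simp
  set L : ℝ := M * (‖l₁‖ + ‖l₂‖) with hL
  have hderb : ∀ n i x, |pderiv i (ψ n) x| ≤ L / e n := by
    intro n i x
    have hθd : ∀ t, HasDerivAt θ (deriv θ t) t := fun t =>
      (hθ.differentiable (by simp) t).hasDerivAt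
    have d1 : HasFDerivAt (a n) ((e n)⁻¹ • l₁) x :=
      (l₁.hasFDerivAt.add_const c₁).mul_const _
    have d2 : HasFDerivAt (b n) ((e n)⁻¹ • l₂) x :=
      (l₂.hasFDerivAt.add_const c₂).mul_const _
    have d3 := (((hθd (a n x)).comp_hasFDerivAt x d1).mul
      ((hθd (b n x)).comp_hasFDerivAt x d2)).const_sub 1
    have d4 : pderiv i (ψ n) x = -(θ (a n x) * (deriv θ (b n x) * ((e n)⁻¹ *
        l₂ (EuclideanSpace.single i 1))) + θ (b n x) * (deriv θ (a n x) * ((e n)⁻¹ *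
        l₁ (EuclideanSpace.single i 1)))) := by
      unfold pderiv
      rw [show ψ n = fun x => 1 - ((θ ∘ a n) * (θ ∘ b n)) x from rfl, d3.fderiv]
      simp
    have hbd : ∀ (s t : ℝ) (l : Pt d →L[ℝ] ℝ), |θ s * (deriv θ t * ((e n)⁻¹ *
        l (EuclideanSpace.single i 1)))| ≤ M * ‖l‖ * (e n)⁻¹ := by
      intro s t l
      have h1 : |l (EuclideanSpace.single i 1)| ≤ ‖l‖ := by
        simpa using l.le_opNorm (EuclideanSpace.single i (1 : ℝ))
      rw [abs_mul, abs_mul, abs_mul, abs_of_nonneg (hθ0 s), abs_of_pos (inv_pos.2 (he0 n))]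
      calc θ s * (|deriv θ t| * ((e n)⁻¹ * |l (EuclideanSpace.single i 1)|))
          ≤ 1 * (M * ((e n)⁻¹ * ‖l‖)) := by
            have := he0 n
            gcongr
            · exact hθ1 s
            · exact hM t
        _ = _ := by ring
    rw [d4, abs_neg]
    refine (abs_add_le _ _).trans ((add_le_add (hbd _ _ _) (hbd _ _ _)).trans_eq ?_)
    rw [hL]; ring
  set D : ℝ≥0∞ := ENNReal.ofReal (L ^ 2) * C with hD
  have hDt : D ≠ ⊤ := ENNReal.mul_ne_top ENNReal.ofReal_ne_top hC
  -- The squared norms are at most `D`, and `D ≤ (D + 1)²`, so `D + 1` bounds the norms without a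
  -- square root.
  refine ⟨ψ, D + 1, by finiteness, hψ, fun n x => ?_, fun n => ?_, fun n i => ?_, ?_⟩
  · have h1 := mul_nonneg (hθ0 (a n x)) (hθ0 (b n x))
    have h2 := mul_le_one₀ (hθ1 (a n x)) (hθ0 (b n x)) (hθ1 (b n x))
    rw [abs_le]
    constructor <;> simp only [ψ] <;> linarith
  · refine ⟨{x | |l₁ x + c₁| < e n ∧ |l₂ x + c₂| < e n}, ?_, ?_, ?_⟩
    · exact (isOpen_abs_add_lt l₁ c₁ _).inter (isOpen_abs_add_lt l₂ c₂ _)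
    · rintro x ⟨h1, h2⟩
      simp [h1, h2, he0 n]
    · rintro x ⟨h1, h2⟩
      have h3 : θ (a n x) = 1 := hθin _ (by rw [habs, div_lt_one (he0 n)]; exact h1)
      have h4 : θ (b n x) = 1 := hθin _ (by rw [habs, div_lt_one (he0 n)]; exact h2)
      simp [ψ, h3, h4]
  · refine eLpNorm_two_le_of_lintegral_le ?_
    set T : Set (Pt d) := {x | |l₁ x + c₁| ≤ 2 * e n ∧ |l₂ x + c₂| ≤ 2 * e n} with hT
    have hTm : MeasurableSet T := by
      exact (isClosed_abs_add_le l₁ c₁ _).measurableSet.inter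
        (isClosed_abs_add_le l₂ c₂ _).measurableSet
    have hpt : ∀ x, ‖pderiv i (ψ n) x‖ₑ ^ 2 ≤
        T.indicator (fun _ => ENNReal.ofReal ((L / e n) ^ 2)) x := by
      intro x
      by_cases hx : x ∈ T
      · rw [indicator_of_mem hx, Real.enorm_eq_ofReal_abs, ← ENNReal.ofReal_pow (abs_nonneg _)]
        exact ENNReal.ofReal_le_ofReal (pow_le_pow_left₀ (abs_nonneg _) (hderb n i x) 2)
      · have hx' : 2 * e n < |l₁ x + c₁| ∨ 2 * e n < |l₂ x + c₂| := by
          by_contra! h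
          exact hx h
        simp [(hder0 n x hx').2 i]
    calc ∫⁻ x in Ω, ‖pderiv i (ψ n) x‖ₑ ^ 2
        ≤ ∫⁻ x in Ω, T.indicator (fun _ => ENNReal.ofReal ((L / e n) ^ 2)) x := lintegral_mono hpt
      _ = ENNReal.ofReal ((L / e n) ^ 2) * volume (T ∩ Ω) := by
        rw [lintegral_indicator_const hTm, Measure.restrict_apply hTm]
      _ ≤ ENNReal.ofReal ((L / e n) ^ 2) * (C * ENNReal.ofReal (e n ^ 2)) := by
        gcongr
        refine le_trans (measure_mono ?_) (hvol (e n) (he0 n) (he1 n))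
        exact fun x hx => ⟨hx.2, hx.1⟩
      _ = D := by
        rw [mul_comm C, ← mul_assoc, ← ENNReal.ofReal_mul (by positivity), hD]
        congr 2
        have := (he0 n).ne'
        field_simp
      _ ≤ D + 1 := le_self_add
      _ ≤ (D + 1) ^ 2 := le_self_pow₀ le_add_self (by norm_num)
  · have hnull : volume ({x | l₁ x + c₁ = 0 ∧ l₂ x + c₂ = 0} ∩ Ω) = 0 := by
      have h1 : ∀ n, volume ({x | l₁ x + c₁ = 0 ∧ l₂ x + c₂ = 0} ∩ Ω) ≤
          C * ENNReal.ofReal (e n ^ 2) := fun n => by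
        refine le_trans (measure_mono ?_) (hvol (e n) (he0 n) (he1 n))
        rintro x ⟨⟨h1, h2⟩, h3⟩
        refine ⟨h3, ?_, ?_⟩
        · rw [h1]; simp [(he0 n).le]
        · rw [h2]; simp [(he0 n).le]
      have h2 : Tendsto (fun n => C * ENNReal.ofReal (e n ^ 2)) atTop (𝓝 0) := by
        have h3 := ENNReal.tendsto_ofReal (hlim.pow 2)
        simpa using ENNReal.Tendsto.const_mul h3 (Or.inr hC)
      exact le_antisymm (ge_of_tendsto' h2 h1) zero_le
    have hae : ∀ᵐ x ∂(volume.restrict Ω), ¬(l₁ x + c₁ = 0 ∧ l₂ x + c₂ = 0) := by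
      rw [ae_restrict_iff' hm, ae_iff]
      convert hnull using 2
      ext x
      simp only [mem_ofPred_eq, mem_inter_iff]
      tauto
    filter_upwards [hae] with x hx
    have hev : ∀ t : ℝ, t ≠ 0 → ∀ᶠ n in atTop, 2 * e n < |t| := fun t ht => by
      have h1 : Tendsto (fun n => 2 * e n) atTop (𝓝 0) := by simpa using hlim.const_mul 2
      exact h1.eventually (gt_mem_nhds (abs_pos.2 ht))
    by_cases h1 : l₁ x + c₁ = 0
    · filter_upwards [hev _ (fun h2 => hx ⟨h1, h2⟩)] with n hn using hder0 n x (Or.inr hn)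
    · filter_upwards [hev _ h1] with n hn using hder0 n x (Or.inl hn)

end Codimension

/-! ### Polygonal domains -/

section Geometry

variable {d : ℕ} {Ω : Set (Pt d)}

/-- The closed simplex spanned by an affine basis. -/
def simplexOf {d : ℕ} (b : AffineBasis (Fin (d + 1)) ℝ (Pt d)) : Set (Pt d) :=
  convexHull ℝ (range b)

theorem mem_simplexOf {b : AffineBasis (Fin (d + 1)) ℝ (Pt d)} {x : Pt d} :
    x ∈ simplexOf b ↔ ∀ j, 0 ≤ b.coord j x := by
  rw [simplexOf, b.convexHull_eq_nonneg_coord]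
  rfl

theorem mem_interior_simplexOf {b : AffineBasis (Fin (d + 1)) ℝ (Pt d)} {x : Pt d} :
    x ∈ interior (simplexOf b) ↔ ∀ j, 0 < b.coord j x := by
  rw [simplexOf, b.interior_convexHull]
  rfl

theorem isCompact_simplexOf (b : AffineBasis (Fin (d + 1)) ℝ (Pt d)) : IsCompact (simplexOf b) :=
  (finite_range b).isCompact_convexHull ℝ

theorem IsPolygonalDomain.exists_simplices (h : IsPolygonalDomain Ω) :
    ∃ (n : ℕ) (b : Fin n → AffineBasis (Fin (d + 1)) ℝ (Pt d)),
      Ω = interior (⋃ k, simplexOf (b k)) := by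
  obtain ⟨-, n, s, hs, hΩ⟩ := h
  refine ⟨n, fun k => ⟨s k, hs k, ?_⟩, hΩ⟩
  rw [(hs k).affineSpan_eq_top_iff_card_eq_finrank_add_one]
  simp

theorem isCompact_iUnion_simplexOf {n : ℕ} (b : Fin n → AffineBasis (Fin (d + 1)) ℝ (Pt d)) :
    IsCompact (⋃ k, simplexOf (b k)) :=
  isCompact_iUnion fun k => isCompact_simplexOf (b k)

theorem IsPolygonalDomain.isOpen (h : IsPolygonalDomain Ω) : IsOpen Ω := by
  obtain ⟨n, b, rfl⟩ := h.exists_simplices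
  exact isOpen_interior

theorem IsPolygonalDomain.isBounded (h : IsPolygonalDomain Ω) : Bornology.IsBounded Ω := by
  obtain ⟨n, b, rfl⟩ := h.exists_simplices
  exact (isCompact_iUnion_simplexOf b).isBounded.subset interior_subset

/-- The linear part of a barycentric coordinate. -/
def coordLin (b : AffineBasis (Fin (d + 1)) ℝ (Pt d)) (j : Fin (d + 1)) : Pt d →L[ℝ] ℝ :=
  LinearMap.toContinuousLinearMap (b.coord j).linear

theorem coord_eq (b : AffineBasis (Fin (d + 1)) ℝ (Pt d)) (j : Fin (d + 1)) (x y : Pt d) :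
    b.coord j x = coordLin b j (x - y) + b.coord j y := by
  have h := (b.coord j).map_vadd y (x - y)
  rw [vadd_eq_add, vadd_eq_add, sub_add_cancel] at h
  exact h

theorem continuous_coord (b : AffineBasis (Fin (d + 1)) ℝ (Pt d)) (j : Fin (d + 1)) :
    Continuous (b.coord j) := by
  have h : (b.coord j : Pt d → ℝ) = fun x => coordLin b j (x - 0) + b.coord j 0 :=
    funext fun x => coord_eq b j x 0
  rw [h]
  fun_prop

theorem exists_coordLin_eq_one (hd : 0 < d) (b : AffineBasis (Fin (d + 1)) ℝ (Pt d))
    (j : Fin (d + 1)) : ∃ n : Pt d, coordLin b j n = 1 := by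
  have : Nontrivial (Fin (d + 1)) := Fin.nontrivial_iff_two_le.2 (by omega)
  obtain ⟨i, hi⟩ := exists_ne j
  refine ⟨b j - b i, ?_⟩
  have h := coord_eq b j (b j) (b i)
  rw [b.coord_apply_eq, b.coord_apply_ne hi.symm, add_zero] at h
  exact h.symm

/-- Two facet hyperplanes are either transversal, and then meet in codimension two with dual vectors
for their normals, or parallel. -/
theorem exists_dual_or_proportional {l₁ l₂ : Pt d →L[ℝ] ℝ} {n : Pt d} (hn : l₁ n = 1) :
    (∃ u₁ u₂ : Pt d, l₁ u₁ = 1 ∧ l₁ u₂ = 0 ∧ l₂ u₁ = 0 ∧ l₂ u₂ = 1) ∨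
      ∃ t : ℝ, ∀ x, l₂ x = t * l₁ x := by
  by_cases h : ∃ u, l₁ u = 0 ∧ l₂ u ≠ 0
  · obtain ⟨u, h1, h2⟩ := h
    refine Or.inl ⟨n - (l₂ n / l₂ u) • u, (l₂ u)⁻¹ • u, ?_, ?_, ?_, ?_⟩
    · simp [h1, hn]
    · simp [h1]
    · simp [h2]
    · simp [h2]
  · push Not at h
    refine Or.inr ⟨l₂ n, fun x => ?_⟩
    have h1 := h (x - l₁ x • n) (by simp [hn])
    simp only [map_sub, map_smul, smul_eq_mul] at h1
    linarith

/-- In the ball, `U` contains all or nothing of each open side of the hyperplane. If it contains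
both sides, closedness adds the hyperplane and the ball lies in `U`. If it contains one side, the
interior is exactly this side, which is stable under shifts pointing into it. If it contains
neither, the interior does not meet the ball. -/
theorem shiftStable_of_sign {U : Set (Pt d)} (hU : IsClosed U) {x₀ n : Pt d} {l : Pt d →L[ℝ] ℝ}
    (hn : l n = 1) {r : ℝ} (hr : 0 < r)
    (hpos : ∀ x ∈ Metric.ball x₀ r, ∀ y ∈ Metric.ball x₀ r, 0 < l (x - x₀) → 0 < l (y - x₀) →
      x ∈ U → y ∈ U)
    (hneg : ∀ x ∈ Metric.ball x₀ r, ∀ y ∈ Metric.ball x₀ r, l (x - x₀) < 0 → l (y - x₀) < 0 →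
      x ∈ U → y ∈ U) : ShiftStable (interior U) x₀ := by
  -- An interior point can be pushed slightly off the hyperplane in either direction without leaving
  -- `U`. Hence interior points on the hyperplane force both sides to be occupied.
  have hmove : ∀ x ∈ interior U, x ∈ Metric.ball x₀ r → ∀ v : Pt d, ∃ s > (0 : ℝ),
      x + s • v ∈ Metric.ball x₀ r ∧ x + s • v ∈ U := fun x hx hxb v => by
    have hc : Tendsto (fun s : ℝ => x + s • v) (𝓝[>] 0) (𝓝 x) := by
      have : Continuous fun s : ℝ => x + s • v := by fun_prop
      simpa using (this.tendsto 0).mono_left nhdsWithin_le_nhds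
    have h1 := hc.eventually ((isOpen_interior.inter Metric.isOpen_ball).mem_nhds ⟨hx, hxb⟩)
    obtain ⟨s, hs, hs0⟩ := (h1.and self_mem_nhdsWithin).exists
    exact ⟨s, hs0, hs.2, interior_subset hs.1⟩
  have hplus : ∀ x ∈ interior U, x ∈ Metric.ball x₀ r → 0 ≤ l (x - x₀) →
      ∃ y ∈ Metric.ball x₀ r, 0 < l (y - x₀) ∧ y ∈ U := fun x hx hxb h => by
    obtain ⟨s, hs, h1, h2⟩ := hmove x hx hxb n
    refine ⟨_, h1, ?_, h2⟩
    have : l (x + s • n - x₀) = l (x - x₀) + s := by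
      simp [hn]; ring
    rw [this]; linarith
  have hminus : ∀ x ∈ interior U, x ∈ Metric.ball x₀ r → l (x - x₀) ≤ 0 →
      ∃ y ∈ Metric.ball x₀ r, l (y - x₀) < 0 ∧ y ∈ U := fun x hx hxb h => by
    obtain ⟨s, hs, h1, h2⟩ := hmove x hx hxb (-n)
    refine ⟨_, h1, ?_, h2⟩
    have : l (x + s • -n - x₀) = l (x - x₀) - s := by
      simp [hn]; ring
    rw [this]; linarith
  have hlc : Continuous fun x => l (x - x₀) := by fun_prop
  have hside : ∀ V : Set (Pt d), IsOpen V → V ⊆ U → V ⊆ interior U := fun V hV h =>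
    interior_maximal h hV
  have hsign : ∀ w : Pt d, l w = 1 → ∃ κ > 0, ∀ z : Pt d, ‖z - w‖ < κ → 0 < l z := fun w hw => by
    have h1 : ∀ᶠ z in 𝓝 w, 0 < l z :=
      (l.continuous.tendsto w).eventually (lt_mem_nhds (by rw [hw]; exact one_pos))
    obtain ⟨κ, hκ, h2⟩ := Metric.eventually_nhds_iff.1 h1
    exact ⟨κ, hκ, fun z hz => h2 (by rwa [dist_eq_norm])⟩
  obtain ⟨κ, hκ, hκn⟩ := hsign n hn
  by_cases hP : ∃ y ∈ Metric.ball x₀ r, 0 < l (y - x₀) ∧ y ∈ U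
  · obtain ⟨y, hyb, hy, hyU⟩ := hP
    have hposU : ∀ x ∈ Metric.ball x₀ r, 0 < l (x - x₀) → x ∈ U := fun x hxb hx =>
      hpos y hyb x hxb hy hx hyU
    by_cases hQ : ∃ y ∈ Metric.ball x₀ r, l (y - x₀) < 0 ∧ y ∈ U
    · obtain ⟨y', hyb', hy', hyU'⟩ := hQ
      have hnegU : ∀ x ∈ Metric.ball x₀ r, l (x - x₀) < 0 → x ∈ U := fun x hxb hx =>
        hneg y' hyb' x hxb hy' hx hyU'
      have hall : Metric.ball x₀ r ⊆ U := fun x hxb => by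
        rcases lt_trichotomy (l (x - x₀)) 0 with h | h | h
        · exact hnegU x hxb h
        · have hc : Tendsto (fun s : ℝ => x + s • n) (𝓝[>] 0) (𝓝 x) := by
            have : Continuous fun s : ℝ => x + s • n := by fun_prop
            simpa using (this.tendsto 0).mono_left nhdsWithin_le_nhds
          refine hU.mem_of_tendsto hc ?_
          filter_upwards [hc.eventually (Metric.isOpen_ball.mem_nhds hxb), self_mem_nhdsWithin]
            with s hs hs0
          refine hposU _ hs ?_
          have h2 : l (x + s • n - x₀) = l (x - x₀) + s := by
            simp [hn]; ring
          have hs0 : 0 < s := hs0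
          rw [h2, h]; linarith
        · exact hposU x hxb h
      exact ⟨r, hr, 0, 1, one_pos, fun x _ _ z _ s _ h => hside _ Metric.isOpen_ball hall h⟩
    · refine ⟨r, hr, n, κ, hκ, fun x hx hxb z hz s hs h => ?_⟩
      have h1 : 0 < l (x - x₀) := by
        by_contra h1
        exact hQ (hminus x hx hxb (not_lt.1 h1))
      refine hside (Metric.ball x₀ r ∩ {x | 0 < l (x - x₀)})
        (Metric.isOpen_ball.inter (isOpen_lt continuous_const hlc)) (fun y hy => hposU y hy.1 hy.2)
        ⟨h, ?_⟩
      have h2 : l (x + s • z - x₀) = l (x - x₀) + s * l z := by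
        simp; ring
      have h3 := mul_pos hs (hκn z hz)
      show 0 < l (x + s • z - x₀)
      rw [h2]; linarith
  · by_cases hQ : ∃ y ∈ Metric.ball x₀ r, l (y - x₀) < 0 ∧ y ∈ U
    · obtain ⟨y', hyb', hy', hyU'⟩ := hQ
      have hnegU : ∀ x ∈ Metric.ball x₀ r, l (x - x₀) < 0 → x ∈ U := fun x hxb hx =>
        hneg y' hyb' x hxb hy' hx hyU'
      refine ⟨r, hr, -n, κ, hκ, fun x hx hxb z hz s hs h => ?_⟩
      have h1 : l (x - x₀) < 0 := by
        by_contra h1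
        exact hP (hplus x hx hxb (not_lt.1 h1))
      refine hside (Metric.ball x₀ r ∩ {x | l (x - x₀) < 0})
        (Metric.isOpen_ball.inter (isOpen_lt hlc continuous_const)) (fun y hy => hnegU y hy.1 hy.2)
        ⟨h, ?_⟩
      have h2 : l (x + s • z - x₀) = l (x - x₀) + s * l z := by
        simp; ring
      have h4 := hκn (-z) (by rwa [← norm_neg, neg_sub, sub_neg_eq_add, add_comm, ← sub_neg_eq_add])
      rw [map_neg] at h4
      have h3 := mul_pos hs h4
      show l (x + s • z - x₀) < 0
      rw [h2]; linarith
    · refine ⟨r, hr, 0, 1, one_pos, fun x hx hxb z hz s hs h => ?_⟩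
      rcases le_total 0 (l (x - x₀)) with h1 | h1
      · exact absurd (hplus x hx hxb h1) hP
      · exact absurd (hminus x hx hxb h1) hQ

/-- The bad set consists of the intersections of pairs of facet hyperplanes with independent
normals. At any other point all facet hyperplanes through the point coincide, and nearby the
remaining barycentric coordinates keep their signs. -/
theorem IsPolygonalDomain.H1_le_closure (hd : 0 < d) (h : IsPolygonalDomain Ω) :
    H1 Ω ≤ (smoothSub Ω).topologicalClosure := by
  classical
  have hΩb := h.isBounded
  have hΩo := h.isOpen
  have hne := h.1.nonempty
  obtain ⟨n, b, hΩ⟩ := h.exists_simplices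
  have hU := (isCompact_iUnion_simplexOf b).isClosed
  let l : Fin n × Fin (d + 1) → Pt d →L[ℝ] ℝ := fun q => coordLin (b q.1) q.2
  let c : Fin n × Fin (d + 1) → ℝ := fun q => (b q.1).coord q.2 0
  have hlc : ∀ q x, (b q.1).coord q.2 x = l q x + c q := fun q x => by
    simpa using coord_eq (b q.1) q.2 x 0
  let P : Finset ((Fin n × Fin (d + 1)) × (Fin n × Fin (d + 1))) := Finset.univ.filter fun p =>
    ∃ u₁ u₂ : Pt d, l p.1 u₁ = 1 ∧ l p.1 u₂ = 0 ∧ l p.2 u₁ = 0 ∧ l p.2 u₂ = 1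
  refine H1_le_closure_smoothSub hΩb hΩo P
    (fun p => {x | l p.1 x + c p.1 = 0 ∧ l p.2 x + c p.2 = 0}) ?_ ?_
  · intro p hp
    obtain ⟨u₁, u₂, h1, h2, h3, h4⟩ := (Finset.mem_filter.1 hp).2
    exact isThin_of_dual hΩb hΩo.measurableSet _ _ h1 h2 h3 h4
  · intro x₀ _ hx₀
    obtain ⟨k₀⟩ : Nonempty (Fin n) := by
      obtain ⟨x, hx⟩ := hne
      rw [hΩ] at hx
      obtain ⟨k, -⟩ := mem_iUnion.1 (interior_subset hx)
      exact ⟨k⟩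
    -- All coordinates vanishing at `x₀` are multiples of one linear form. If none vanishes, the
    -- condition is void and any index serves.
    obtain ⟨α, hα⟩ : ∃ α, ∀ β : Fin n × Fin (d + 1), (b β.1).coord β.2 x₀ = 0 →
        ∃ t : ℝ, ∀ x, (b β.1).coord β.2 x = t * l α (x - x₀) := by
      by_cases hA : ∃ α : Fin n × Fin (d + 1), (b α.1).coord α.2 x₀ = 0
      · obtain ⟨α, hα⟩ := hA
        refine ⟨α, fun β hβ => ?_⟩
        obtain ⟨w, hw⟩ := exists_coordLin_eq_one hd (b α.1) α.2
        rcases exists_dual_or_proportional (l₁ := l α) (l₂ := l β) hw with hdual | ⟨t, ht⟩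
        · refine absurd ⟨?_, ?_⟩ (hx₀ (α, β) (Finset.mem_filter.2 ⟨Finset.mem_univ _, hdual⟩))
          · rw [← hlc, hα]
          · rw [← hlc, hβ]
        · refine ⟨t, fun x => ?_⟩
          rw [coord_eq _ _ x x₀, hβ, add_zero]
          exact ht _
      · push Not at hA
        exact ⟨(k₀, 0), fun β hβ => absurd hβ (hA β)⟩
    obtain ⟨w, hw⟩ := exists_coordLin_eq_one hd (b α.1) α.2
    have hev : ∀ᶠ x in 𝓝 x₀, ∀ q : Fin n × Fin (d + 1),
        (0 < (b q.1).coord q.2 x₀ → 0 < (b q.1).coord q.2 x) ∧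
        ((b q.1).coord q.2 x₀ < 0 → (b q.1).coord q.2 x < 0) := by
      refine eventually_all.2 fun q => ?_
      have hc := (continuous_coord (b q.1) q.2).tendsto x₀
      refine Filter.Eventually.and ?_ ?_
      · by_cases hq : 0 < (b q.1).coord q.2 x₀
        · filter_upwards [hc.eventually (lt_mem_nhds hq)] with x hx _ using hx
        · exact Eventually.of_forall fun x hx => absurd hx hq
      · by_cases hq : (b q.1).coord q.2 x₀ < 0
        · filter_upwards [hc.eventually (gt_mem_nhds hq)] with x hx _ using hx
        · exact Eventually.of_forall fun x hx => absurd hx hq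
    obtain ⟨r, hr, hball⟩ := Metric.eventually_nhds_iff_ball.1 hev
    -- Membership in the union depends only on the side of the hyperplane: in each simplex,
    -- coordinates nonzero at `x₀` keep their sign, and the others have the sign of a fixed multiple
    -- of `l α (x - x₀)`.
    have key : ∀ x ∈ Metric.ball x₀ r, ∀ y ∈ Metric.ball x₀ r, 0 < l α (x - x₀) * l α (y - x₀) →
        x ∈ (⋃ k, simplexOf (b k)) → y ∈ ⋃ k, simplexOf (b k) := by
      intro x hx y hy hxy hxU
      obtain ⟨k, hk⟩ := mem_iUnion.1 hxU
      rw [mem_simplexOf] at hk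
      refine mem_iUnion.2 ⟨k, mem_simplexOf.2 fun j => ?_⟩
      rcases lt_trichotomy ((b k).coord j x₀) 0 with h0 | h0 | h0
      · exact absurd (hk j) (not_le.2 ((hball x hx (k, j)).2 h0))
      · obtain ⟨t, ht⟩ := hα (k, j) h0
        have h1 := hk j
        have h2 := ht x
        have h3 := ht y
        rw [h2] at h1
        rw [h3]
        rcases pos_and_pos_or_neg_and_neg_of_mul_pos hxy with ⟨h4, h5⟩ | ⟨h4, h5⟩
        · exact mul_nonneg (nonneg_of_mul_nonneg_left h1 h4) h5.le
        · refine mul_nonneg_of_nonpos_of_nonpos ?_ h5.le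
          by_contra h6
          exact absurd h1 (not_le.2 (mul_neg_of_pos_of_neg (not_le.1 h6) h4))
      · exact ((hball y hy (k, j)).1 h0).le
    rw [hΩ]
    exact shiftStable_of_sign hU hw hr
      (fun x hx y hy h1 h2 hxU => key x hx y hy (mul_pos h1 h2) hxU)
      (fun x hx y hy h1 h2 hxU => key x hx y hy (mul_pos_of_neg_of_neg h1 h2) hxU)

end Geometry

/-! ### Integration along segments -/

section Segments

variable {d : ℕ}

/-- Cauchy–Schwarz in the form that the variance `∫ (ψ' - m)²` about the mean slope `m` is
nonnegative. -/
theorem sq_sub_le_integral {ψ ψ' : ℝ → ℝ} (h : ∀ s, HasDerivAt ψ (ψ' s) s) (hc : Continuous ψ')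
    {t : ℝ} (ht : 0 ≤ t) : (ψ t - ψ 0) ^ 2 ≤ t * ∫ s in (0 : ℝ)..t, ψ' s ^ 2 := by
  rcases ht.eq_or_lt with rfl | ht
  · simp
  have h1 : ∫ s in (0 : ℝ)..t, ψ' s = ψ t - ψ 0 :=
    intervalIntegral.integral_eq_sub_of_hasDerivAt (fun s _ => h s) (hc.intervalIntegrable _ _)
  set m : ℝ := (ψ t - ψ 0) / t with hm
  have h2 : 0 ≤ ∫ s in (0 : ℝ)..t, (ψ' s - m) ^ 2 :=
    intervalIntegral.integral_nonneg ht.le fun s _ => sq_nonneg _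
  have h3 : ∫ s in (0 : ℝ)..t, (ψ' s - m) ^ 2 =
      (∫ s in (0 : ℝ)..t, ψ' s ^ 2) - 2 * m * (ψ t - ψ 0) + m ^ 2 * t := by
    have e : ∀ s, (ψ' s - m) ^ 2 = ψ' s ^ 2 - 2 * m * ψ' s + m ^ 2 := fun s => by ring
    simp only [e]
    rw [intervalIntegral.integral_add, intervalIntegral.integral_sub,
      intervalIntegral.integral_const_mul, h1, intervalIntegral.integral_const]
    · simp; ring
    all_goals exact Continuous.intervalIntegrable (by fun_prop) _ _
  rw [h3] at h2
  have h4 : m * t = ψ t - ψ 0 := by rw [hm]; field_simp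
  have h5 : (ψ t - ψ 0) ^ 2 = t * (2 * m * (ψ t - ψ 0) - m ^ 2 * t) := by rw [← h4]; ring
  rw [h5]
  gcongr
  linarith

/-- `|φ|²` for a vector field `φ`. -/
def fieldSq (φ : Fin d → Pt d → ℝ) (x : Pt d) : ℝ := ∑ i, φ i x ^ 2

/-- The strain of a smooth vector field. -/
def strainAt (φ : Fin d → Pt d → ℝ) (i j : Fin d) (x : Pt d) : ℝ :=
  (1 / 2) * (pderiv j (φ i) x + pderiv i (φ j) x)

/-- `|ε(φ)|²` for a smooth vector field `φ`. -/
def strainSq (φ : Fin d → Pt d → ℝ) (x : Pt d) : ℝ := ∑ i, ∑ j, strainAt φ i j x ^ 2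

/-- `φ(x) ⬝ v`. -/
def fieldDot (φ : Fin d → Pt d → ℝ) (x v : Pt d) : ℝ := ∑ i, φ i x * v i

theorem fieldSq_nonneg (φ : Fin d → Pt d → ℝ) (x : Pt d) : 0 ≤ fieldSq φ x :=
  Finset.sum_nonneg fun _ _ => sq_nonneg _

theorem strainSq_nonneg (φ : Fin d → Pt d → ℝ) (x : Pt d) : 0 ≤ strainSq φ x :=
  Finset.sum_nonneg fun _ _ => Finset.sum_nonneg fun _ _ => sq_nonneg _

theorem fieldDot_sq_le (φ : Fin d → Pt d → ℝ) (x v : Pt d) :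
    fieldDot φ x v ^ 2 ≤ fieldSq φ x * ‖v‖ ^ 2 := by
  rw [EuclideanSpace.real_norm_sq_eq]
  exact Finset.sum_mul_sq_le_sq_mul_sq _ _ _

theorem continuous_strainAt {φ : Fin d → Pt d → ℝ} (hφ : ∀ i, ContDiff ℝ ∞ (φ i)) (i j : Fin d) :
    Continuous (strainAt φ i j) :=
  continuous_const.mul ((continuous_pderiv (hφ i) j).add (continuous_pderiv (hφ j) i))

theorem continuous_fieldSq {φ : Fin d → Pt d → ℝ} (hφ : ∀ i, ContDiff ℝ ∞ (φ i)) :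
    Continuous (fieldSq φ) :=
  continuous_finsetSum _ fun i _ => (hφ i).continuous.pow 2

theorem continuous_strainSq {φ : Fin d → Pt d → ℝ} (hφ : ∀ i, ContDiff ℝ ∞ (φ i)) :
    Continuous (strainSq φ) :=
  continuous_finsetSum _ fun i _ => continuous_finsetSum _ fun j _ =>
    (continuous_strainAt hφ i j).pow 2

theorem fderiv_eq_sum_pderiv (f : Pt d → ℝ) (x v : Pt d) :
    fderiv ℝ f x v = ∑ j, pderiv j f x * v j := by
  have h : v = ∑ j, v j • EuclideanSpace.single j (1 : ℝ) := by
    ext k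
    simp [Finset.sum_apply, Pi.single_apply]
  conv_lhs => rw [h]
  rw [map_sum]
  refine Finset.sum_congr rfl fun j _ => ?_
  rw [map_smul, smul_eq_mul, mul_comm]
  rfl

/-- The derivative of `φ(y + t v) ⬝ v` only involves the strain. -/
theorem hasDerivAt_fieldDot {φ : Fin d → Pt d → ℝ} (hφ : ∀ i, ContDiff ℝ ∞ (φ i)) (y v : Pt d)
    (t : ℝ) : HasDerivAt (fun s : ℝ => fieldDot φ (y + s • v) v)
      (∑ i, ∑ j, strainAt φ i j (y + t • v) * (v i * v j)) t := by
  have h1 : HasDerivAt (fun s : ℝ => y + s • v) v t := by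
    simpa using ((hasDerivAt_id t).smul_const v).const_add y
  have h2 : HasDerivAt (fun s : ℝ => fieldDot φ (y + s • v) v)
      (∑ i, (∑ j, pderiv j (φ i) (y + t • v) * v j) * v i) t := by
    refine HasDerivAt.fun_sum fun i _ => HasDerivAt.mul_const ?_ _
    have h3 := ((hφ i).differentiable (by simp) (y + t • v)).hasFDerivAt.comp_hasDerivAt t h1
    rwa [fderiv_eq_sum_pderiv] at h3
  convert h2 using 1
  have h4 : ∑ i, (∑ j, pderiv j (φ i) (y + t • v) * v j) * v i =
      ∑ i, ∑ j, pderiv j (φ i) (y + t • v) * (v i * v j) := by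
    refine Finset.sum_congr rfl fun i _ => ?_
    rw [Finset.sum_mul]
    exact Finset.sum_congr rfl fun j _ => by ring
  have h5 : ∑ i, ∑ j, pderiv j (φ i) (y + t • v) * (v i * v j) =
      ∑ i, ∑ j, pderiv i (φ j) (y + t • v) * (v i * v j) := by
    rw [Finset.sum_comm]
    exact Finset.sum_congr rfl fun i _ => Finset.sum_congr rfl fun j _ => by ring
  have h6 : ∑ i, ∑ j, strainAt φ i j (y + t • v) * (v i * v j) =
      (1 / 2) * (∑ i, ∑ j, pderiv j (φ i) (y + t • v) * (v i * v j)) +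
        (1 / 2) * ∑ i, ∑ j, pderiv i (φ j) (y + t • v) * (v i * v j) := by
    simp only [Finset.mul_sum, ← Finset.sum_add_distrib]
    exact Finset.sum_congr rfl fun i _ => Finset.sum_congr rfl fun j _ => by
      unfold strainAt; ring
  rw [h6, ← h5, h4]
  ring

theorem sum_strainAt_sq_le (φ : Fin d → Pt d → ℝ) (x v : Pt d) :
    (∑ i, ∑ j, strainAt φ i j x * (v i * v j)) ^ 2 ≤ strainSq φ x * ‖v‖ ^ 4 := by
  have h := Finset.sum_mul_sq_le_sq_mul_sq (Finset.univ : Finset (Fin d × Fin d))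
    (fun q => strainAt φ q.1 q.2 x) (fun q => v q.1 * v q.2)
  rw [← Finset.univ_product_univ, Finset.sum_product, Finset.sum_product, Finset.sum_product] at h
  refine h.trans_eq ?_
  rw [strainSq, show ‖v‖ ^ 4 = ‖v‖ ^ 2 * ‖v‖ ^ 2 by ring, EuclideanSpace.real_norm_sq_eq]
  congr 1
  rw [Finset.sum_mul_sum]
  simp only [mul_pow]

theorem fieldDot_sub_sq_le {φ : Fin d → Pt d → ℝ} (hφ : ∀ i, ContDiff ℝ ∞ (φ i)) (y v : Pt d)
    {t : ℝ} (ht : 0 ≤ t) : (fieldDot φ (y + t • v) v - fieldDot φ y v) ^ 2 ≤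
      t * (‖v‖ ^ 4 * ∫ s in (0 : ℝ)..t, strainSq φ (y + s • v)) := by
  have hcs : Continuous fun s : ℝ => y + s • v := by fun_prop
  have hc : Continuous fun s : ℝ => ∑ i, ∑ j, strainAt φ i j (y + s • v) * (v i * v j) :=
    continuous_finsetSum _ fun i _ => continuous_finsetSum _ fun j _ =>
      ((continuous_strainAt hφ i j).comp hcs).mul continuous_const
  have h := sq_sub_le_integral (hasDerivAt_fieldDot hφ y v) hc ht
  simp only [zero_smul, add_zero] at h
  refine h.trans ?_
  gcongr
  rw [← intervalIntegral.integral_const_mul]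
  refine intervalIntegral.integral_mono_on ht ((hc.pow 2).intervalIntegrable _ _)
    ((continuous_const.mul ((continuous_strainSq hφ).comp hcs)).intervalIntegrable _ _)
    fun s _ => ?_
  rw [mul_comm]
  exact sum_strainAt_sq_le φ _ v

/-- The value of `φ ⬝ v` at the end of a segment is controlled along the segment. -/
theorem fieldDot_sq_le_integral {φ : Fin d → Pt d → ℝ} (hφ : ∀ i, ContDiff ℝ ∞ (φ i)) (y v : Pt d)
    {D : ℝ} (hv : ‖v‖ ≤ D) : fieldDot φ y v ^ 2 ≤
      (4 * D ^ 2 + D ^ 4) *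
        ∫ s in (0 : ℝ)..(1 / 2), (fieldSq φ (y + s • v) + strainSq φ (y + s • v)) := by
  have hcs : Continuous fun s : ℝ => y + s • v := by fun_prop
  have hcF : Continuous fun s : ℝ => fieldSq φ (y + s • v) := (continuous_fieldSq hφ).comp hcs
  have hcS : Continuous fun s : ℝ => strainSq φ (y + s • v) := (continuous_strainSq hφ).comp hcs
  set I : ℝ := ∫ s in (0 : ℝ)..(1 / 2), strainSq φ (y + s • v) with hI
  set J : ℝ := ∫ s in (0 : ℝ)..(1 / 2), fieldSq φ (y + s • v) with hJ
  have hD : 0 ≤ D := (norm_nonneg v).trans hv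
  have hI0 : 0 ≤ I := intervalIntegral.integral_nonneg (by norm_num) fun s _ => strainSq_nonneg _ _
  have hJ0 : 0 ≤ J := intervalIntegral.integral_nonneg (by norm_num) fun s _ => fieldSq_nonneg _ _
  -- The value at the end point is compared with the value at each `t`, and the comparison is then
  -- averaged over `t ∈ [0, 1/2]`. Stopping at `1/2` keeps the segments away from the apex, where
  -- the cone used later degenerates.
  have hpt : ∀ t ∈ Icc (0 : ℝ) (1 / 2), fieldDot φ y v ^ 2 ≤
      2 * D ^ 2 * fieldSq φ (y + t • v) + D ^ 4 * I := by
    intro t ht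
    have h1 := fieldDot_sub_sq_le hφ y v ht.1
    have h2 := fieldDot_sq_le φ (y + t • v) v
    have h3 : ∫ s in (0 : ℝ)..t, strainSq φ (y + s • v) ≤ I :=
      intervalIntegral.integral_mono_interval le_rfl ht.1 ht.2
        (Eventually.of_forall fun s => strainSq_nonneg _ _) (hcS.intervalIntegrable _ _)
    have h3' : 0 ≤ ∫ s in (0 : ℝ)..t, strainSq φ (y + s • v) :=
      intervalIntegral.integral_nonneg ht.1 fun s _ => strainSq_nonneg _ _
    have h4 : t * (‖v‖ ^ 4 * ∫ s in (0 : ℝ)..t, strainSq φ (y + s • v)) ≤ 1 / 2 * (D ^ 4 * I) := by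
      have := ht.2
      gcongr
    have h5 : fieldSq φ (y + t • v) * ‖v‖ ^ 2 ≤ fieldSq φ (y + t • v) * D ^ 2 := by
      have := fieldSq_nonneg φ (y + t • v)
      gcongr
    nlinarith [sq_nonneg (fieldDot φ (y + t • v) v + (fieldDot φ (y + t • v) v - fieldDot φ y v))]
  have hint : ∫ t in (0 : ℝ)..(1 / 2), fieldDot φ y v ^ 2 ≤
      ∫ t in (0 : ℝ)..(1 / 2), (2 * D ^ 2 * fieldSq φ (y + t • v) + D ^ 4 * I) :=
    intervalIntegral.integral_mono_on (by norm_num) (continuous_const.intervalIntegrable _ _)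
      (((continuous_const.mul hcF).add continuous_const).intervalIntegrable _ _) hpt
  have hcF' : Continuous fun s : ℝ => 2 * D ^ 2 * fieldSq φ (y + s • v) := continuous_const.mul hcF
  rw [intervalIntegral.integral_const, intervalIntegral.integral_add
    (hcF'.intervalIntegrable _ _) (continuous_const.intervalIntegrable _ _),
    intervalIntegral.integral_const_mul, intervalIntegral.integral_const] at hint
  rw [intervalIntegral.integral_add (hcF.intervalIntegrable _ _) (hcS.intervalIntegrable _ _)]
  simp only [smul_eq_mul] at hint
  have h6 : 0 ≤ D ^ 4 * J := by positivity
  have h7 : 0 ≤ D ^ 2 * I := by positivity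
  have e : (4 * D ^ 2 + D ^ 4) * (J + I) = 4 * (D ^ 2 * J) + D ^ 4 * J + 4 * (D ^ 2 * I) +
    D ^ 4 * I := by ring
  rw [e]
  linarith

end Segments

/-! ### The trace inequality for smooth fields -/

section TraceInequality

variable {d : ℕ}

/-- Integrating the measures of the sections of a cone over a subset of a hyperplane. -/
theorem exists_lintegral_cone_le (l : Pt d →L[ℝ] ℝ) (p a : Pt d) (ha : l (a - p) ≠ 0) :
    ∃ C : ℝ≥0∞, C ≠ ⊤ ∧ ∀ F A : Set (Pt d), (∀ y ∈ F, l (y - p) = 0) → MeasurableSet A →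
      ∫⁻ t in Ioo (0 : ℝ) (1 / 2), (Measure.euclideanHausdorffMeasure (d - 1) : Measure (Pt d))
        (F ∩ {y | y + t • (a - y) ∈ A}) ≤ C * volume A := by
  set μ : Measure (Pt d) := Measure.euclideanHausdorffMeasure (d - 1) with hμ
  set w : Pt d := (InnerProductSpace.toDual ℝ (Pt d)).symm l with hw
  have hlw : ∀ x, l x = inner ℝ w x := fun x => by
    rw [hw, InnerProductSpace.toDual_symm_apply]
  have hw0 : w ≠ 0 := by
    intro h
    rw [hlw, h, inner_zero_left] at ha
    exact ha rfl
  set α := l (a - p) with hα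
  have hww : inner ℝ w w ≠ (0 : ℝ) := fun h => hw0 (inner_self_eq_zero.1 h)
  -- The normal vector to the hyperplane scaled so that `l v = l (a - p)`: then `y + t (a - y)` lies
  -- in the parallel hyperplane through `p + t v`, and volume is sliced along `v`.
  set v : Pt d := (α / inner ℝ w w) • w with hv
  have hc0 : α / inner ℝ w w ≠ 0 := div_ne_zero ha hww
  have hv0 : v ≠ 0 := smul_ne_zero hc0 hw0
  have hlv : l v = α := by
    rw [hlw, hv, inner_smul_right]
    field_simp
  refine ⟨2 ^ (d - 1) * ‖v‖ₑ⁻¹, ?_, fun F A hF hA => ?_⟩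
  · exact ENNReal.mul_ne_top (by simp) (ENNReal.inv_ne_top.2 (by simpa using hv0))
  have hslice := EuclideanGeometry.euclideanHausdorffMeasure_eq_lintegral p hv0 hA
  rw [finrank_euclideanSpace_fin, EuclideanSpace.euclideanHausdorffMeasure_eq_volume] at hslice
  -- The section at height `t` is the image of the base under the homothety with centre `a` and
  -- ratio `1 - t ≥ 1/2`, so the measure of the base part is at most `2 ^ (d - 1)` times that of the
  -- section.
  have hpt : ∀ t ∈ Ioo (0 : ℝ) (1 / 2), μ (F ∩ {y | y + t • (a - y) ∈ A}) ≤
      2 ^ (d - 1) * μ (A ∩ AffineSubspace.mk' (t • v +ᵥ p) (ℝ ∙ v)ᗮ) := by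
    intro t ht
    have ht1 : (1 - t) ≠ 0 := by linarith [ht.2]
    have hsub : F ∩ {y | y + t • (a - y) ∈ A} ⊆ AffineMap.homothety a (1 - t) ⁻¹'
        (A ∩ AffineSubspace.mk' (t • v +ᵥ p) (ℝ ∙ v)ᗮ) := by
      rintro y ⟨hy, hyA⟩
      have e : AffineMap.homothety a (1 - t) y = y + t • (a - y) := by
        rw [AffineMap.homothety_apply, vsub_eq_sub, vadd_eq_add]
        module
      refine mem_preimage.2 ?_
      rw [e]
      refine ⟨hyA, ?_⟩
      rw [SetLike.mem_coe, AffineSubspace.mem_mk', Submodule.mem_orthogonal_singleton_iff_inner_right,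
        vsub_eq_sub, vadd_eq_add]
      have h1 : l (y + t • (a - y) - (t • v + p)) = 0 := by
        have e2 : y + t • (a - y) - (t • v + p) =
            (1 - t) • (y - p) + t • (a - p) - t • v := by module
        rw [e2, map_sub, map_add, map_smul, map_smul, map_smul, hF y hy, hlv]
        simp [hα]
      have h2 : ∀ z, inner ℝ v z = α / inner ℝ w w * l z := fun z => by
        rw [hlw z, hv, real_inner_smul_left]
      rw [h2, h1, mul_zero]
    refine (measure_mono hsub).trans ?_
    rw [hμ, euclideanHausdorffMeasure_homothety_preimage _ _ ht1, ENNReal.smul_def, smul_eq_mul]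
    gcongr
    have h2 : ‖(1 - t)‖₊⁻¹ ≤ 2 := by
      rw [inv_le_comm₀ (by simpa using ht1) (by norm_num), ← NNReal.coe_le_coe, coe_nnnorm,
        Real.norm_of_nonneg (by linarith [ht.2])]
      push_cast
      linarith [ht.2]
    calc ((‖(1 - t)‖₊⁻¹ ^ (d - 1) : NNReal) : ℝ≥0∞) ≤ ((2 ^ (d - 1) : NNReal) : ℝ≥0∞) :=
          ENNReal.coe_le_coe.2 (by gcongr)
      _ = 2 ^ (d - 1) := by push_cast; rfl
  calc ∫⁻ t in Ioo (0 : ℝ) (1 / 2), μ (F ∩ {y | y + t • (a - y) ∈ A})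
      ≤ ∫⁻ t in Ioo (0 : ℝ) (1 / 2),
          2 ^ (d - 1) * μ (A ∩ AffineSubspace.mk' (t • v +ᵥ p) (ℝ ∙ v)ᗮ) :=
        setLIntegral_mono' measurableSet_Ioo hpt
    _ ≤ ∫⁻ t : ℝ, 2 ^ (d - 1) * μ (A ∩ AffineSubspace.mk' (t • v +ᵥ p) (ℝ ∙ v)ᗮ) :=
        setLIntegral_le_lintegral _ _
    _ = 2 ^ (d - 1) * ∫⁻ t : ℝ, μ (A ∩ AffineSubspace.mk' (t • v +ᵥ p) (ℝ ∙ v)ᗮ) :=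
        lintegral_const_mul' _ _ (by simp)
    _ = 2 ^ (d - 1) * ‖v‖ₑ⁻¹ * volume A := by
        rw [hslice, mul_assoc, ← mul_assoc ‖v‖ₑ⁻¹, ENNReal.inv_mul_cancel (by simpa using hv0)
          (by simp), one_mul]

/-- The facet of a simplex opposite to the vertex `j`. -/
def facetOf (b : AffineBasis (Fin (d + 1)) ℝ (Pt d)) (j : Fin (d + 1)) : Set (Pt d) :=
  simplexOf b ∩ {y | b.coord j y = 0}

theorem measurableSet_facetOf (b : AffineBasis (Fin (d + 1)) ℝ (Pt d)) (j : Fin (d + 1)) :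
    MeasurableSet (facetOf b j) :=
  (isCompact_simplexOf b).measurableSet.inter
    ((isClosed_singleton (x := (0 : ℝ))).preimage (continuous_coord b j)).measurableSet

theorem segment_mem_simplexOf {b : AffineBasis (Fin (d + 1)) ℝ (Pt d)} {y a : Pt d}
    (hy : y ∈ simplexOf b) (ha : a ∈ simplexOf b) {t : ℝ} (ht : t ∈ Icc (0 : ℝ) 1) :
    y + t • (a - y) ∈ simplexOf b :=
  (convex_convexHull ℝ _).add_smul_sub_mem hy ha ht

/-- The map `(y, t) ↦ y + t (a - y)` pushes the product of the area of the facet and `dt` to a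
measure below a multiple of the volume, and the segments stay in the simplex. Applied to the simplex
itself, the cone estimate shows that the area is finite, because each section is the whole facet. -/
theorem exists_lintegral_facetOf_le (hd : 0 < d) (b : AffineBasis (Fin (d + 1)) ℝ (Pt d))
    (j : Fin (d + 1)) {a : Pt d} (haS : a ∈ simplexOf b) (ha : 0 < b.coord j a) :
    (Measure.euclideanHausdorffMeasure (d - 1) : Measure (Pt d)) (facetOf b j) ≠ ⊤ ∧
    ∃ C : ℝ≥0∞, C ≠ ⊤ ∧ ∀ G : Pt d → ℝ≥0∞, Measurable G →
      ∫⁻ y in facetOf b j, (∫⁻ t in Ioo (0 : ℝ) (1 / 2), G (y + t • (a - y)))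
        ∂(Measure.euclideanHausdorffMeasure (d - 1)) ≤ C * ∫⁻ x in simplexOf b, G x := by
  set μ : Measure (Pt d) := Measure.euclideanHausdorffMeasure (d - 1) with hμ
  have : Nontrivial (Fin (d + 1)) := Fin.nontrivial_iff_two_le.2 (by omega)
  obtain ⟨i, hi⟩ := exists_ne j
  have hS := (isCompact_simplexOf b).measurableSet
  have hFm := measurableSet_facetOf b j
  have hl : ∀ x, coordLin b j (x - b i) = b.coord j x := fun x => by
    rw [coord_eq b j x (b i), b.coord_apply_ne hi.symm, add_zero]
  obtain ⟨C, hC, hcone⟩ := exists_lintegral_cone_le (coordLin b j) (b i) a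
    (by rw [hl]; exact ha.ne')
  have hF : ∀ y ∈ facetOf b j, coordLin b j (y - b i) = 0 := fun y hy => by
    rw [hl]; exact hy.2
  have hfin : μ (facetOf b j) ≠ ⊤ := by
    have h1 := hcone _ (simplexOf b) hF hS
    have h2 : ∫⁻ t in Ioo (0 : ℝ) (1 / 2), μ (facetOf b j) ≤
        ∫⁻ t in Ioo (0 : ℝ) (1 / 2), μ (facetOf b j ∩ {y | y + t • (a - y) ∈ simplexOf b}) := by
      refine setLIntegral_mono' measurableSet_Ioo fun t ht => measure_mono fun y hy => ⟨hy, ?_⟩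
      exact segment_mem_simplexOf hy.1 haS ⟨ht.1.le, by linarith [ht.2]⟩
    rw [setLIntegral_const, Real.volume_Ioo] at h2
    have h3 := (h2.trans h1).trans_lt
      (ENNReal.mul_lt_top hC.lt_top (isCompact_simplexOf b).measure_lt_top)
    intro h
    rw [h, ENNReal.top_mul (by simp)] at h3
    exact lt_irrefl _ h3
  refine ⟨hfin, C, hC, fun G hG => ?_⟩
  have : IsFiniteMeasure (μ.restrict (facetOf b j)) := ⟨by simpa using hfin.lt_top⟩
  set ρ := (μ.restrict (facetOf b j)).prod (volume.restrict (Ioo (0 : ℝ) (1 / 2))) with hρ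
  let f : Pt d × ℝ → Pt d := fun q => q.1 + q.2 • (a - q.1)
  have hf : Measurable f := by
    have : Continuous f := by fun_prop
    exact this.measurable
  have hmap : ρ.map f ≤ C • volume := by
    refine Measure.le_iff.2 fun A hA => ?_
    rw [Measure.map_apply hf hA, hρ, Measure.prod_apply_symm (hf hA), Measure.smul_apply,
      smul_eq_mul]
    refine le_trans (lintegral_mono fun t => ?_) (hcone _ A hF hA)
    have hm : MeasurableSet ((fun y => (y, t)) ⁻¹' (f ⁻¹' A)) :=
      (hf.comp (measurable_id.prodMk measurable_const)) hA
    rw [Measure.restrict_apply hm, inter_comm]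
    exact le_rfl
  have hG' : Measurable ((simplexOf b).indicator G) := hG.indicator hS
  calc ∫⁻ y in facetOf b j, (∫⁻ t in Ioo (0 : ℝ) (1 / 2), G (y + t • (a - y))) ∂μ
      = ∫⁻ y in facetOf b j, (∫⁻ t in Ioo (0 : ℝ) (1 / 2),
          (simplexOf b).indicator G (y + t • (a - y))) ∂μ := by
        refine setLIntegral_congr_fun hFm fun y hy => ?_
        refine setLIntegral_congr_fun measurableSet_Ioo fun t ht => ?_
        rw [indicator_of_mem]
        exact segment_mem_simplexOf hy.1 haS ⟨ht.1.le, by linarith [ht.2]⟩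
    _ = ∫⁻ q, (simplexOf b).indicator G (f q) ∂ρ :=
        (lintegral_prod _ (hG'.comp hf).aemeasurable).symm
    _ = ∫⁻ x, (simplexOf b).indicator G x ∂(ρ.map f) := (lintegral_map hG' hf).symm
    _ ≤ ∫⁻ x, (simplexOf b).indicator G x ∂(C • volume) := lintegral_mono' hmap le_rfl
    _ = C * ∫⁻ x in simplexOf b, G x := by
        rw [lintegral_smul_measure, lintegral_indicator hS, smul_eq_mul]

/-- The edges issuing from one vertex span the space, so pairing with them is injective, hence
bounded below in finite dimension. -/
theorem exists_sum_sq_le_of_affineBasis (b : AffineBasis (Fin (d + 1)) ℝ (Pt d))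
    (j : Fin (d + 1)) : ∃ C : ℝ, 0 ≤ C ∧ ∀ ξ : Pt d,
      ‖ξ‖ ^ 2 ≤ C * ∑ i, (inner ℝ ξ (b i - b j)) ^ 2 := by
  let L : Pt d →ₗ[ℝ] EuclideanSpace ℝ (Fin (d + 1)) :=
    { toFun := fun ξ => WithLp.toLp 2 fun i => inner ℝ ξ (b i - b j)
      map_add' := fun x y => by ext i; simp [inner_add_left]
      map_smul' := fun r x => by ext i; simp [inner_smul_left] }
  have hL : L.ker = ⊥ := by
    refine LinearMap.ker_eq_bot'.2 fun ξ hξ => ?_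
    have h1 : ∀ i, inner ℝ ξ (b i - b j) = (0 : ℝ) := fun i => by
      have := congrArg (fun z : EuclideanSpace ℝ (Fin (d + 1)) => z i) hξ
      simpa [L] using this
    have h2 := b.linear_combination_coord_eq_self (ξ + b j)
    have h3 := b.sum_coord_apply_eq_one (ξ + b j)
    have h4 : ξ = ∑ i, b.coord i (ξ + b j) • (b i - b j) := by
      simp only [smul_sub, Finset.sum_sub_distrib, ← Finset.sum_smul, h3, h2]
      simp
    have h5 : inner ℝ ξ ξ = (0 : ℝ) := by
      nth_rewrite 2 [h4]
      rw [inner_sum]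
      exact Finset.sum_eq_zero fun i _ => by rw [inner_smul_right, h1, mul_zero]
    exact inner_self_eq_zero.1 h5
  obtain ⟨K, -, hK⟩ := L.exists_antilipschitzWith hL
  refine ⟨(K : ℝ) ^ 2, sq_nonneg _, fun ξ => ?_⟩
  have h1 : ‖ξ‖ ≤ K * ‖L ξ‖ := by
    have := hK.le_mul_dist ξ 0
    simpa [dist_eq_norm] using this
  have h2 : ‖L ξ‖ ^ 2 = ∑ i, (inner ℝ ξ (b i - b j)) ^ 2 := by
    rw [EuclideanSpace.real_norm_sq_eq]
    rfl
  rw [← h2, ← mul_pow]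
  gcongr

/-- Each component `φ(y) ⬝ (a i - y)` is controlled by the field and its strain along the segment
from `y` to `a i`. The differences of these directions are half the edges at the vertex `j`, so
together the components control `φ(y)`. -/
theorem exists_lintegral_fieldSq_facetOf_le (hd : 0 < d)
    (b : AffineBasis (Fin (d + 1)) ℝ (Pt d)) (j : Fin (d + 1)) :
    (Measure.euclideanHausdorffMeasure (d - 1) : Measure (Pt d)) (facetOf b j) ≠ ⊤ ∧
    ∃ C : ℝ≥0∞, C ≠ ⊤ ∧ ∀ φ : Fin d → Pt d → ℝ, (∀ i, ContDiff ℝ ∞ (φ i)) →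
      ∫⁻ y in facetOf b j, ENNReal.ofReal (fieldSq φ y)
        ∂(Measure.euclideanHausdorffMeasure (d - 1)) ≤
      C * ∫⁻ x in simplexOf b, ENNReal.ofReal (fieldSq φ x + strainSq φ x) := by
  set μ : Measure (Pt d) := Measure.euclideanHausdorffMeasure (d - 1) with hμ
  -- The vertex opposite to the facet and the midpoints of the edges from it: none of these points
  -- lies on the facet.
  let a : Fin (d + 1) → Pt d := fun i => b j + (1 / 2 : ℝ) • (b i - b j)
  have hbS : ∀ i, b i ∈ simplexOf b := fun i => subset_convexHull ℝ _ (mem_range_self i)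
  have haS : ∀ i, a i ∈ simplexOf b := fun i =>
    segment_mem_simplexOf (hbS j) (hbS i) ⟨by norm_num, by norm_num⟩
  have ha : ∀ i, 0 < b.coord j (a i) := fun i => by
    have h1 := coord_eq b j (a i) (b j)
    have h2 := coord_eq b j (b i) (b j)
    have h3 : 0 ≤ b.coord j (b i) := mem_simplexOf.1 (hbS i) j
    have e : a i - b j = (1 / 2 : ℝ) • (b i - b j) := by simp [a]
    rw [e, map_smul, smul_eq_mul, b.coord_apply_eq] at h1
    rw [b.coord_apply_eq] at h2
    linarith
  have hmain := fun i => exists_lintegral_facetOf_le hd b j (haS i) (ha i)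
  refine ⟨(hmain j).1, ?_⟩
  choose hfin C hC hG using hmain
  obtain ⟨K, hK0, hK⟩ := exists_sum_sq_le_of_affineBasis b j
  obtain ⟨D, hD⟩ := (isCompact_simplexOf b).isBounded.exists_norm_le
  have hD0 : 0 ≤ D := (norm_nonneg _).trans (hD _ (hbS j))
  set M : ℝ := K * (8 * ((d : ℝ) + 2)) with hM
  have hM0 : 0 ≤ M := by positivity
  set N : ℝ := 4 * (2 * D) ^ 2 + (2 * D) ^ 4 with hN
  have hN0 : 0 ≤ N := by positivity
  refine ⟨ENNReal.ofReal M * (ENNReal.ofReal N * ∑ i, C i),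
    ENNReal.mul_ne_top ENNReal.ofReal_ne_top (ENNReal.mul_ne_top ENNReal.ofReal_ne_top
      (ENNReal.sum_ne_top.2 fun i _ => hC i)), fun φ hφ => ?_⟩
  have hpt : ∀ y : Pt d, fieldSq φ y ≤ M * ∑ i, fieldDot φ y (a i - y) ^ 2 := by
    intro y
    let ξ : Pt d := WithLp.toLp 2 fun k => φ k y
    have h1 : ‖ξ‖ ^ 2 = fieldSq φ y := by rw [EuclideanSpace.real_norm_sq_eq]; rfl
    have h2 : ∀ v : Pt d, inner ℝ ξ v = fieldDot φ y v := fun v => by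
      rw [PiLp.inner_apply]
      exact Finset.sum_congr rfl fun k _ => by simp [ξ, mul_comm]
    have h3 : ∀ i, (inner ℝ ξ (b i - b j)) ^ 2 ≤
        8 * (fieldDot φ y (a i - y) ^ 2 + fieldDot φ y (a j - y) ^ 2) := fun i => by
      have e : b i - b j = (2 : ℝ) • ((a i - y) - (a j - y)) := by
        simp only [a]
        module
      rw [e, inner_smul_right, inner_sub_right, h2, h2]
      nlinarith [sq_nonneg (fieldDot φ y (a i - y) + fieldDot φ y (a j - y))]
    -- Each of the `d + 1` terms also contributes the index `j`, whence the factor `1 + (d + 1) = d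
    -- + 2`.
    have h4 : ∑ i, (inner ℝ ξ (b i - b j)) ^ 2 ≤
        8 * ((d : ℝ) + 2) * ∑ i, fieldDot φ y (a i - y) ^ 2 := by
      refine (Finset.sum_le_sum fun i _ => h3 i).trans ?_
      rw [← Finset.mul_sum, Finset.sum_add_distrib, Finset.sum_const, Finset.card_univ,
        Fintype.card_fin, nsmul_eq_mul]
      have h5 : fieldDot φ y (a j - y) ^ 2 ≤ ∑ i, fieldDot φ y (a i - y) ^ 2 :=
        Finset.single_le_sum (f := fun i => fieldDot φ y (a i - y) ^ 2)
          (fun i _ => sq_nonneg _) (Finset.mem_univ j)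
      have h6 : ((d + 1 : ℕ) : ℝ) * fieldDot φ y (a j - y) ^ 2 ≤
          (d + 1 : ℕ) * ∑ i, fieldDot φ y (a i - y) ^ 2 := by gcongr
      push_cast at h6 ⊢
      linarith
    rw [← h1, hM, mul_assoc]
    exact (hK ξ).trans (by gcongr)
  have hGm : Measurable fun x => ENNReal.ofReal (fieldSq φ x + strainSq φ x) :=
    ((continuous_fieldSq hφ).add (continuous_strainSq hφ)).measurable.ennreal_ofReal
  have hdotm : ∀ i, Measurable fun y => ENNReal.ofReal (fieldDot φ y (a i - y) ^ 2) := fun i => by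
    have : Continuous fun y => fieldDot φ y (a i - y) :=
      continuous_finsetSum _ fun k _ => (hφ k).continuous.mul (by fun_prop)
    exact (this.pow 2).measurable.ennreal_ofReal
  have hi : ∀ i, ∫⁻ y in facetOf b j, ENNReal.ofReal (fieldDot φ y (a i - y) ^ 2) ∂μ ≤
      ENNReal.ofReal N *
        (C i * ∫⁻ x in simplexOf b, ENNReal.ofReal (fieldSq φ x + strainSq φ x)) := fun i => by
    calc ∫⁻ y in facetOf b j, ENNReal.ofReal (fieldDot φ y (a i - y) ^ 2) ∂μ
        ≤ ∫⁻ y in facetOf b j, ENNReal.ofReal N * (∫⁻ t in Ioo (0 : ℝ) (1 / 2), ENNReal.ofReal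
            (fieldSq φ (y + t • (a i - y)) + strainSq φ (y + t • (a i - y)))) ∂μ := by
          refine setLIntegral_mono' (measurableSet_facetOf b j) fun y hy => ?_
          have hv : ‖a i - y‖ ≤ 2 * D := by
            have h1 := norm_sub_le (a i) y
            have h2 := hD _ (haS i)
            have h3 := hD _ hy.1
            linarith
          have h4 := fieldDot_sq_le_integral hφ y (a i - y) hv
          have hcont : Continuous fun s : ℝ =>
              fieldSq φ (y + s • (a i - y)) + strainSq φ (y + s • (a i - y)) :=
            ((continuous_fieldSq hφ).add (continuous_strainSq hφ)).comp (by fun_prop)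
          rw [intervalIntegral.integral_of_le (by norm_num), integral_Ioc_eq_integral_Ioo] at h4
          refine (ENNReal.ofReal_le_ofReal h4).trans ?_
          rw [ENNReal.ofReal_mul hN0, ofReal_integral_eq_lintegral_ofReal]
          · exact (hcont.integrableOn_Icc).mono_set Ioo_subset_Icc_self
          · exact Eventually.of_forall fun s => add_nonneg (fieldSq_nonneg _ _) (strainSq_nonneg _ _)
      _ = ENNReal.ofReal N * ∫⁻ y in facetOf b j, (∫⁻ t in Ioo (0 : ℝ) (1 / 2), ENNReal.ofReal
            (fieldSq φ (y + t • (a i - y)) + strainSq φ (y + t • (a i - y)))) ∂μ :=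
          lintegral_const_mul' _ _ ENNReal.ofReal_ne_top
      _ ≤ _ := by
          gcongr
          exact hG i _ hGm
  calc ∫⁻ y in facetOf b j, ENNReal.ofReal (fieldSq φ y) ∂μ
      ≤ ∫⁻ y in facetOf b j, ENNReal.ofReal M *
          ∑ i, ENNReal.ofReal (fieldDot φ y (a i - y) ^ 2) ∂μ := by
        refine lintegral_mono fun y => ?_
        rw [← ENNReal.ofReal_sum_of_nonneg fun i _ => sq_nonneg _, ← ENNReal.ofReal_mul hM0]
        exact ENNReal.ofReal_le_ofReal (hpt y)
    _ = ENNReal.ofReal M *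
          ∑ i, ∫⁻ y in facetOf b j, ENNReal.ofReal (fieldDot φ y (a i - y) ^ 2) ∂μ := by
        rw [lintegral_const_mul' _ _ ENNReal.ofReal_ne_top, lintegral_finsetSum _ fun i _ => hdotm i]
    _ ≤ ENNReal.ofReal M * ∑ i, ENNReal.ofReal N *
          (C i * ∫⁻ x in simplexOf b, ENNReal.ofReal (fieldSq φ x + strainSq φ x)) := by
        gcongr with i
        exact hi i
    _ = _ := by
        rw [← Finset.mul_sum, ← Finset.sum_mul]
        ring

/-- A frontier point lies in some simplex but not in its interior, so one of its barycentric
coordinates vanishes. -/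
theorem frontier_subset_iUnion_facetOf {n : ℕ} (b : Fin n → AffineBasis (Fin (d + 1)) ℝ (Pt d)) :
    frontier (interior (⋃ k, simplexOf (b k))) ⊆
      ⋃ q : Fin n × Fin (d + 1), facetOf (b q.1) q.2 := by
  intro x hx
  rw [isOpen_interior.frontier_eq] at hx
  have hxU : x ∈ ⋃ k, simplexOf (b k) :=
    (isCompact_iUnion_simplexOf b).isClosed.closure_subset_iff.2 interior_subset hx.1
  obtain ⟨k, hk⟩ := mem_iUnion.1 hxU
  by_contra h
  refine hx.2 (interior_mono (subset_iUnion (fun k => simplexOf (b k)) k)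
    (mem_interior_simplexOf.2 fun j => ?_))
  refine lt_of_le_of_ne (mem_simplexOf.1 hk j) fun h0 => h (mem_iUnion.2 ⟨(k, j), hk, h0.symm⟩)

/-- The boundary of a convex set has measure zero. -/
theorem lintegral_simplexOf (b : AffineBasis (Fin (d + 1)) ℝ (Pt d)) (G : Pt d → ℝ≥0∞) :
    ∫⁻ x in simplexOf b, G x = ∫⁻ x in interior (simplexOf b), G x := by
  have h : (interior (simplexOf b) : Set (Pt d)) =ᵐ[volume] simplexOf b :=
    interior_ae_eq_of_null_frontier ((convex_convexHull ℝ _).addHaar_frontier volume)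
  exact (setLIntegral_congr h).symm

/-- The trace inequality for smooth fields. -/
theorem IsPolygonalDomain.exists_lintegral_surfaceMeasure_le {Ω : Set (Pt d)} (hd : 0 < d)
    (h : IsPolygonalDomain Ω) : surfaceMeasure Ω univ ≠ ⊤ ∧
    ∃ C : ℝ≥0∞, C ≠ ⊤ ∧ ∀ φ : Fin d → Pt d → ℝ, (∀ i, ContDiff ℝ ∞ (φ i)) →
      ∫⁻ y, ENNReal.ofReal (fieldSq φ y) ∂(surfaceMeasure Ω) ≤
      C * ∫⁻ x in Ω, ENNReal.ofReal (fieldSq φ x + strainSq φ x) := by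
  set μ : Measure (Pt d) := Measure.euclideanHausdorffMeasure (d - 1) with hμ
  obtain ⟨n, b, hΩ⟩ := h.exists_simplices
  have hsub : frontier Ω ⊆ ⋃ q : Fin n × Fin (d + 1), facetOf (b q.1) q.2 := by
    rw [hΩ]; exact frontier_subset_iUnion_facetOf b
  have hmain := fun q : Fin n × Fin (d + 1) => exists_lintegral_fieldSq_facetOf_le hd (b q.1) q.2
  choose hfin C hC hG using hmain
  constructor
  · rw [surfaceMeasure, Measure.restrict_apply_univ]
    refine ne_top_of_le_ne_top ?_ ((measure_mono hsub).trans (measure_iUnion_le _))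
    rw [tsum_fintype]
    exact ENNReal.sum_ne_top.2 fun q _ => hfin q
  refine ⟨∑ q, C q, ENNReal.sum_ne_top.2 fun q _ => hC q, fun φ hφ => ?_⟩
  calc ∫⁻ y, ENNReal.ofReal (fieldSq φ y) ∂(surfaceMeasure Ω)
      ≤ ∫⁻ y in ⋃ q : Fin n × Fin (d + 1), facetOf (b q.1) q.2, ENNReal.ofReal (fieldSq φ y) ∂μ :=
        lintegral_mono_set hsub
    _ ≤ ∑' q : Fin n × Fin (d + 1), ∫⁻ y in facetOf (b q.1) q.2, ENNReal.ofReal (fieldSq φ y) ∂μ :=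
        lintegral_iUnion_le _ _
    _ = ∑ q : Fin n × Fin (d + 1), ∫⁻ y in facetOf (b q.1) q.2, ENNReal.ofReal (fieldSq φ y) ∂μ :=
        tsum_fintype _
    _ ≤ ∑ q : Fin n × Fin (d + 1), C q *
          ∫⁻ x in Ω, ENNReal.ofReal (fieldSq φ x + strainSq φ x) := by
        refine Finset.sum_le_sum fun q _ => (hG q φ hφ).trans ?_
        rw [lintegral_simplexOf]
        gcongr
        rw [hΩ]
        exact interior_mono (subset_iUnion (fun k => simplexOf (b k)) q.1)
    _ = _ := (Finset.sum_mul _ _ _).symm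

end TraceInequality

/-! ### Korn's inequality on convex sets -/

section LocalKorn

variable {d : ℕ}

theorem fieldDot_sub (φ : Fin d → Pt d → ℝ) (x v w : Pt d) :
    fieldDot φ x (v - w) = fieldDot φ x v - fieldDot φ x w := by
  simp [fieldDot, mul_sub, Finset.sum_sub_distrib]

theorem fieldDot_smul_single (φ : Fin d → Pt d → ℝ) (x : Pt d) (r : ℝ) (j : Fin d) :
    fieldDot φ x (r • EuclideanSpace.single j 1) = r * φ j x := by
  simp [fieldDot, mul_comm]

/-- `(φ(x) - φ(a)) ⬝ (x - a)`, which vanishes for rigid motions. -/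
def strainGap (φ : Fin d → Pt d → ℝ) (x a : Pt d) : ℝ :=
  fieldDot φ x (x - a) - fieldDot φ a (x - a)

theorem continuous_strainGap {φ : Fin d → Pt d → ℝ} (hφ : ∀ i, ContDiff ℝ ∞ (φ i)) :
    Continuous fun z : Pt d × Pt d => strainGap φ z.1 z.2 := by
  have h1 : ∀ i, Continuous (φ i) := fun i => (hφ i).continuous
  unfold strainGap fieldDot
  fun_prop

theorem ofReal_strainGap_sq_le {φ : Fin d → Pt d → ℝ} (hφ : ∀ i, ContDiff ℝ ∞ (φ i)) {x a : Pt d}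
    {D : ℝ} (hD : ‖x - a‖ ≤ D) : ENNReal.ofReal (strainGap φ x a ^ 2) ≤
      ENNReal.ofReal (D ^ 4) *
        ∫⁻ t in Ioo (0 : ℝ) 1, ENNReal.ofReal (strainSq φ (a + t • (x - a))) := by
  have h := fieldDot_sub_sq_le hφ a (x - a) zero_le_one
  have hc : Continuous fun s : ℝ => strainSq φ (a + s • (x - a)) :=
    (continuous_strainSq hφ).comp (by fun_prop)
  rw [one_smul, add_sub_cancel, one_mul] at h
  rw [← ofReal_integral_eq_lintegral_ofReal
    ((hc.integrableOn_Icc).mono_set Ioo_subset_Icc_self)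
    (Eventually.of_forall fun s => strainSq_nonneg _ _), ← ENNReal.ofReal_mul (by positivity)]
  refine ENNReal.ofReal_le_ofReal (h.trans ?_)
  rw [intervalIntegral.integral_of_le zero_le_one, integral_Ioc_eq_integral_Ioo]
  have : 0 ≤ ∫ s in Ioo (0 : ℝ) 1, strainSq φ (a + s • (x - a)) :=
    integral_nonneg fun s => strainSq_nonneg _ _
  gcongr

theorem setLIntegral_comp_affine_le {f : Pt d → ℝ≥0∞} (hf : Measurable f) {s V : Set (Pt d)}
    (hs : MeasurableSet s) (hV : MeasurableSet V) (w : Pt d) {c : ℝ} (hc : c ≠ 0)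
    (h : ∀ x ∈ s, w + c • x ∈ V) :
    ∫⁻ x in s, f (w + c • x) ≤ ENNReal.ofReal |(c ^ d)⁻¹| * ∫⁻ x in V, f x := by
  have hF : Measurable fun y => V.indicator f (w + y) :=
    (hf.indicator hV).comp (measurable_const_add w)
  calc ∫⁻ x in s, f (w + c • x)
      = ∫⁻ x in s, V.indicator f (w + c • x) :=
        setLIntegral_congr_fun hs fun x hx => by rw [indicator_of_mem (h x hx)]
    _ ≤ ∫⁻ x, V.indicator f (w + c • x) := setLIntegral_le_lintegral _ _
    _ = ∫⁻ y, V.indicator f (w + y) ∂((volume : Measure (Pt d)).map (c • ·)) :=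
        (lintegral_map hF (measurable_const_smul c)).symm
    _ = ENNReal.ofReal |(c ^ d)⁻¹| * ∫⁻ y, V.indicator f (w + y) := by
        rw [Measure.map_addHaar_smul _ hc, lintegral_smul_measure, finrank_euclideanSpace_fin,
          smul_eq_mul]
    _ = _ := by rw [lintegral_add_left_eq_self, lintegral_indicator hV]

/-- The gap at `(x, a)` is bounded by the strain along the segment from `a` to `x`, which stays in
the convex set. For each parameter `t` the integral over pairs is reduced to one over `V` by an
affine substitution. -/
theorem exists_lintegral_strainGap_le {V : Set (Pt d)} (hV : Convex ℝ V) (hVo : MeasurableSet V)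
    (hb : Bornology.IsBounded V) :
    ∃ C : ℝ≥0∞, C ≠ ⊤ ∧ ∀ φ : Fin d → Pt d → ℝ, (∀ i, ContDiff ℝ ∞ (φ i)) →
      ∫⁻ z, ENNReal.ofReal (strainGap φ z.1 z.2 ^ 2)
        ∂((volume.restrict V).prod (volume.restrict V)) ≤
      C * ∫⁻ x in V, ENNReal.ofReal (strainSq φ x) := by
  obtain ⟨D, hD⟩ := hb.exists_norm_le
  have hDV : ∀ x ∈ V, ∀ a ∈ V, ‖x - a‖ ≤ 2 * D := fun x hx a ha => by
    have h1 := norm_sub_le x a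
    have h2 := hD _ hx
    have h3 := hD _ ha
    linarith
  set P := ((volume : Measure (Pt d)).restrict V).prod ((volume : Measure (Pt d)).restrict V) with hP
  refine ⟨ENNReal.ofReal ((2 * D) ^ 4) * (2 ^ d * volume V), ENNReal.mul_ne_top
    ENNReal.ofReal_ne_top (ENNReal.mul_ne_top (by simp) hb.measure_lt_top.ne), fun φ hφ => ?_⟩
  set S : Pt d → ℝ≥0∞ := fun x => ENNReal.ofReal (strainSq φ x) with hS
  have hSm : Measurable S := (continuous_strainSq hφ).measurable.ennreal_ofReal
  have hVV : ∀ᵐ z ∂P, z.1 ∈ V ∧ z.2 ∈ V := by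
    rw [hP, Measure.prod_restrict]
    exact ae_restrict_mem (hVo.prod hVo)
  have hFm : Measurable fun q : (Pt d × Pt d) × ℝ => S (q.1.2 + q.2 • (q.1.1 - q.1.2)) := by
    have : Continuous fun q : (Pt d × Pt d) × ℝ => q.1.2 + q.2 • (q.1.1 - q.1.2) := by fun_prop
    exact hSm.comp this.measurable
  have hscale : ∀ c : ℝ, 1 / 2 ≤ c → ENNReal.ofReal |(c ^ d)⁻¹| ≤ 2 ^ d := fun c hc => by
    have h0 : 0 < c := by linarith
    rw [abs_of_pos (by positivity), ← inv_pow, ENNReal.ofReal_pow (by positivity)]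
    gcongr
    rw [← ENNReal.ofReal_ofNat]
    refine ENNReal.ofReal_le_ofReal ?_
    rw [inv_le_comm₀ h0 (by norm_num)]
    linarith
  have ht : ∀ t ∈ Ioo (0 : ℝ) 1, ∫⁻ z, S (z.2 + t • (z.1 - z.2)) ∂P ≤
      2 ^ d * volume V * ∫⁻ x in V, S x := by
    intro t ht
    have hm : Measurable fun z : Pt d × Pt d => S (z.2 + t • (z.1 - z.2)) := by
      have : Continuous fun z : Pt d × Pt d => z.2 + t • (z.1 - z.2) := by fun_prop
      exact hSm.comp this.measurable
    have hfin : ∀ G : Pt d → ℝ≥0∞, (∀ x ∈ V, G x ≤ 2 ^ d * ∫⁻ x in V, S x) →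
        ∫⁻ x in V, G x ≤ 2 ^ d * volume V * ∫⁻ x in V, S x := fun G hG => by
      refine (setLIntegral_mono' hVo hG).trans ?_
      rw [setLIntegral_const, mul_right_comm]
    -- The substitution is made in `x` (ratio `t`) or in `a` (ratio `1 - t`), whichever ratio is at
    -- least `1/2`, so the Jacobian factor is at most `2 ^ d`.
    rcases le_total (1 / 2) t with h | h
    · rw [hP, lintegral_prod_symm _ hm.aemeasurable]
      refine hfin _ fun a ha => ?_
      have e : ∀ x, a + t • (x - a) = (a - t • a) + t • x := fun x => by module
      simp only [e]
      have h1 := setLIntegral_comp_affine_le hSm hVo hVo (a - t • a) ht.1.ne' fun x hx => by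
        rw [← e]
        exact hV.add_smul_sub_mem ha hx ⟨ht.1.le, ht.2.le⟩
      refine h1.trans ?_
      gcongr
      exact hscale t h
    · rw [hP, lintegral_prod _ hm.aemeasurable]
      refine hfin _ fun x hx => ?_
      have e : ∀ a, a + t • (x - a) = t • x + (1 - t) • a := fun a => by module
      simp only [e]
      have ht1 : (1 - t) ≠ 0 := by linarith [ht.2]
      have h1 := setLIntegral_comp_affine_le hSm hVo hVo (t • x) ht1 fun a ha => by
        rw [← e]
        exact hV.add_smul_sub_mem ha hx ⟨ht.1.le, ht.2.le⟩
      refine h1.trans ?_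
      gcongr
      exact hscale (1 - t) (by linarith)
  calc ∫⁻ z, ENNReal.ofReal (strainGap φ z.1 z.2 ^ 2) ∂P
      ≤ ∫⁻ z, ENNReal.ofReal ((2 * D) ^ 4) *
          (∫⁻ t in Ioo (0 : ℝ) 1, S (z.2 + t • (z.1 - z.2))) ∂P := by
        refine lintegral_mono_ae ?_
        filter_upwards [hVV] with z hz
        exact ofReal_strainGap_sq_le hφ (hDV _ hz.1 _ hz.2)
    _ = ENNReal.ofReal ((2 * D) ^ 4) *
          ∫⁻ z, (∫⁻ t in Ioo (0 : ℝ) 1, S (z.2 + t • (z.1 - z.2))) ∂P :=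
        lintegral_const_mul' _ _ ENNReal.ofReal_ne_top
    _ = ENNReal.ofReal ((2 * D) ^ 4) *
          ∫⁻ t in Ioo (0 : ℝ) 1, ∫⁻ z, S (z.2 + t • (z.1 - z.2)) ∂P := by
        rw [lintegral_lintegral_swap]
        exact hFm.aemeasurable
    _ ≤ ENNReal.ofReal ((2 * D) ^ 4) *
          ∫⁻ t in Ioo (0 : ℝ) 1, 2 ^ d * volume V * ∫⁻ x in V, S x := by
        gcongr 1
        exact setLIntegral_mono' measurableSet_Ioo ht
    _ = _ := by
        rw [setLIntegral_const, Real.volume_Ioo]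
        simp [mul_assoc]

/-- Base points at which the strain gaps are controlled. -/
theorem exists_points_strainGap_le {V : Set (Pt d)} (hV : Convex ℝ V) (hVo : MeasurableSet V)
    (hb : Bornology.IsBounded V) {ι : Type*} [Fintype ι] (p : ι → Pt d) {ρ : ℝ} (hρ : 0 < ρ)
    (hp : ∀ i, Metric.ball (p i) ρ ⊆ V) :
    ∃ C : ℝ≥0∞, C ≠ ⊤ ∧ ∀ φ : Fin d → Pt d → ℝ, (∀ i, ContDiff ℝ ∞ (φ i)) →
      ∃ w ∈ Metric.ball (0 : Pt d) ρ,
      (∑ i, ∫⁻ x in V, ENNReal.ofReal (strainGap φ x (p i + w) ^ 2)) +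
        ∑ i, ∑ k, ENNReal.ofReal (strainGap φ (p i + w) (p k + w) ^ 2) ≤
      C * ∫⁻ x in V, ENNReal.ofReal (strainSq φ x) := by
  obtain ⟨C, hC, hgap⟩ := exists_lintegral_strainGap_le hV hVo hb
  set B := Metric.ball (0 : Pt d) ρ with hB
  have hBm : MeasurableSet B := measurableSet_ball
  have hB0 : volume B ≠ 0 := (Metric.measure_ball_pos volume _ hρ).ne'
  have hBt : volume B ≠ ⊤ := measure_ball_lt_top.ne
  have hpB : ∀ i, ∀ w ∈ B, p i + w ∈ V := fun i w hw =>
    hp i (by rw [hB, mem_ball_zero_iff] at hw; simpa [Metric.mem_ball, dist_eq_norm] using hw)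
  let N : ι × ι → ℝ≥0∞ := fun q => ENNReal.ofReal (‖p q.1 - p q.2‖ ^ 4)
  set C' : ℝ≥0∞ := Fintype.card ι * C + ∑ q, N q with hC'
  have hC't : C' ≠ ⊤ := ENNReal.add_ne_top.2 ⟨ENNReal.mul_ne_top (by simp) hC,
    ENNReal.sum_ne_top.2 fun q _ => ENNReal.ofReal_ne_top⟩
  refine ⟨(volume B)⁻¹ * C', ENNReal.mul_ne_top (ENNReal.inv_ne_top.2 hB0) hC't, fun φ hφ => ?_⟩
  set S : Pt d → ℝ≥0∞ := fun x => ENNReal.ofReal (strainSq φ x) with hS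
  have hSm : Measurable S := (continuous_strainSq hφ).measurable.ennreal_ofReal
  let G : Pt d × Pt d → ℝ≥0∞ := fun z => ENNReal.ofReal (strainGap φ z.1 z.2 ^ 2)
  have hGm : Measurable G := ((continuous_strainGap hφ).pow 2).measurable.ennreal_ofReal
  have hGi : Measurable fun a => ∫⁻ x in V, G (x, a) := hGm.lintegral_prod_left'
  have hT1 : ∀ i, Measurable fun w => ∫⁻ x in V, G (x, p i + w) := fun i =>
    hGi.comp (measurable_const_add (p i))
  have hT2 : ∀ i k, Measurable fun w => G (p i + w, p k + w) := fun i k =>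
    hGm.comp ((measurable_const_add (p i)).prodMk (measurable_const_add (p k)))
  let T : Pt d → ℝ≥0∞ := fun w =>
    (∑ i, ∫⁻ x in V, G (x, p i + w)) + ∑ i, ∑ k, G (p i + w, p k + w)
  have hTm : Measurable T := (Finset.measurable_fun_sum _ fun i _ => hT1 i).add
    (Finset.measurable_fun_sum _ fun i _ => Finset.measurable_fun_sum _ fun k _ => hT2 i k)
  -- Point values of the gaps are not bounded by integrals of the strain, but some `w` does no worse
  -- than the average. All points move by the same `w`, so their relative positions are preserved.
  obtain ⟨w, hw, hTw⟩ := exists_le_setLAverage (μ := volume) hB0 hBt hTm.aemeasurable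
  refine ⟨w, hw, hTw.trans ?_⟩
  rw [setLAverage_eq, ENNReal.div_eq_inv_mul, mul_assoc]
  gcongr
  have h1 : ∀ i, ∫⁻ w in B, ∫⁻ x in V, G (x, p i + w) ≤ C * ∫⁻ x in V, S x := fun i => by
    have h2 := setLIntegral_comp_affine_le hGi hBm hVo (p i) one_ne_zero
      fun w hw => by rw [one_smul]; exact hpB i w hw
    simp only [one_smul, one_pow, inv_one, abs_one, ENNReal.ofReal_one, one_mul] at h2
    refine h2.trans (le_trans (le_of_eq ?_) (hgap φ hφ))
    rw [lintegral_prod_symm _ hGm.aemeasurable]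
  have h2 : ∀ i k, ∫⁻ w in B, G (p i + w, p k + w) ≤ N (i, k) * ∫⁻ x in V, S x := fun i k => by
    have hFm : Measurable fun q : Pt d × ℝ => S ((p k + q.2 • (p i - p k)) + q.1) := by
      have : Continuous fun q : Pt d × ℝ => (p k + q.2 • (p i - p k)) + q.1 := by fun_prop
      exact hSm.comp this.measurable
    calc ∫⁻ w in B, G (p i + w, p k + w)
        ≤ ∫⁻ w in B, N (i, k) * ∫⁻ t in Ioo (0 : ℝ) 1, S ((p k + t • (p i - p k)) + w) := by
          refine lintegral_mono fun w => ?_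
          have e : (p i + w) - (p k + w) = p i - p k := by abel
          refine (ofReal_strainGap_sq_le hφ (le_of_eq (congrArg norm e))).trans (le_of_eq ?_)
          simp only [e, add_right_comm (p k) w]
          rfl
      _ = N (i, k) * ∫⁻ t in Ioo (0 : ℝ) 1, ∫⁻ w in B, S ((p k + t • (p i - p k)) + w) := by
          rw [lintegral_const_mul' _ _ ENNReal.ofReal_ne_top, lintegral_lintegral_swap]
          exact hFm.aemeasurable
      _ ≤ N (i, k) * ∫⁻ t in Ioo (0 : ℝ) 1, ∫⁻ x in V, S x := by
          gcongr 1
          refine setLIntegral_mono' measurableSet_Ioo fun t ht => ?_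
          have h3 := setLIntegral_comp_affine_le hSm hBm hVo (p k + t • (p i - p k)) one_ne_zero
            fun w hw => by
              have e : (p k + t • (p i - p k)) + (1 : ℝ) • w =
                  (p k + w) + t • ((p i + w) - (p k + w)) := by module
              rw [e]
              exact hV.add_smul_sub_mem (hpB k w hw) (hpB i w hw) ⟨ht.1.le, ht.2.le⟩
          simpa using h3
      _ = N (i, k) * ∫⁻ x in V, S x := by simp
  calc ∫⁻ w in B, T w
      = (∑ i, ∫⁻ w in B, ∫⁻ x in V, G (x, p i + w)) +
          ∑ i, ∑ k, ∫⁻ w in B, G (p i + w, p k + w) := by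
        rw [lintegral_add_left (Finset.measurable_fun_sum _ fun i _ => hT1 i),
          lintegral_finsetSum _ fun i _ => hT1 i,
          lintegral_finsetSum _ fun i _ => Finset.measurable_fun_sum _ fun k _ => hT2 i k]
        congr 1
        exact Finset.sum_congr rfl fun i _ => lintegral_finsetSum _ fun k _ => hT2 i k
    _ ≤ (∑ _i : ι, C * ∫⁻ x in V, S x) + ∑ i, ∑ k, N (i, k) * ∫⁻ x in V, S x := by
        gcongr with i _ i _ k _
        · exact h1 i
        · exact h2 i k
    _ = C' * ∫⁻ x in V, S x := by
        simp only [← Finset.sum_mul]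
        rw [hC', add_mul, Fintype.sum_prod_type, Finset.sum_const, Finset.card_univ, nsmul_eq_mul,
          mul_assoc]

/-- The rigid motion `x ↦ m + B x` as a vector field. -/
def rigidField (m : Fin d → ℝ) (B : Matrix (Fin d) (Fin d) ℝ) : Fin d → Pt d → ℝ :=
  fun i x => rigidMotion m B x i

/-- A field is reconstructed, up to strain gaps, from its values at `d + 1` points. -/
theorem exists_rigid_sub_sq_le (φ : Fin d → Pt d → ℝ) {ρ D : ℝ} (hρ : 0 < ρ) (a₀ : Pt d)
    (a : Option (Fin d) → Pt d) (ha₀ : a none = a₀)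
    (ha : ∀ j, a (some j) = a₀ + ρ • EuclideanSpace.single j 1) :
    ∃ (m : Fin d → ℝ) (B : Matrix (Fin d) (Fin d) ℝ), Bᵀ = -B ∧ ∀ x : Pt d, ‖x - a₀‖ ≤ D →
      ∑ j, (φ j x - rigidField m B j x) ^ 2 ≤ d * (8 / ρ ^ 2 + 9 / 2 * d * D ^ 2 / ρ ^ 4) *
        ((∑ i, strainGap φ x (a i) ^ 2) + ∑ i, ∑ k, strainGap φ (a i) (a k) ^ 2) := by
  -- `M` is minus the matrix of difference quotients at `a₀`, with the index of the direction first.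
  -- Its skew part `B` is the linear part of the rigid motion; the symmetric part is a discrete
  -- strain.
  let M : Matrix (Fin d) (Fin d) ℝ := Matrix.of fun j k =>
    -(φ k (a (some j)) - φ k a₀) / ρ
  let B : Matrix (Fin d) (Fin d) ℝ := Matrix.of fun j k => (M j k - M k j) / 2
  refine ⟨fun j => φ j (a (some j)) - ∑ k, B j k * a₀ k, B, ?_, fun x hx => ?_⟩
  · ext j k
    simp only [Matrix.transpose_apply, Matrix.neg_apply, B, Matrix.of_apply]
    ring
  set T := (∑ i, strainGap φ x (a i) ^ 2) + ∑ i, ∑ k, strainGap φ (a i) (a k) ^ 2 with hT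
  have hx1 : ∀ i, strainGap φ x (a i) ^ 2 ≤ T := fun i => by
    have h1 := Finset.single_le_sum (f := fun i => strainGap φ x (a i) ^ 2)
      (fun i _ => sq_nonneg _) (Finset.mem_univ i)
    have h2 : 0 ≤ ∑ i, ∑ k, strainGap φ (a i) (a k) ^ 2 :=
      Finset.sum_nonneg fun i _ => Finset.sum_nonneg fun k _ => sq_nonneg _
    linarith
  have hx2 : ∀ i k, strainGap φ (a i) (a k) ^ 2 ≤ T := fun i k => by
    have h1 := Finset.single_le_sum (f := fun k => strainGap φ (a i) (a k) ^ 2)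
      (fun k _ => sq_nonneg _) (Finset.mem_univ k)
    have h2 := Finset.single_le_sum (f := fun i => ∑ k, strainGap φ (a i) (a k) ^ 2)
      (fun i _ => Finset.sum_nonneg fun k _ => sq_nonneg _) (Finset.mem_univ i)
    have h3 : 0 ≤ ∑ i, strainGap φ x (a i) ^ 2 := Finset.sum_nonneg fun i _ => sq_nonneg _
    linarith
  have hT0 : 0 ≤ T := (sq_nonneg _).trans (hx1 none)
  -- Differences of the base points are `ρ (e_j - e_k)` and `ρ e_j`, so polarisation of the gaps
  -- gives exactly the symmetric part of `M`.
  have hsym : ∀ j k, M j k + M k j = (strainGap φ (a (some j)) (a (some k)) -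
      strainGap φ (a (some j)) (a none) - strainGap φ (a (some k)) (a none)) / ρ ^ 2 := by
    intro j k
    have e1 : a (some j) - a (some k) =
        ρ • EuclideanSpace.single j 1 - ρ • EuclideanSpace.single k 1 := by
      rw [ha, ha]; abel
    have e2 : ∀ j, a (some j) - a₀ = ρ • EuclideanSpace.single j 1 := fun j => by
      rw [ha]; abel
    simp only [strainGap, ha₀, e1, e2]
    simp only [fieldDot_sub, fieldDot_smul_single, M, Matrix.of_apply]
    field_simp
    ring
  -- Subtracting the gaps of `x` with respect to `a₀` and `a₀ + ρ e_j` isolates the component `φ j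
  -- x`; the linear terms that remain are those of `M`.
  have hrep : ∀ j, φ j x - rigidField (fun j => φ j (a (some j)) - ∑ k, B j k * a₀ k) B j x =
      (strainGap φ x (a none) - strainGap φ x (a (some j))) / ρ +
        ∑ k, (M j k + M k j) / 2 * (x - a₀) k := by
    intro j
    have e1 : x - a (some j) = (x - a₀) - ρ • EuclideanSpace.single j 1 := by rw [ha]; abel
    have e2 : fieldDot φ (a (some j)) (x - a₀) - fieldDot φ a₀ (x - a₀) =
        -(ρ * ∑ k, M j k * (x - a₀) k) := by
      rw [fieldDot, fieldDot, ← Finset.sum_sub_distrib, Finset.mul_sum, ← Finset.sum_neg_distrib]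
      refine Finset.sum_congr rfl fun k _ => ?_
      simp only [M, Matrix.of_apply]
      field_simp
    have e3 : rigidField (fun j => φ j (a (some j)) - ∑ k, B j k * a₀ k) B j x =
        φ j (a (some j)) + ∑ k, B j k * (x - a₀) k := by
      simp only [rigidField, rigidMotion, PiLp.sub_apply, mul_sub, Finset.sum_sub_distrib]
      ring
    have e4 : ∑ k, (M j k + M k j) / 2 * (x - a₀) k =
        (∑ k, M j k * (x - a₀) k) - ∑ k, B j k * (x - a₀) k := by
      rw [← Finset.sum_sub_distrib]
      refine Finset.sum_congr rfl fun k _ => ?_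
      simp only [B, Matrix.of_apply]
      ring
    rw [e3, e4]
    simp only [strainGap, e1, ha₀, fieldDot_sub, fieldDot_smul_single]
    simp only [fieldDot_sub] at e2
    field_simp
    linear_combination -e2
  have hD : ∑ k, (x - a₀) k ^ 2 ≤ D ^ 2 := by
    rw [← EuclideanSpace.real_norm_sq_eq]
    gcongr
  have hj : ∀ j, (φ j x - rigidField (fun j => φ j (a (some j)) - ∑ k, B j k * a₀ k) B j x) ^ 2 ≤
      (8 / ρ ^ 2 + 9 / 2 * d * D ^ 2 / ρ ^ 4) * T := by
    intro j
    rw [hrep]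
    have h1 : ((strainGap φ x (a none) - strainGap φ x (a (some j))) / ρ) ^ 2 ≤ 4 / ρ ^ 2 * T := by
      rw [div_pow, div_mul_eq_mul_div]
      gcongr
      nlinarith [hx1 none, hx1 (some j),
        sq_nonneg (strainGap φ x (a none) + strainGap φ x (a (some j)))]
    have h2 : ∀ k, ((M j k + M k j) / 2) ^ 2 ≤ 9 / 4 / ρ ^ 4 * T := fun k => by
      rw [hsym, div_pow, div_pow, ← pow_mul]
      have h3 := hx2 (some j) (some k)
      have h4 := hx2 (some j) none
      have h5 := hx2 (some k) none
      set u := strainGap φ (a (some j)) (a (some k))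
      set v := strainGap φ (a (some j)) (a none)
      set w := strainGap φ (a (some k)) (a none)
      have h6 : (u - v - w) ^ 2 ≤ 9 * T := by
        nlinarith [sq_nonneg (u + v), sq_nonneg (u + w), sq_nonneg (v - w)]
      calc (u - v - w) ^ 2 / ρ ^ (2 * 2) / 2 ^ 2 ≤ 9 * T / ρ ^ (2 * 2) / 2 ^ 2 := by gcongr
        _ = 9 / 4 / ρ ^ 4 * T := by norm_num; ring
    have h3 : (∑ k, (M j k + M k j) / 2 * (x - a₀) k) ^ 2 ≤ d * (9 / 4 / ρ ^ 4 * T) * D ^ 2 := by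
      refine (Finset.sum_mul_sq_le_sq_mul_sq _ _ _).trans ?_
      have h4 : ∑ k, ((M j k + M k j) / 2) ^ 2 ≤ d * (9 / 4 / ρ ^ 4 * T) := by
        refine (Finset.sum_le_sum fun k _ => h2 k).trans (le_of_eq ?_)
        simp
      have h5 : 0 ≤ ∑ k, (x - a₀) k ^ 2 := Finset.sum_nonneg fun k _ => sq_nonneg _
      have h6 : 0 ≤ d * (9 / 4 / ρ ^ 4 * T) := by positivity
      gcongr
    refine (add_sq_le).trans ?_
    calc 2 * (((strainGap φ x (a none) - strainGap φ x (a (some j))) / ρ) ^ 2 +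
          (∑ k, (M j k + M k j) / 2 * (x - a₀) k) ^ 2)
        ≤ 2 * (4 / ρ ^ 2 * T + d * (9 / 4 / ρ ^ 4 * T) * D ^ 2) := by gcongr
      _ = (8 / ρ ^ 2 + 9 / 2 * d * D ^ 2 / ρ ^ 4) * T := by ring
  refine (Finset.sum_le_sum fun j _ => hj j).trans (le_of_eq ?_)
  simp [mul_assoc]

/-- Korn's second inequality (Poincaré type) on bounded convex open sets. -/
theorem exists_rigid_lintegral_le {V : Set (Pt d)} (hV : Convex ℝ V) (hVo : IsOpen V)
    (hb : Bornology.IsBounded V) (hne : V.Nonempty) :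
    ∃ C : ℝ≥0∞, C ≠ ⊤ ∧ ∀ φ : Fin d → Pt d → ℝ, (∀ i, ContDiff ℝ ∞ (φ i)) →
      ∃ (m : Fin d → ℝ) (B : Matrix (Fin d) (Fin d) ℝ), Bᵀ = -B ∧
        ∫⁻ x in V, ENNReal.ofReal (∑ j, (φ j x - rigidField m B j x) ^ 2) ≤
          C * ∫⁻ x in V, ENNReal.ofReal (strainSq φ x) := by
  obtain ⟨p₀, hp₀⟩ := hne
  obtain ⟨r, hr, hball⟩ := Metric.isOpen_iff.1 hVo p₀ hp₀
  obtain ⟨D, hD⟩ := hb.exists_norm_le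
  set ρ := r / 2 with hρ
  have hρ0 : 0 < ρ := by positivity
  -- With `ρ = r / 2`, the balls of radius `ρ` about all `d + 1` points lie in the ball of radius
  -- `r` about `p₀`.
  let p : Option (Fin d) → Pt d := fun i => i.elim p₀ fun j => p₀ + ρ • EuclideanSpace.single j 1
  have hp : ∀ i, Metric.ball (p i) ρ ⊆ V := by
    intro i x hx
    refine hball ?_
    rw [mem_ball_iff_norm] at hx ⊢
    rcases i with _ | j
    · have : ‖x - p₀‖ < ρ := hx
      linarith
    · have h1 : ‖x - (p₀ + ρ • EuclideanSpace.single j (1 : ℝ))‖ < ρ := hx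
      have h2 := norm_add_le (x - (p₀ + ρ • EuclideanSpace.single j (1 : ℝ)))
        (ρ • EuclideanSpace.single j (1 : ℝ))
      have e : x - (p₀ + ρ • EuclideanSpace.single j (1 : ℝ)) +
        ρ • EuclideanSpace.single j (1 : ℝ) = x - p₀ := by abel
      rw [e, norm_smul, Real.norm_of_nonneg hρ0.le, PiLp.norm_single] at h2
      simp only [norm_one, mul_one] at h2
      linarith
  obtain ⟨C, hC, hpts⟩ := exists_points_strainGap_le hV hVo.measurableSet hb p hρ0 hp
  set K : ℝ := d * (8 / ρ ^ 2 + 9 / 2 * d * (2 * D) ^ 2 / ρ ^ 4) with hK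
  have hK0 : 0 ≤ K := by positivity
  refine ⟨ENNReal.ofReal K * ((1 + volume V) * C), ENNReal.mul_ne_top ENNReal.ofReal_ne_top
    (ENNReal.mul_ne_top (ENNReal.add_ne_top.2 ⟨by simp, hb.measure_lt_top.ne⟩) hC),
    fun φ hφ => ?_⟩
  obtain ⟨w, hw, hle⟩ := hpts φ hφ
  obtain ⟨m, B, hB, hrig⟩ := exists_rigid_sub_sq_le (D := 2 * D) φ hρ0 (p₀ + w) (fun i => p i + w)
    rfl fun j => by show p₀ + ρ • EuclideanSpace.single j 1 + w = _; abel
  refine ⟨m, B, hB, ?_⟩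
  have hw0 : p₀ + w ∈ V := hp none (by
    rw [mem_ball_zero_iff] at hw
    simpa [Metric.mem_ball, dist_eq_norm, p] using hw)
  have hDV : ∀ x ∈ V, ‖x - (p₀ + w)‖ ≤ 2 * D := fun x hx => by
    have h1 := norm_sub_le x (p₀ + w)
    have h2 := hD _ hx
    have h3 := hD _ hw0
    linarith
  set Q : ℝ≥0∞ := ∑ i, ∑ k, ENNReal.ofReal (strainGap φ (p i + w) (p k + w) ^ 2) with hQ
  have hGm : ∀ i, Measurable fun x => ENNReal.ofReal (strainGap φ x (p i + w) ^ 2) := fun i =>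
    (((continuous_strainGap hφ).comp (continuous_id.prodMk continuous_const)).pow
      2).measurable.ennreal_ofReal
  calc ∫⁻ x in V, ENNReal.ofReal (∑ j, (φ j x - rigidField m B j x) ^ 2)
      ≤ ∫⁻ x in V, ENNReal.ofReal K *
          ((∑ i, ENNReal.ofReal (strainGap φ x (p i + w) ^ 2)) + Q) := by
        refine setLIntegral_mono' hVo.measurableSet fun x hx => ?_
        refine (ENNReal.ofReal_le_ofReal (hrig x (hDV x hx))).trans (le_of_eq ?_)
        rw [ENNReal.ofReal_mul hK0, ENNReal.ofReal_add
          (Finset.sum_nonneg fun i _ => sq_nonneg _)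
          (Finset.sum_nonneg fun i _ => Finset.sum_nonneg fun k _ => sq_nonneg _),
          ENNReal.ofReal_sum_of_nonneg fun i _ => sq_nonneg _, ENNReal.ofReal_sum_of_nonneg
          fun i _ => Finset.sum_nonneg fun k _ => sq_nonneg _, hQ]
        congr 2
        exact Finset.sum_congr rfl fun i _ => ENNReal.ofReal_sum_of_nonneg fun k _ => sq_nonneg _
    _ = ENNReal.ofReal K *
          ((∑ i, ∫⁻ x in V, ENNReal.ofReal (strainGap φ x (p i + w) ^ 2)) + Q * volume V) := by
        rw [lintegral_const_mul' _ _ ENNReal.ofReal_ne_top,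
          lintegral_add_right _ measurable_const, lintegral_finsetSum _ fun i _ => hGm i,
          setLIntegral_const]
    _ ≤ ENNReal.ofReal K * ((1 + volume V) *
          ((∑ i, ∫⁻ x in V, ENNReal.ofReal (strainGap φ x (p i + w) ^ 2)) + Q)) := by
        gcongr
        rw [add_mul, one_mul, mul_add (volume V), mul_comm (volume V) Q]
        gcongr
        · exact le_self_add
        · exact le_add_self
    _ ≤ ENNReal.ofReal K * ((1 + volume V) *
          (C * ∫⁻ x in V, ENNReal.ofReal (strainSq φ x))) := by gcongr
    _ = _ := by ring

end LocalKorn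

/-! ### Korn's inequality on connected domains -/

section GlobalKorn

variable {d : ℕ}

/-- Rigid motions are affine, so the value at a distant point is extrapolated from two values close
together. -/
theorem rigidField_line (m : Fin d → ℝ) (B : Matrix (Fin d) (Fin d) ℝ) (i : Fin d) (x y : Pt d)
    {κ : ℝ} (hκ : κ ≠ 0) : rigidField m B i x =
      (1 - κ⁻¹) * rigidField m B i y + κ⁻¹ * rigidField m B i (y + κ • (x - y)) := by
  have h : ∑ j, B i j * (y + κ • (x - y)) j =
      (∑ j, B i j * y j) + κ * ((∑ j, B i j * x j) - ∑ j, B i j * y j) := by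
    rw [← Finset.sum_sub_distrib, Finset.mul_sum, ← Finset.sum_add_distrib]
    refine Finset.sum_congr rfl fun j _ => ?_
    simp only [PiLp.add_apply, PiLp.smul_apply, PiLp.sub_apply, smul_eq_mul]
    ring
  simp only [rigidField, rigidMotion, h]
  field_simp
  ring

theorem contDiff_rigidField (m : Fin d → ℝ) (B : Matrix (Fin d) (Fin d) ℝ) (i : Fin d) :
    ContDiff ℝ ∞ (rigidField m B i) := by
  unfold rigidField rigidMotion
  fun_prop

theorem pderiv_rigidField (m : Fin d → ℝ) (B : Matrix (Fin d) (Fin d) ℝ) (i j : Fin d) (x : Pt d) :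
    pderiv j (rigidField m B i) x = B i j := by
  have h : HasFDerivAt (rigidField m B i)
      (∑ k, B i k • (EuclideanSpace.proj k : Pt d →L[ℝ] ℝ)) x := by
    unfold rigidField rigidMotion
    refine HasFDerivAt.const_add _ (HasFDerivAt.fun_sum fun k _ => ?_)
    exact ((EuclideanSpace.proj k : Pt d →L[ℝ] ℝ).hasFDerivAt).const_mul (B i k)
  rw [pderiv, h.fderiv]
  simp

theorem pderiv_sub {φ ψ : Pt d → ℝ} (hφ : ContDiff ℝ ∞ φ) (hψ : ContDiff ℝ ∞ ψ) (i : Fin d)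
    (x : Pt d) : pderiv i (fun y => φ y - ψ y) x = pderiv i φ x - pderiv i ψ x := by
  unfold pderiv
  rw [fderiv_fun_sub (hφ.differentiable (by simp) x) (hψ.differentiable (by simp) x)]
  rfl

theorem strainSq_sub_rigidField {φ : Fin d → Pt d → ℝ} (hφ : ∀ i, ContDiff ℝ ∞ (φ i))
    (m : Fin d → ℝ) {B : Matrix (Fin d) (Fin d) ℝ} (hB : Bᵀ = -B) (x : Pt d) :
    strainSq (fun i y => φ i y - rigidField m B i y) x = strainSq φ x := by
  refine Finset.sum_congr rfl fun i _ => Finset.sum_congr rfl fun j _ => ?_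
  have h : B j i = -B i j := by
    have := congrFun (congrFun hB i) j
    simpa using this
  rw [strainAt, pderiv_sub (hφ i) (contDiff_rigidField m B i),
    pderiv_sub (hφ j) (contDiff_rigidField m B j), pderiv_rigidField, pderiv_rigidField, h, strainAt]
  ring

theorem fieldSq_le_two_mul (φ ψ : Fin d → Pt d → ℝ) (x : Pt d) :
    ENNReal.ofReal (fieldSq φ x) ≤ 2 * ENNReal.ofReal (∑ j, (φ j x - ψ j x) ^ 2) +
      2 * ENNReal.ofReal (fieldSq ψ x) := by
  rw [← ENNReal.ofReal_ofNat, ← ENNReal.ofReal_mul (by norm_num), ← ENNReal.ofReal_mul (by norm_num),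
    ← ENNReal.ofReal_add (mul_nonneg (by norm_num) (Finset.sum_nonneg fun _ _ => sq_nonneg _))
      (mul_nonneg (by norm_num) (fieldSq_nonneg _ _))]
  refine ENNReal.ofReal_le_ofReal ?_
  unfold fieldSq
  rw [Finset.mul_sum, Finset.mul_sum, ← Finset.sum_add_distrib]
  refine Finset.sum_le_sum fun j _ => ?_
  nlinarith [sq_nonneg (φ j x - 2 * ψ j x)]

/-- On rigid motions, the `L²` norm over a nonempty open set dominates that over a bounded set. -/
theorem exists_lintegral_rigidField_le {V W : Set (Pt d)} (hV : MeasurableSet V)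
    (hVb : Bornology.IsBounded V) (hW : IsOpen W) (hne : W.Nonempty) :
    ∃ C : ℝ≥0∞, C ≠ ⊤ ∧ ∀ (m : Fin d → ℝ) (B : Matrix (Fin d) (Fin d) ℝ),
      ∫⁻ x in V, ENNReal.ofReal (fieldSq (rigidField m B) x) ≤
        C * ∫⁻ x in W, ENNReal.ofReal (fieldSq (rigidField m B) x) := by
  obtain ⟨y₀, hy₀⟩ := hne
  obtain ⟨r, hr, hball⟩ := Metric.isOpen_iff.1 hW y₀ hy₀
  obtain ⟨D, hD⟩ := hVb.exists_norm_le
  set U := Metric.ball y₀ (r / 2) with hU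
  have hU0 : volume U ≠ 0 := (Metric.measure_ball_pos volume _ (by positivity)).ne'
  have hUt : volume U ≠ ⊤ := measure_ball_lt_top.ne
  have hUW : U ⊆ W := (Metric.ball_subset_ball (by linarith)).trans hball
  -- Small enough that contracting `V` by `κ` towards any point of `U` lands in the ball of radius
  -- `r` inside `W`.
  set κ : ℝ := r / 2 / (|D| + ‖y₀‖ + r + 1) with hκ
  have hκ0 : 0 < κ := by positivity
  set c₁ : ℝ := 2 * (1 - κ⁻¹) ^ 2 with hc₁
  set c₂ : ℝ := 2 * (κ⁻¹) ^ 2 with hc₂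
  have hc₁0 : 0 ≤ c₁ := by positivity
  have hc₂0 : 0 ≤ c₂ := by positivity
  refine ⟨ENNReal.ofReal c₁ * ((volume U)⁻¹ * volume V) +
    ENNReal.ofReal c₂ * ENNReal.ofReal |(κ ^ d)⁻¹|, ?_, fun m B => ?_⟩
  · exact ENNReal.add_ne_top.2 ⟨ENNReal.mul_ne_top ENNReal.ofReal_ne_top
      (ENNReal.mul_ne_top (ENNReal.inv_ne_top.2 hU0) hVb.measure_lt_top.ne),
      ENNReal.mul_ne_top ENNReal.ofReal_ne_top ENNReal.ofReal_ne_top⟩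
  set f : Pt d → ℝ≥0∞ := fun x => ENNReal.ofReal (fieldSq (rigidField m B) x) with hf
  have hfm : Measurable f :=
    (continuous_fieldSq (contDiff_rigidField m B)).measurable.ennreal_ofReal
  -- A base point whose value is bounded by the average, hence by the integral over `W`.
  obtain ⟨y, hy, hfy⟩ := exists_le_setLAverage (μ := volume) hU0 hUt hfm.aemeasurable
  have hfy' : f y ≤ (volume U)⁻¹ * ∫⁻ x in W, f x := by
    rw [setLAverage_eq, ENNReal.div_eq_inv_mul] at hfy
    exact hfy.trans (by gcongr)
  have hpt : ∀ x, f x ≤ ENNReal.ofReal c₁ * f y + ENNReal.ofReal c₂ * f (y + κ • (x - y)) := by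
    intro x
    simp only [hf]
    rw [← ENNReal.ofReal_mul hc₁0, ← ENNReal.ofReal_mul hc₂0, ← ENNReal.ofReal_add
      (mul_nonneg hc₁0 (fieldSq_nonneg _ _)) (mul_nonneg hc₂0 (fieldSq_nonneg _ _))]
    refine ENNReal.ofReal_le_ofReal ?_
    unfold fieldSq
    rw [Finset.mul_sum, Finset.mul_sum, ← Finset.sum_add_distrib]
    refine Finset.sum_le_sum fun i _ => ?_
    rw [rigidField_line m B i x y hκ0.ne']
    refine add_sq_le.trans (le_of_eq ?_)
    rw [hc₁, hc₂]
    ring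
  have e : ∀ x, y + κ • (x - y) = (y - κ • y) + κ • x := fun x => by module
  have hmem : ∀ x ∈ V, (y - κ • y) + κ • x ∈ W := fun x hx => by
    rw [← e]
    refine hball ?_
    rw [hU, mem_ball_iff_norm] at hy
    rw [mem_ball_iff_norm]
    have h1 : ‖x - y‖ ≤ |D| + ‖y₀‖ + r := by
      have h2 := norm_sub_le x y
      have h3 := (hD _ hx).trans (le_abs_self D)
      have h4 := norm_add_le (y - y₀) y₀
      rw [sub_add_cancel] at h4
      linarith
    have h2 : ‖κ • (x - y)‖ ≤ r / 2 := by
      rw [norm_smul, Real.norm_of_nonneg hκ0.le, hκ, div_mul_eq_mul_div]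
      refine div_le_of_le_mul₀ (by positivity) (by positivity) ?_
      gcongr
      linarith
    have h3 := norm_add_le (y - y₀) (κ • (x - y))
    have e2 : y + κ • (x - y) - y₀ = (y - y₀) + κ • (x - y) := by abel
    rw [e2]
    linarith
  have hcomp := setLIntegral_comp_affine_le hfm hV hW.measurableSet _ hκ0.ne' hmem
  calc ∫⁻ x in V, f x
      ≤ ∫⁻ x in V, (ENNReal.ofReal c₁ * f y + ENNReal.ofReal c₂ * f ((y - κ • y) + κ • x)) :=
        lintegral_mono fun x => by rw [← e]; exact hpt x
    _ = ENNReal.ofReal c₁ * f y * volume V +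
          ENNReal.ofReal c₂ * ∫⁻ x in V, f ((y - κ • y) + κ • x) := by
        rw [lintegral_add_left measurable_const, setLIntegral_const,
          lintegral_const_mul' _ _ ENNReal.ofReal_ne_top]
    _ ≤ ENNReal.ofReal c₁ * ((volume U)⁻¹ * ∫⁻ x in W, f x) * volume V +
          ENNReal.ofReal c₂ * (ENNReal.ofReal |(κ ^ d)⁻¹| * ∫⁻ x in W, f x) := by gcongr
    _ = _ := by ring

/-- The `L²` norm of smooth fields over `V` is controlled by the strain on `Ω` and the `L²` norm
over `W`. -/
def Controls (Ω W V : Set (Pt d)) : Prop :=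
  ∃ C : ℝ≥0∞, C ≠ ⊤ ∧ ∀ φ : Fin d → Pt d → ℝ, (∀ i, ContDiff ℝ ∞ (φ i)) →
    ∫⁻ x in V, ENNReal.ofReal (fieldSq φ x) ≤
      C * ((∫⁻ x in Ω, ENNReal.ofReal (strainSq φ x)) + ∫⁻ x in W, ENNReal.ofReal (fieldSq φ x))

/-- On the convex set `V'` the field is close to a rigid motion. On the overlap this motion is
controlled by the field, hence by the control on `V`, and a rigid motion on `V'` is controlled by
its restriction to the overlap. -/
theorem Controls.of_inter {Ω W V V' : Set (Pt d)} (h : Controls Ω W V) (hV : IsOpen V)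
    (hV' : Convex ℝ V') (hV'o : IsOpen V') (hV'b : Bornology.IsBounded V') (hV'Ω : V' ⊆ Ω)
    (hne : (V ∩ V').Nonempty) : Controls Ω W V' := by
  obtain ⟨C₁, hC₁, h1⟩ := h
  obtain ⟨C₂, hC₂, h2⟩ := exists_rigid_lintegral_le hV' hV'o hV'b (hne.mono inter_subset_right)
  obtain ⟨C₃, hC₃, h3⟩ := exists_lintegral_rigidField_le hV'o.measurableSet hV'b (hV.inter hV'o) hne
  refine ⟨2 * C₂ + 2 * (C₃ * (2 * C₂ + 2 * C₁)), ?_, fun φ hφ => ?_⟩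
  · exact ENNReal.add_ne_top.2 ⟨ENNReal.mul_ne_top (by simp) hC₂, ENNReal.mul_ne_top (by simp)
      (ENNReal.mul_ne_top hC₃ (ENNReal.add_ne_top.2 ⟨ENNReal.mul_ne_top (by simp) hC₂,
        ENNReal.mul_ne_top (by simp) hC₁⟩))⟩
  obtain ⟨m, B, hB, hle⟩ := h2 φ hφ
  set r := rigidField m B with hr
  set E := ∫⁻ x in Ω, ENNReal.ofReal (strainSq φ x) with hE
  set X := E + ∫⁻ x in W, ENNReal.ofReal (fieldSq φ x) with hX
  have hEX : E ≤ X := le_self_add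
  have hφm : Measurable fun x => ENNReal.ofReal (fieldSq φ x) :=
    (continuous_fieldSq hφ).measurable.ennreal_ofReal
  have hrm : Measurable fun x => ENNReal.ofReal (fieldSq r x) :=
    (continuous_fieldSq (contDiff_rigidField m B)).measurable.ennreal_ofReal
  have hdiff : ∫⁻ x in V', ENNReal.ofReal (∑ j, (φ j x - r j x) ^ 2) ≤ C₂ * X :=
    hle.trans (by
      gcongr
      exact (lintegral_mono_set hV'Ω).trans hEX)
  have hsplit : ∀ (A : Set (Pt d)) (f g : Fin d → Pt d → ℝ),
      Measurable (fun x => ENNReal.ofReal (fieldSq g x)) →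
      ∫⁻ x in A, ENNReal.ofReal (fieldSq f x) ≤
        2 * (∫⁻ x in A, ENNReal.ofReal (∑ j, (f j x - g j x) ^ 2)) +
          2 * ∫⁻ x in A, ENNReal.ofReal (fieldSq g x) := fun A f g hg => by
    rw [← lintegral_const_mul' 2 _ (by simp), ← lintegral_const_mul 2 hg,
      ← lintegral_add_right _ (hg.const_mul 2)]
    exact lintegral_mono fun x => fieldSq_le_two_mul f g x
  have hswap : ∀ x, ∑ j, (r j x - φ j x) ^ 2 = ∑ j, (φ j x - r j x) ^ 2 := fun x =>
    Finset.sum_congr rfl fun j _ => by ring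
  have hr2 : ∫⁻ x in V ∩ V', ENNReal.ofReal (fieldSq r x) ≤ 2 * (C₂ * X) + 2 * (C₁ * X) := by
    refine (hsplit _ r φ hφm).trans ?_
    simp only [hswap]
    gcongr
    · exact (lintegral_mono_set inter_subset_right).trans hdiff
    · exact (lintegral_mono_set inter_subset_left).trans (h1 φ hφ)
  calc ∫⁻ x in V', ENNReal.ofReal (fieldSq φ x)
      ≤ 2 * (C₂ * X) + 2 * (C₃ * (2 * (C₂ * X) + 2 * (C₁ * X))) := by
        refine (hsplit _ φ r hrm).trans ?_
        gcongr
        exact (h3 m B).trans (by gcongr)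
    _ = _ := by ring

/-- Having a controlled neighbourhood is a locally constant property of points of the connected set
`Ω`, so it propagates from the centre of the ball. The interior of each simplex is convex and meets
a controlled neighbourhood, so finitely many steps reach up to the boundary. -/
theorem IsPolygonalDomain.controls_ball {Ω : Set (Pt d)} (h : IsPolygonalDomain Ω) {x₀ : Pt d}
    {r : ℝ} (hr : 0 < r) (hball : Metric.ball x₀ r ⊆ Ω) : Controls Ω (Metric.ball x₀ r) Ω := by
  set W := Metric.ball x₀ r with hW
  have hΩo := h.isOpen
  have hx₀ : x₀ ∈ Ω := hball (Metric.mem_ball_self hr)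
  have hWW : Controls Ω W W := ⟨1, by simp, fun φ _ => by rw [one_mul]; exact le_add_self⟩
  let Q : Pt d → Prop := fun x => ∃ V : Set (Pt d), x ∈ V ∧ IsOpen V ∧ Controls Ω W V
  have hQ : ∀ x ∈ Ω, Q x := by
    intro x hx
    have hloc : ∀ y ∈ Ω, ∀ᶠ z in 𝓝[Ω] y, Q y ↔ Q z := by
      intro y hy
      obtain ⟨s, hs, hsΩ⟩ := Metric.isOpen_iff.1 hΩo y hy
      filter_upwards [mem_nhdsWithin_of_mem_nhds (Metric.ball_mem_nhds y hs)] with z hz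
      have key : ∀ a ∈ Metric.ball y s, Q a → Controls Ω W (Metric.ball y s) := by
        rintro a ha ⟨V, haV, hVo, hV⟩
        exact hV.of_inter hVo (convex_ball y s) Metric.isOpen_ball Metric.isBounded_ball hsΩ
          ⟨a, haV, ha⟩
      have hyb := Metric.mem_ball_self (x := y) hs
      exact ⟨fun hQ => ⟨_, hz, Metric.isOpen_ball, key y hyb hQ⟩,
        fun hQ => ⟨_, hyb, Metric.isOpen_ball, key z hz hQ⟩⟩
    have hind := h.1.isPreconnected.induction₂ (fun y z => Q y ↔ Q z) hloc
      (fun a b c _ _ _ hab hbc => hab.trans hbc) (fun a b _ _ hab => hab.symm) hx₀ hx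
    exact hind.1 ⟨W, Metric.mem_ball_self hr, Metric.isOpen_ball, hWW⟩
  obtain ⟨n, b, hΩ⟩ := h.exists_simplices
  have hS : ∀ k, Controls Ω W (interior (simplexOf (b k))) := by
    intro k
    have hsub : interior (simplexOf (b k)) ⊆ Ω := by
      rw [hΩ]; exact interior_mono (subset_iUnion (fun k => simplexOf (b k)) k)
    rcases (interior (simplexOf (b k))).eq_empty_or_nonempty with h0 | ⟨x, hx⟩
    · exact ⟨0, by simp, fun φ _ => by simp [h0]⟩
    · obtain ⟨V, hxV, hVo, hV⟩ := hQ x (hsub hx)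
      exact hV.of_inter hVo (convex_convexHull ℝ _).interior isOpen_interior
        ((isCompact_simplexOf (b k)).isBounded.subset interior_subset) hsub ⟨x, hxV, hx⟩
  choose C hC hle using hS
  refine ⟨∑ k, C k, ENNReal.sum_ne_top.2 fun k _ => hC k, fun φ hφ => ?_⟩
  have hΩsub : Ω ⊆ ⋃ k, simplexOf (b k) := by rw [hΩ]; exact interior_subset
  refine (lintegral_mono_set hΩsub).trans ((lintegral_iUnion_le _ _).trans ?_)
  rw [tsum_fintype, Finset.sum_mul]
  refine Finset.sum_le_sum fun k _ => ?_
  rw [lintegral_simplexOf]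
  exact hle k φ hφ

/-- Korn's inequality modulo rigid motions for smooth fields on a polygonal domain. -/
theorem IsPolygonalDomain.exists_rigid_lintegral_le {Ω : Set (Pt d)} (h : IsPolygonalDomain Ω) :
    ∃ C : ℝ≥0∞, C ≠ ⊤ ∧ ∀ φ : Fin d → Pt d → ℝ, (∀ i, ContDiff ℝ ∞ (φ i)) →
      ∃ (m : Fin d → ℝ) (B : Matrix (Fin d) (Fin d) ℝ), Bᵀ = -B ∧
        ∫⁻ x in Ω, ENNReal.ofReal (∑ j, (φ j x - rigidField m B j x) ^ 2) ≤
          C * ∫⁻ x in Ω, ENNReal.ofReal (strainSq φ x) := by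
  obtain ⟨x₀, hx₀⟩ := h.1.nonempty
  obtain ⟨r, hr, hball⟩ := Metric.isOpen_iff.1 h.isOpen x₀ hx₀
  obtain ⟨C₁, hC₁, h1⟩ := h.controls_ball hr hball
  obtain ⟨C₂, hC₂, h2⟩ := Biot.exists_rigid_lintegral_le (convex_ball x₀ r) Metric.isOpen_ball
    Metric.isBounded_ball ⟨x₀, Metric.mem_ball_self hr⟩
  refine ⟨C₁ * (1 + C₂), ENNReal.mul_ne_top hC₁ (ENNReal.add_ne_top.2 ⟨by simp, hC₂⟩),
    fun φ hφ => ?_⟩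
  obtain ⟨m, B, hB, hle⟩ := h2 φ hφ
  refine ⟨m, B, hB, ?_⟩
  -- The control is applied to the field minus its rigid motion on the ball: the strain is
  -- unchanged, and the remaining term on the ball is bounded by Korn's inequality there.
  have h3 := h1 (fun i y => φ i y - rigidField m B i y)
    fun i => (hφ i).sub (contDiff_rigidField m B i)
  simp only [strainSq_sub_rigidField hφ m hB] at h3
  refine h3.trans ?_
  rw [mul_assoc, add_mul, one_mul]
  gcongr
  exact hle.trans (by gcongr)

end GlobalKorn

/-! ### Korn's inequality and traces in `H¹` -/

section Traces

variable {d : ℕ} {Ω : Set (Pt d)}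

def valVecL : H1Vec Ω →L[ℝ] L2Vec Ω :=
  ((PiLp.continuousLinearEquiv 2 ℝ fun _ : Fin d => L2 Ω).symm : (Fin d → L2 Ω) →L[ℝ] L2Vec Ω).comp
    (ContinuousLinearMap.pi fun i => val.comp (PiLp.proj 2 (fun _ : Fin d => H1 Ω) i))

def gradL (i j : Fin d) : H1Vec Ω →L[ℝ] L2 Ω :=
  (PiLp.proj 2 (fun _ : Fin d => L2 Ω) j : L2Vec Ω →L[ℝ] L2 Ω).comp
    (grad.comp (PiLp.proj 2 (fun _ : Fin d => H1 Ω) i))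

def divL : H1Vec Ω →L[ℝ] L2 Ω := ∑ i, gradL i i

theorem divL_apply (v : H1Vec Ω) : divL v = div v := by
  simp [divL, div, gradL]

/-- The space of strains. -/
abbrev StrainSpace (Ω : Set (Pt d)) := PiLp 2 (fun _ : Fin d × Fin d => L2 Ω)

def strainL : H1Vec Ω →L[ℝ] StrainSpace Ω :=
  ((PiLp.continuousLinearEquiv 2 ℝ fun _ : Fin d × Fin d => L2 Ω).symm :
    (Fin d × Fin d → L2 Ω) →L[ℝ] StrainSpace Ω).comp
    (ContinuousLinearMap.pi fun ij => (1 / 2 : ℝ) • (gradL ij.1 ij.2 + gradL ij.2 ij.1))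

theorem continuous_valVec : Continuous (valVec : H1Vec Ω → L2Vec Ω) := valVecL.continuous

theorem continuous_strain : Continuous (strain : H1Vec Ω → StrainSpace Ω) := strainL.continuous

theorem continuous_grad_apply (i j : Fin d) : Continuous fun v : H1Vec Ω => grad (v i) j :=
  (gradL i j).continuous

theorem continuous_val_apply (i : Fin d) : Continuous fun v : H1Vec Ω => val (v i) :=
  val.continuous.comp (PiLp.continuous_apply 2 _ i)

theorem valVec_zero : valVec (0 : H1Vec Ω) = 0 := (valVecL : H1Vec Ω →L[ℝ] L2Vec Ω).map_zero

theorem strain_zero : strain (0 : H1Vec Ω) = 0 := (strainL : H1Vec Ω →L[ℝ] StrainSpace Ω).map_zero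

/-- The field with all components equal to `u` transfers vector results to scalar functions. -/
theorem norm_valVec_const (u : H1 Ω) :
    ‖valVec (WithLp.toLp 2 fun _ => u : H1Vec Ω)‖ ^ 2 = d * ‖val u‖ ^ 2 := by
  rw [PiLp.norm_sq_eq_of_L2]
  simp [valVec]

theorem norm_half_smul_add_sq_le {E : Type*} [NormedAddCommGroup E] [NormedSpace ℝ E] (a b : E) :
    ‖(1 / 2 : ℝ) • (a + b)‖ ^ 2 ≤ 1 / 2 * (‖a‖ ^ 2 + ‖b‖ ^ 2) := by
  have h := norm_add_le a b
  rw [norm_smul, mul_pow, Real.norm_of_nonneg (by norm_num)]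
  nlinarith [norm_nonneg (a + b), sq_nonneg (‖a‖ - ‖b‖)]

theorem norm_strain_const_le (u : H1 Ω) :
    ‖strain (WithLp.toLp 2 fun _ => u : H1Vec Ω)‖ ^ 2 ≤ d * ‖grad u‖ ^ 2 := by
  have h1 : ∀ q : Fin d × Fin d, ‖strain (WithLp.toLp 2 fun _ => u : H1Vec Ω) q‖ ^ 2 ≤
      1 / 2 * (‖grad u q.2‖ ^ 2 + ‖grad u q.1‖ ^ 2) := fun q =>
    norm_half_smul_add_sq_le (grad u q.2) (grad u q.1)
  rw [PiLp.norm_sq_eq_of_L2, PiLp.norm_sq_eq_of_L2]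
  refine (Finset.sum_le_sum fun q _ => h1 q).trans (le_of_eq ?_)
  rw [Fintype.sum_prod_type]
  simp only [← Finset.mul_sum, Finset.sum_add_distrib, Finset.sum_const, Finset.card_univ,
    Fintype.card_fin, nsmul_eq_mul]
  ring

/-- The divergence is the trace of the strain. -/
theorem norm_div_sq_le (v : H1Vec Ω) : ‖div v‖ ^ 2 ≤ d * ‖strain v‖ ^ 2 := by
  have h1 : div v = ∑ i, strain v (i, i) := by
    refine Finset.sum_congr rfl fun i _ => ?_
    simp only [strain]
    module
  have h2 : ‖div v‖ ≤ ∑ i, ‖strain v (i, i)‖ := by rw [h1]; exact norm_sum_le _ _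
  have h3 : (∑ i, ‖strain v (i, i)‖) ^ 2 ≤ d * ∑ i, ‖strain v (i, i)‖ ^ 2 := by
    simpa using sq_sum_le_card_mul_sum_sq (s := Finset.univ) (f := fun i => ‖strain v (i, i)‖)
  have h4 : ∑ i, ‖strain v (i, i)‖ ^ 2 ≤ ‖strain v‖ ^ 2 := by
    rw [PiLp.norm_sq_eq_of_L2, Fintype.sum_prod_type]
    refine Finset.sum_le_sum fun i _ => ?_
    exact Finset.single_le_sum (f := fun j => ‖strain v (i, j)‖ ^ 2) (fun j _ => sq_nonneg _)
      (Finset.mem_univ i)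
  calc ‖div v‖ ^ 2 ≤ (∑ i, ‖strain v (i, i)‖) ^ 2 := by gcongr
    _ ≤ d * ∑ i, ‖strain v (i, i)‖ ^ 2 := h3
    _ ≤ _ := by gcongr

theorem ofReal_norm_sq_eq_lintegral {α ι : Type*} [MeasurableSpace α] [Fintype ι] {μ : Measure α}
    (w : PiLp 2 fun _ : ι => Lp ℝ 2 μ) {f : ι → α → ℝ} (h : ∀ i, w i =ᵐ[μ] f i) :
    ENNReal.ofReal (‖w‖ ^ 2) = ∫⁻ x, ENNReal.ofReal (∑ i, f i x ^ 2) ∂μ := by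
  have h1 : ∀ i, ‖w i‖ ^ 2 = ∫ x, w i x ^ 2 ∂μ := fun i => by
    rw [← real_inner_self_eq_norm_sq, L2.inner_def]
    refine integral_congr_ae (Eventually.of_forall fun x => ?_)
    simp [sq]
  have h2 : ∀ i, Integrable (fun x => w i x ^ 2) μ := fun i => (Lp.memLp (w i)).integrable_sq
  rw [PiLp.norm_sq_eq_of_L2]
  simp only [h1]
  rw [← integral_finsetSum _ fun i _ => h2 i, ofReal_integral_eq_lintegral_ofReal
    (integrable_finsetSum _ fun i _ => h2 i)
    (Eventually.of_forall fun x => Finset.sum_nonneg fun i _ => sq_nonneg _)]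
  refine lintegral_congr_ae ?_
  filter_upwards [eventually_all.2 h] with x hx
  simp only [hx]

/-- `u` is the restriction to `Ω` of the smooth compactly supported field `φ`. -/
def IsSmoothVec (u : H1Vec Ω) (φ : Fin d → Pt d → ℝ) : Prop :=
  ∀ i, ContDiff ℝ ∞ (φ i) ∧ HasCompactSupport (φ i) ∧
    val (u i) =ᵐ[volume.restrict Ω] φ i ∧
    ∀ j, grad (u i) j =ᵐ[volume.restrict Ω] pderiv j (φ i)

theorem IsSmoothVec.sub {u v : H1Vec Ω} {φ ψ : Fin d → Pt d → ℝ} (hu : IsSmoothVec u φ)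
    (hv : IsSmoothVec v ψ) : IsSmoothVec (u - v) fun i x => φ i x - ψ i x := by
  intro i
  refine ⟨(hu i).1.sub (hv i).1, (hu i).2.1.sub (hv i).2.1, ?_, fun j => ?_⟩
  · rw [PiLp.sub_apply, map_sub]
    filter_upwards [Lp.coeFn_sub (val (u i)) (val (v i)), (hu i).2.2.1, (hv i).2.2.1]
      with x hx h1 h2
    rw [hx, Pi.sub_apply, h1, h2]
  · rw [PiLp.sub_apply, map_sub, PiLp.sub_apply]
    filter_upwards [Lp.coeFn_sub (grad (u i) j) (grad (v i) j), (hu i).2.2.2 j, (hv i).2.2.2 j]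
      with x hx h1 h2
    rw [hx, Pi.sub_apply, h1, h2, pderiv_sub (hu i).1 (hv i).1]

theorem IsSmoothVec.strain_ae {u : H1Vec Ω} {φ : Fin d → Pt d → ℝ} (hu : IsSmoothVec u φ)
    (ij : Fin d × Fin d) : strain u ij =ᵐ[volume.restrict Ω] strainAt φ ij.1 ij.2 := by
  filter_upwards [Lp.coeFn_smul (1 / 2 : ℝ) (grad (u ij.1) ij.2 + grad (u ij.2) ij.1),
    Lp.coeFn_add (grad (u ij.1) ij.2) (grad (u ij.2) ij.1), (hu ij.1).2.2.2 ij.2,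
    (hu ij.2).2.2.2 ij.1] with x h1 h2 h3 h4
  show ((1 / 2 : ℝ) • (grad (u ij.1) ij.2 + grad (u ij.2) ij.1) : L2 Ω) x = _
  rw [h1, Pi.smul_apply, h2, Pi.add_apply, h3, h4, strainAt, smul_eq_mul]

theorem IsSmoothVec.ofReal_norm_valVec {u : H1Vec Ω} {φ : Fin d → Pt d → ℝ}
    (hu : IsSmoothVec u φ) :
    ENNReal.ofReal (‖valVec u‖ ^ 2) = ∫⁻ x in Ω, ENNReal.ofReal (fieldSq φ x) :=
  ofReal_norm_sq_eq_lintegral (valVec u) fun i => (hu i).2.2.1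

theorem IsSmoothVec.ofReal_norm_strain {u : H1Vec Ω} {φ : Fin d → Pt d → ℝ}
    (hu : IsSmoothVec u φ) :
    ENNReal.ofReal (‖strain u‖ ^ 2) = ∫⁻ x in Ω, ENNReal.ofReal (strainSq φ x) := by
  rw [ofReal_norm_sq_eq_lintegral (strain u) hu.strain_ae]
  simp only [Fintype.sum_prod_type]
  rfl

theorem smoothSub_le_H1 : smoothSub Ω ≤ H1 Ω := by
  rintro w ⟨φ, hφ, -, h1, h2⟩ i ψ hψ
  have h3 := setIntegral_mul_pderiv (Ω := Ω) hφ hψ i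
  have h4 : ∫ x in Ω, w.fst x * pderiv i ψ x = ∫ x in Ω, φ x * pderiv i ψ x :=
    integral_congr_ae (by filter_upwards [h1] with x hx; rw [hx])
  have h5 : ∫ x in Ω, w.snd i x * ψ x = ∫ x in Ω, pderiv i φ x * ψ x :=
    integral_congr_ae (by filter_upwards [h2 i] with x hx; rw [hx])
  rw [h4, h5, h3]

theorem exists_smoothVec_tendsto (h : H1 Ω ≤ (smoothSub Ω).topologicalClosure) (v : H1Vec Ω) :
    ∃ (u : ℕ → H1Vec Ω) (φ : ℕ → Fin d → Pt d → ℝ), (∀ n, IsSmoothVec (u n) (φ n)) ∧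
      Tendsto u atTop (𝓝 v) := by
  have h1 : ∀ i, ∃ w : ℕ → Jet Ω, (∀ n, w n ∈ smoothSub Ω) ∧
      Tendsto w atTop (𝓝 (v i : Jet Ω)) := fun i => mem_closure_iff_seq_limit.1 (h (v i).2)
  choose w hw hlim using h1
  choose φ hφ hc h2 h3 using hw
  refine ⟨fun n => WithLp.toLp 2 fun i => ⟨w i n, smoothSub_le_H1 ⟨φ i n, hφ i n, hc i n, h2 i n,
    h3 i n⟩⟩, fun n i => φ i n, fun n i => ⟨hφ i n, hc i n, h2 i n, h3 i n⟩, ?_⟩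
  have := (PiLp.continuous_toLp 2 (fun _ : Fin d => H1 Ω)).tendsto v.ofLp
  exact this.comp (tendsto_pi_nhds.2 fun i => tendsto_subtype_rng.2 (hlim i))

/-- **Korn's inequality** on the orthogonal complement of the rigid motions. -/
theorem IsPolygonalDomain.exists_norm_valVec_le (hd : 0 < d) (h : IsPolygonalDomain Ω) :
    ∃ C : ℝ, 0 ≤ C ∧ ∀ v : H1Vec Ω, PerpRM v → ‖valVec v‖ ≤ C * ‖strain v‖ := by
  obtain ⟨C, hC, hkorn⟩ := h.exists_rigid_lintegral_le
  refine ⟨√C.toReal, Real.sqrt_nonneg _, fun v hv => ?_⟩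
  have hfin : IsFiniteMeasure ((volume : Measure (Pt d)).restrict Ω) :=
    ⟨by simpa using h.isBounded.measure_lt_top⟩
  -- Only `v` is orthogonal to the rigid motions, not its smooth approximations, so Korn's
  -- inequality modulo rigid motions is applied to `u` and the orthogonality is used for `v`.
  have hsmooth : ∀ (u : H1Vec Ω) (φ : Fin d → Pt d → ℝ), IsSmoothVec u φ →
      ‖valVec v‖ ≤ ‖valVec v - valVec u‖ + √C.toReal * ‖strain u‖ := by
    intro u φ hu
    obtain ⟨m, B, hB, hle⟩ := hkorn φ fun i => (hu i).1
    have hR : ∀ i, MemLp (rigidField m B i) 2 (volume.restrict Ω) := fun i => by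
      obtain ⟨K, -, hK⟩ := exists_bound_of_isBounded (contDiff_rigidField m B i).continuous
        h.isBounded
      refine MemLp.of_bound (contDiff_rigidField m B i).continuous.aestronglyMeasurable K ?_
      filter_upwards [ae_restrict_mem h.isOpen.measurableSet] with x hx using hK x hx
    let R : L2Vec Ω := WithLp.toLp 2 fun i => (hR i).toLp _
    have hRi : ∀ i, R i =ᵐ[volume.restrict Ω] rigidField m B i := fun i => (hR i).coeFn_toLp
    have hort : inner ℝ (valVec v) R = (0 : ℝ) := by
      rw [← hv m B hB, PiLp.inner_apply]
      refine Finset.sum_congr rfl fun i _ => ?_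
      rw [L2.inner_def]
      refine integral_congr_ae ?_
      filter_upwards [hRi i] with x hx
      rw [hx]
      simp only [RCLike.inner_apply, conj_trivial]
      rw [mul_comm]
      rfl
    -- By Pythagoras, subtracting a rigid motion from `v` cannot decrease its norm.
    have h1 : ‖valVec v‖ ≤ ‖valVec v - R‖ := by
      have h2 := norm_sub_sq_real (valVec v) R
      rw [hort] at h2
      refine le_of_sq_le_sq ?_ (norm_nonneg _)
      nlinarith [sq_nonneg ‖R‖]
    have h2 : ‖valVec u - R‖ ≤ √C.toReal * ‖strain u‖ := by
      have h3 := ofReal_norm_sq_eq_lintegral (valVec u - R)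
        (f := fun i x => φ i x - rigidField m B i x) fun i => by
          filter_upwards [Lp.coeFn_sub (val (u i)) (R i), (hu i).2.2.1, hRi i] with x h3 h4 h5
          show (val (u i) - R i : L2 Ω) x = _
          rw [h3, Pi.sub_apply, h4, h5]
      have h4 : ENNReal.ofReal (‖valVec u - R‖ ^ 2) ≤
          ENNReal.ofReal (C.toReal * ‖strain u‖ ^ 2) := by
        rw [h3, ENNReal.ofReal_mul ENNReal.toReal_nonneg, ENNReal.ofReal_toReal hC,
          hu.ofReal_norm_strain]
        exact hle
      rw [ENNReal.ofReal_le_ofReal_iff (by positivity)] at h4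
      refine le_of_sq_le_sq ?_ (by positivity)
      rwa [mul_pow, Real.sq_sqrt ENNReal.toReal_nonneg]
    calc ‖valVec v‖ ≤ ‖valVec v - R‖ := h1
      _ = ‖(valVec v - valVec u) + (valVec u - R)‖ := by congr 1; abel
      _ ≤ ‖valVec v - valVec u‖ + ‖valVec u - R‖ := norm_add_le _ _
      _ ≤ _ := by gcongr
  obtain ⟨u, φ, hu, hlim⟩ := exists_smoothVec_tendsto (h.H1_le_closure hd) v
  have h1 : Tendsto (fun n => ‖valVec v - valVec (u n)‖ + √C.toReal * ‖strain (u n)‖) atTop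
      (𝓝 (‖valVec v - valVec v‖ + √C.toReal * ‖strain v‖)) :=
    ((tendsto_const_nhds.sub ((continuous_valVec.tendsto v).comp hlim)).norm).add
      (((continuous_strain.tendsto v).comp hlim).norm.const_mul _)
  rw [sub_self, norm_zero, zero_add] at h1
  exact ge_of_tendsto' h1 fun n => hsmooth _ _ (hu n)

/-- Traces of vector fields exist and are controlled by the field and its strain. -/
theorem IsPolygonalDomain.exists_traceVec (hd : 0 < d) (h : IsPolygonalDomain Ω) :
    ∃ C : ℝ, 0 ≤ C ∧ ∀ v : H1Vec Ω, ∃ g : L2BdVec Ω, IsTraceVec v g ∧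
      ‖g‖ ≤ C * (‖valVec v‖ + ‖strain v‖) := by
  obtain ⟨hfin, C, hC, htr⟩ := h.exists_lintegral_surfaceMeasure_le hd
  have : IsFiniteMeasure (surfaceMeasure Ω) := ⟨hfin.lt_top⟩
  refine ⟨√C.toReal, Real.sqrt_nonneg _, fun v => ?_⟩
  obtain ⟨u, φ, hu, hlim⟩ := exists_smoothVec_tendsto (h.H1_le_closure hd) v
  have hmem : ∀ n i, MemLp (φ n i) 2 (surfaceMeasure Ω) := fun n i =>
    (hu n i).1.continuous.memLp_of_hasCompactSupport (hu n i).2.1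
  -- Applied to differences, this shows that the boundary values of the approximations form a Cauchy
  -- sequence; applied to the approximations, it bounds the limit.
  have hbd : ∀ (w : H1Vec Ω) (ψ : Fin d → Pt d → ℝ) (g : L2BdVec Ω), IsSmoothVec w ψ →
      (∀ i, g i =ᵐ[surfaceMeasure Ω] ψ i) → ‖g‖ ≤ √C.toReal * (‖valVec w‖ + ‖strain w‖) := by
    intro w ψ g hw hg
    have h1 : ENNReal.ofReal (‖g‖ ^ 2) ≤
        ENNReal.ofReal (C.toReal * (‖valVec w‖ ^ 2 + ‖strain w‖ ^ 2)) := by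
      rw [ofReal_norm_sq_eq_lintegral g hg, ENNReal.ofReal_mul ENNReal.toReal_nonneg,
        ENNReal.ofReal_toReal hC, ENNReal.ofReal_add (by positivity) (by positivity),
        hw.ofReal_norm_valVec, hw.ofReal_norm_strain,
        ← lintegral_add_left (continuous_fieldSq fun i => (hw i).1).measurable.ennreal_ofReal]
      refine (htr ψ fun i => (hw i).1).trans (le_of_eq ?_)
      congr 1
      exact lintegral_congr fun x => ENNReal.ofReal_add (fieldSq_nonneg _ _) (strainSq_nonneg _ _)
    rw [ENNReal.ofReal_le_ofReal_iff (by positivity)] at h1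
    refine le_of_sq_le_sq (h1.trans ?_) (by positivity)
    rw [mul_pow, Real.sq_sqrt ENNReal.toReal_nonneg]
    gcongr
    nlinarith [norm_nonneg (valVec w), norm_nonneg (strain w)]
  let g : ℕ → L2BdVec Ω := fun n => WithLp.toLp 2 fun i => (hmem n i).toLp _
  have hg : ∀ n i, g n i =ᵐ[surfaceMeasure Ω] φ n i := fun n i => (hmem n i).coeFn_toLp
  have hdiff : ∀ m n, dist (g m) (g n) ≤
      √C.toReal * (‖valVec (u m - u n)‖ + ‖strain (u m - u n)‖) := fun m n => by
    have h0 : ∀ i, (g m - g n) i =ᵐ[surfaceMeasure Ω] fun x => φ m i x - φ n i x := fun i => by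
      filter_upwards [Lp.coeFn_sub (g m i) (g n i), hg m i, hg n i] with x h1 h2 h3
      rw [PiLp.sub_apply, h1, Pi.sub_apply, h2, h3]
    rw [dist_eq_norm]
    exact hbd (u m - u n) (fun i x => φ m i x - φ n i x) (g m - g n) ((hu m).sub (hu n)) h0
  have hcauchy : CauchySeq g := by
    rw [cauchySeq_iff_tendsto_dist_atTop_0]
    have h1 : Tendsto (fun q : ℕ × ℕ => u q.1 - u q.2) atTop (𝓝 0) := by
      have h2 := cauchySeq_iff_tendsto_dist_atTop_0.1 hlim.cauchySeq
      rw [tendsto_zero_iff_norm_tendsto_zero]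
      simpa only [dist_eq_norm] using h2
    have h2 : Tendsto (fun q : ℕ × ℕ => √C.toReal *
        (‖valVec (u q.1 - u q.2)‖ + ‖strain (u q.1 - u q.2)‖)) atTop (𝓝 0) := by
      have h3 : Tendsto (fun q : ℕ × ℕ => valVec (u q.1 - u q.2)) atTop (𝓝 0) := by
        rw [← valVec_zero]
        exact (continuous_valVec.tendsto 0).comp h1
      have h4 : Tendsto (fun q : ℕ × ℕ => strain (u q.1 - u q.2)) atTop (𝓝 0) := by
        rw [← strain_zero]
        exact (continuous_strain.tendsto 0).comp h1
      simpa only [norm_zero, add_zero, mul_zero] using (h3.norm.add h4.norm).const_mul √C.toReal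
    exact squeeze_zero (fun _ => dist_nonneg) (fun q => hdiff q.1 q.2) h2
  obtain ⟨g₀, hg₀⟩ := cauchySeq_tendsto_of_complete hcauchy
  refine ⟨g₀, fun i => ⟨fun n => φ n i, fun n => (hu n i).1, ?_, fun j => ?_, ?_⟩, ?_⟩
  · rw [← tendsto_L2_iff fun n => (hu n i).2.2.1]
    exact ((continuous_val_apply i).tendsto v).comp hlim
  · rw [← tendsto_L2_iff fun n => (hu n i).2.2.2 j]
    exact ((continuous_grad_apply i j).tendsto v).comp hlim
  · rw [← tendsto_L2_iff fun n => hg n i]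
    exact ((PiLp.continuous_apply 2 (fun _ : Fin d => L2Bd Ω) i).tendsto g₀).comp hg₀
  · have h1 : Tendsto (fun n => √C.toReal * (‖valVec (u n)‖ + ‖strain (u n)‖)) atTop
        (𝓝 (√C.toReal * (‖valVec v‖ + ‖strain v‖))) :=
      ((((continuous_valVec.tendsto v).comp hlim).norm).add
        (((continuous_strain.tendsto v).comp hlim).norm)).const_mul _
    exact le_of_tendsto_of_tendsto' hg₀.norm h1 fun n => hbd _ _ _ (hu n) (hg n)

/-- Traces of functions exist and are controlled by the `H¹` norm. -/
theorem IsPolygonalDomain.exists_trace (hd : 0 < d) (h : IsPolygonalDomain Ω) :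
    ∃ C : ℝ, 0 ≤ C ∧ ∀ u : H1 Ω, ∃ g : L2Bd Ω, IsTrace u g ∧ ‖g‖ ≤ C * (‖val u‖ + ‖grad u‖) := by
  obtain ⟨C, hC, htr⟩ := h.exists_traceVec hd
  refine ⟨C * √d, by positivity, fun u => ?_⟩
  obtain ⟨g, hg, hle⟩ := htr (WithLp.toLp 2 fun _ => u)
  refine ⟨g ⟨0, hd⟩, hg ⟨0, hd⟩, (PiLp.norm_apply_le g _).trans (hle.trans ?_)⟩
  have h1 : ‖valVec (WithLp.toLp 2 fun _ => u : H1Vec Ω)‖ ≤ √d * ‖val u‖ := by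
    refine le_of_sq_le_sq ?_ (by positivity)
    rw [norm_valVec_const, mul_pow, Real.sq_sqrt (Nat.cast_nonneg d)]
  have h2 : ‖strain (WithLp.toLp 2 fun _ => u : H1Vec Ω)‖ ≤ √d * ‖grad u‖ := by
    refine le_of_sq_le_sq ?_ (by positivity)
    rw [mul_pow, Real.sq_sqrt (Nat.cast_nonneg d)]
    exact norm_strain_const_le u
  rw [mul_assoc, mul_add √d]
  gcongr

end Traces

/-! ### Steklov averages and an abstract energy inequality -/

section Energy

/-- Backward averages in time. -/
def steklov {Y : Type*} [NormedAddCommGroup Y] [NormedSpace ℝ Y] (f : ℝ → Y) (h t : ℝ) : Y :=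
  h⁻¹ • ∫ r in (t - h)..t, f r

variable {Y Z : Type*} [NormedAddCommGroup Y] [NormedSpace ℝ Y]
  [NormedAddCommGroup Z] [NormedSpace ℝ Z]

/-- The Steklov average is the average of the translates `f (t - z)` over the uniform distribution
of `z` on `(0, h)`. -/
theorem tendsto_eLpNorm_steklov [CompleteSpace Y] {f : ℝ → Y} (hf : MemLp f 2 volume) :
    Tendsto (fun h => eLpNorm (fun t => steklov f h t - f t) 2 volume) (𝓝[>] 0) (𝓝 0) := by
  rw [ENNReal.tendsto_nhds_zero]
  intro ε hε
  obtain ⟨δ, hδ, key⟩ := exists_eLpNorm_average_sub_le volume hf hε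
  filter_upwards [Ioo_mem_nhdsGT hδ] with h hh
  set ν : Measure ℝ := (ENNReal.ofReal h)⁻¹ • volume.restrict (Ioo 0 h) with hν
  have hh0 : ENNReal.ofReal h ≠ 0 := by simpa using hh.1
  have hνp : IsProbabilityMeasure ν := ⟨by
    rw [hν, Measure.smul_apply, Measure.restrict_apply_univ, Real.volume_Ioo, sub_zero, smul_eq_mul,
      ENNReal.inv_mul_cancel hh0 ENNReal.ofReal_ne_top]⟩
  have hνac : ν ≪ volume :=
    (Measure.smul_absolutelyContinuous).trans Measure.restrict_le_self.absolutelyContinuous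
  have hνb : ∀ᵐ z ∂ν, ‖z‖ < δ := by
    refine Measure.smul_absolutelyContinuous.ae_le ?_
    filter_upwards [ae_restrict_mem measurableSet_Ioo] with z hz
    rw [Real.norm_of_nonneg hz.1.le]
    exact hz.2.trans hh.2
  have e : ∀ t, ∫ z, f (t - z) ∂ν = steklov f h t := fun t => by
    rw [hν, integral_smul_measure, ← integral_Ioc_eq_integral_Ioo,
      ← intervalIntegral.integral_of_le hh.1.le, intervalIntegral.integral_comp_sub_left, sub_zero,
      ENNReal.toReal_inv, ENNReal.toReal_ofReal hh.1.le]
    rfl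
  simpa only [e] using key ν hνp hνac hνb

theorem continuous_steklov {f : ℝ → Y} (hf : LocallyIntegrable f) (h : ℝ) :
    Continuous (steklov f h) := by
  have hi : ∀ a b, IntervalIntegrable f volume a b := fun a b =>
    (hf.integrableOn_isCompact isCompact_uIcc).intervalIntegrable
  have hp : Continuous fun t => ∫ r in (0 : ℝ)..t, f r := intervalIntegral.continuous_primitive hi 0
  have e : steklov f h = fun t => h⁻¹ • ((∫ r in (0 : ℝ)..t, f r) - ∫ r in (0 : ℝ)..(t - h), f r) := by
    funext t
    rw [steklov, intervalIntegral.integral_interval_sub_left (hi _ _) (hi _ _)]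
  rw [e]
  exact (hp.sub (hp.comp (continuous_id.sub continuous_const))).const_smul _

theorem lintegral_enorm_rpow_two {α X : Type*} [MeasurableSpace α] [NormedAddCommGroup X]
    {μ : Measure α} (f : α → X) :
    (∫⁻ x, ‖f x‖ₑ ^ (2 : ℝ) ∂μ) ^ (1 / (2 : ℝ)) = eLpNorm f 2 μ := by
  rw [eLpNorm_eq_lintegral_rpow_enorm_toReal (by norm_num) (by norm_num)]
  norm_num

theorem lintegral_enorm_mul_enorm_le {α X X' : Type*} [MeasurableSpace α] [NormedAddCommGroup X]
    [NormedAddCommGroup X'] {μ : Measure α} {f : α → X} {g : α → X'}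
    (hf : AEStronglyMeasurable f μ) (hg : AEStronglyMeasurable g μ) :
    ∫⁻ x, ‖f x‖ₑ * ‖g x‖ₑ ∂μ ≤ eLpNorm f 2 μ * eLpNorm g 2 μ := by
  have h := ENNReal.lintegral_mul_le_Lp_mul_Lq μ (p := 2) (q := 2) Real.HolderConjugate.two_two
    hf.enorm hg.enorm
  rwa [lintegral_enorm_rpow_two, lintegral_enorm_rpow_two] at h

theorem lintegral_enorm_bilin_le {μ : Measure ℝ} (B : Y →L[ℝ] Z →L[ℝ] ℝ) {f : ℝ → Y} {g : ℝ → Z}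
    (hf : AEStronglyMeasurable f μ) (hg : AEStronglyMeasurable g μ) :
    ∫⁻ t, ‖B (f t) (g t)‖ₑ ∂μ ≤ ‖B‖ₑ * (eLpNorm f 2 μ * eLpNorm g 2 μ) := by
  calc ∫⁻ t, ‖B (f t) (g t)‖ₑ ∂μ ≤ ∫⁻ t, ‖B‖ₑ * (‖f t‖ₑ * ‖g t‖ₑ) ∂μ := by
        refine lintegral_mono fun t => ?_
        rw [← mul_assoc]
        exact ((B (f t)).le_opENorm (g t)).trans (by gcongr; exact B.le_opENorm (f t))
    _ = ‖B‖ₑ * ∫⁻ t, ‖f t‖ₑ * ‖g t‖ₑ ∂μ := lintegral_const_mul' _ _ (by simp)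
    _ ≤ _ := by
        gcongr
        exact lintegral_enorm_mul_enorm_le hf hg

theorem integrable_bilin {μ : Measure ℝ} (B : Y →L[ℝ] Z →L[ℝ] ℝ) {f : ℝ → Y} {g : ℝ → Z}
    (hf : MemLp f 2 μ) (hg : MemLp g 2 μ) : Integrable (fun t => B (f t) (g t)) μ :=
  ⟨B.aestronglyMeasurable_comp₂ hf.1 hg.1, (lintegral_enorm_bilin_le B hf.1 hg.1).trans_lt
    (ENNReal.mul_lt_top (by simp) (ENNReal.mul_lt_top hf.2 hg.2))⟩

theorem tendsto_integral_steklov [CompleteSpace Y] (B : Y →L[ℝ] Z →L[ℝ] ℝ) {f : ℝ → Y} {g : ℝ → Z}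
    {S : Set ℝ} (hf : MemLp f 2 volume) (hg : MemLp g 2 (volume.restrict S))
    (hS : Bornology.IsBounded S) (hSm : MeasurableSet S) :
    (∀ h, Integrable (fun t => B (steklov f h t) (g t)) (volume.restrict S)) ∧
    Tendsto (fun h => ∫ t in S, B (steklov f h t) (g t)) (𝓝[>] 0) (𝓝 (∫ t in S, B (f t) (g t))) := by
  have hfl : LocallyIntegrable f := hf.locallyIntegrable (by norm_num)
  have hfin : IsFiniteMeasure ((volume : Measure ℝ).restrict S) :=
    ⟨by simpa using hS.measure_lt_top⟩
  have hfS : MemLp f 2 (volume.restrict S) := hf.restrict S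
  have hstek : ∀ h, MemLp (steklov f h) 2 (volume.restrict S) := fun h => by
    have hc := continuous_steklov hfl h
    obtain ⟨C, hC⟩ := hS.isCompact_closure.exists_bound_of_continuousOn hc.continuousOn
    refine MemLp.of_bound hc.aestronglyMeasurable C ?_
    exact ae_restrict_of_forall_mem hSm fun t ht => hC t (subset_closure ht)
  have hint : ∀ h, Integrable (fun t => B (steklov f h t) (g t)) (volume.restrict S) := fun h =>
    integrable_bilin B (hstek h) hg
  refine ⟨hint, tendsto_integral_of_L1 _ (integrable_bilin B hfS hg).1 (Eventually.of_forall hint) ?_⟩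
  have hlim : Tendsto (fun h => ‖B‖ₑ * (eLpNorm (fun t => steklov f h t - f t) 2 volume *
      eLpNorm g 2 (volume.restrict S))) (𝓝[>] 0) (𝓝 0) := by
    have h1 := ENNReal.Tendsto.const_mul (a := ‖B‖ₑ) (ENNReal.Tendsto.mul_const
      (tendsto_eLpNorm_steklov hf) (Or.inr hg.2.ne)) (Or.inr (by simp))
    simpa using h1
  refine tendsto_of_tendsto_of_tendsto_of_le_of_le tendsto_const_nhds hlim (fun _ => zero_le)
    fun h => ?_
  have h1 := lintegral_enorm_bilin_le B ((hstek h).sub hfS).1 hg.1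
  simp only [Pi.sub_apply, map_sub, sub_apply] at h1
  refine h1.trans ?_
  gcongr
  exact eLpNorm_mono_measure _ Measure.restrict_le_self

/-- Integrating an inequality for backward difference quotients. -/
theorem ae_le_of_differenceQuotient_le {T : ℝ} {E : ℝ → ℝ} {E₀ : ℝ} (hT : 0 < T)
    (hE₀ : ∀ t ≤ 0, E t = E₀) (hE : IntegrableOn E (Ioo 0 T)) {R : ℝ → ℝ → ℝ} {I : ℝ → ℝ}
    (hR : ∀ s ∈ Ioo 0 T, ∀ h, IntegrableOn (R h) (Ioo 0 s))
    (hlim : ∀ s ∈ Ioo 0 T, Tendsto (fun h => ∫ t in Ioo 0 s, R h t) (𝓝[>] 0) (𝓝 (I s)))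
    (hstep : ∀ h > 0, ∀ᵐ t ∂(timeMeasure T), h⁻¹ * (E t - E (t - h)) ≤ R h t) :
    ∀ᵐ s ∂(timeMeasure T), E s ≤ E₀ + I s := by
  have hEi : IntervalIntegrable E volume 0 T := by
    rw [intervalIntegrable_iff_integrableOn_Ioo_of_le hT.le]
    exact hE
  have hsub : ∀ a b, a ≤ T → b ≤ T → IntervalIntegrable E volume a b := by
    have h0 : ∀ b ≤ T, IntervalIntegrable E volume 0 b := fun b hb => by
      rcases le_total 0 b with h | h
      · exact hEi.mono_set (by rw [uIcc_of_le h, uIcc_of_le hT.le]; exact Icc_subset_Icc_right hb)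
      · refine (intervalIntegrable_const (c := E₀)).congr ?_
        intro t ht
        rw [uIoc_of_ge h] at ht
        exact (hE₀ t ht.2).symm
    exact fun a b ha hb => (h0 a ha).symm.trans (h0 b hb)
  rw [timeMeasure, ae_restrict_iff' measurableSet_Ioo]
  filter_upwards [hEi.ae_hasDerivAt_integral] with s hs hsT
  rw [uIcc_of_le hT.le] at hs
  have hd := hs ⟨hsT.1.le, hsT.2.le⟩ 0 ⟨le_rfl, hT.le⟩
  -- Lebesgue differentiation: backward averages of `E` converge to `E s` at almost every `s`.
  have hquot : Tendsto (fun h : ℝ => h⁻¹ * ∫ t in (s - h)..s, E t) (𝓝[>] 0) (𝓝 (E s)) := by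
    have h1 : Tendsto (fun h : ℝ => s - h) (𝓝[>] 0) (𝓝[≠] s) := by
      refine tendsto_nhdsWithin_iff.2 ⟨?_, ?_⟩
      · have : Continuous fun h : ℝ => s - h := by fun_prop
        simpa using (this.tendsto 0).mono_left nhdsWithin_le_nhds
      · filter_upwards [self_mem_nhdsWithin] with h hh
        have hh : 0 < h := hh
        show s - h ≠ s
        linarith
    refine (hd.tendsto_slope.comp h1).congr' ?_
    filter_upwards [self_mem_nhdsWithin] with h hh
    have hh : 0 < h := hh
    have h2 : (∫ t in (0 : ℝ)..s, E t) - ∫ t in (0 : ℝ)..(s - h), E t = ∫ t in (s - h)..s, E t :=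
      intervalIntegral.integral_interval_sub_left (hsub _ _ hT.le hsT.2.le)
        (hsub _ _ hT.le (by linarith [hsT.2]))
    rw [← h2, Function.comp_apply, slope_def_field]
    have h3 : s - h - s = -h := by ring
    rw [h3, div_neg, ← neg_div, neg_sub, div_eq_inv_mul]
  have hle : ∀ᶠ h in 𝓝[>] (0 : ℝ), (h⁻¹ * ∫ t in (s - h)..s, E t) - E₀ ≤
      ∫ t in Ioo 0 s, R h t := by
    filter_upwards [self_mem_nhdsWithin] with h hh
    have hh : 0 < h := hh
    have hi1 : IntegrableOn E (Ioo 0 s) := by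
      rw [← intervalIntegrable_iff_integrableOn_Ioo_of_le hsT.1.le]
      exact hsub _ _ hT.le hsT.2.le
    have hi2' : IntervalIntegrable (fun t => E (t - h)) volume 0 s := by
      have := (hsub (0 - h) (s - h) (by linarith) (by linarith [hsT.2])).comp_sub_right h
      simpa using this
    have hi2 : IntegrableOn (fun t => E (t - h)) (Ioo 0 s) := by
      rwa [← intervalIntegrable_iff_integrableOn_Ioo_of_le hsT.1.le]
    -- Integrating the difference quotient telescopes to the average of `E` over `(s - h, s)` minus
    -- that over `(-h, 0)`, and the latter equals `E₀` because `E` is constant before time zero.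
    have h1 : ∫ t in Ioo 0 s, h⁻¹ * (E t - E (t - h)) ≤ ∫ t in Ioo 0 s, R h t := by
      refine integral_mono_ae ((hi1.sub hi2).const_mul _) (hR s hsT h) ?_
      exact (ae_mono (Measure.restrict_mono (Ioo_subset_Ioo_right hsT.2.le) le_rfl)) (hstep h hh)
    refine le_trans (le_of_eq ?_) h1
    rw [integral_const_mul, integral_sub hi1 hi2, ← integral_Ioc_eq_integral_Ioo,
      ← integral_Ioc_eq_integral_Ioo, ← intervalIntegral.integral_of_le hsT.1.le,
      ← intervalIntegral.integral_of_le hsT.1.le, intervalIntegral.integral_comp_sub_right]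
    have h2 : ∫ t in (0 - h)..(0 : ℝ), E t = h * E₀ := by
      have h3 : ∫ t in (0 - h)..(0 : ℝ), E t = ∫ _ in (0 - h)..(0 : ℝ), E₀ :=
        intervalIntegral.integral_congr fun t ht => by
          rw [uIcc_of_le (by linarith)] at ht
          exact hE₀ t ht.2
      rw [h3, intervalIntegral.integral_const]
      simp
    have h4 := intervalIntegral.integral_add_adjacent_intervals
      (hsub (0 - h) 0 (by linarith) hT.le) (hsub 0 (s - h) hT.le (by linarith [hsT.2]))
    have h5 := intervalIntegral.integral_add_adjacent_intervals
      (hsub 0 (s - h) hT.le (by linarith [hsT.2])) (hsub (s - h) s (by linarith [hsT.2]) hsT.2.le)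
    rw [← h4, ← h5, h2]
    field_simp
    ring
  have := le_of_tendsto_of_tendsto (hquot.sub_const E₀) (hlim s hsT) hle
  linarith

variable {V S L X : Type*} [NormedAddCommGroup V] [NormedSpace ℝ V]
  [NormedAddCommGroup S] [InnerProductSpace ℝ S] [NormedAddCommGroup L] [InnerProductSpace ℝ L]
  [NormedAddCommGroup X] [NormedSpace ℝ X]

/-- Convexity of `½ ‖·‖²`: the increment is at most the derivative at the new point applied to the
increment. -/
theorem half_norm_sq_sub_le (a b : S) : 1 / 2 * ‖a‖ ^ 2 - 1 / 2 * ‖b‖ ^ 2 ≤ inner ℝ a (a - b) := by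
  have h := norm_sub_sq_real a b
  rw [inner_sub_right, real_inner_self_eq_norm_sq]
  nlinarith [sq_nonneg ‖a - b‖]

/-- The stored energy. -/
def storedEnergy (εL : V →L[ℝ] S) (dL : V →L[ℝ] L) (ℓ : V →L[ℝ] ℝ) (γ β a₀ : ℝ) (v : V) (P : L) :
    ℝ :=
  γ * (1 / 2 * ‖εL v‖ ^ 2) + β * (1 / 2 * ‖dL v‖ ^ 2) + a₀ * (1 / 2 * ‖P‖ ^ 2) - ℓ v

/-- The discrete form of testing with the time derivative: the momentum equation at the new state is
tested with `v - v'`. The coupling term `b₀ P` combines with the increment of `a₀ P` into the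
increment of the fluid content `a₀ P + b₀ dL v`, paired with `P`. -/
theorem storedEnergy_sub_le {εL : V →L[ℝ] S} {dL : V →L[ℝ] L} {ℓ : V →L[ℝ] ℝ}
    {γ β a₀ b₀ lam : ℝ} (hγ : 0 ≤ γ) (hβ : 0 ≤ β) (ha₀ : 0 ≤ a₀) {v v' : V} {P P' q : L}
    (hmom : ∀ w, γ * inner ℝ (εL v) (εL w) =
      inner ℝ (b₀ • P - β • dL v - lam • q) (dL w) + ℓ w) :
    storedEnergy εL dL ℓ γ β a₀ v P - storedEnergy εL dL ℓ γ β a₀ v' P' ≤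
      inner ℝ ((a₀ • P + b₀ • dL v) - (a₀ • P' + b₀ • dL v')) P -
        lam * inner ℝ (dL v - dL v') q := by
  have h1 := mul_le_mul_of_nonneg_left (half_norm_sq_sub_le (εL v) (εL v')) hγ
  have h2 := mul_le_mul_of_nonneg_left (half_norm_sq_sub_le (dL v) (dL v')) hβ
  have h3 := mul_le_mul_of_nonneg_left (half_norm_sq_sub_le P P') ha₀
  have h4 := hmom (v - v')
  rw [map_sub, map_sub, map_sub, inner_sub_left, inner_sub_left, real_inner_smul_left,
    real_inner_smul_left, real_inner_smul_left] at h4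
  have e : (a₀ • P + b₀ • dL v) - (a₀ • P' + b₀ • dL v') =
      a₀ • (P - P') + b₀ • (dL v - dL v') := by module
  rw [e, inner_add_left, real_inner_smul_left, real_inner_smul_left, real_inner_comm P (P - P'),
    real_inner_comm P (dL v - dL v'), real_inner_comm q (dL v - dL v')]
  unfold storedEnergy
  linarith

theorem memLp_indicator_Ioo {W : Type*} [NormedAddCommGroup W] {T : ℝ} {f : ℝ → W} {p : ℝ≥0∞}
    (hf : MemLp f p (timeMeasure T)) : MemLp ((Ioo 0 T).indicator f) p volume :=
  (memLp_indicator_iff_restrict measurableSet_Ioo).2 hf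

theorem integral_indicator_Ioo_of_le {W : Type*} [NormedAddCommGroup W] [NormedSpace ℝ W] {T t : ℝ}
    (f : ℝ → W) (ht : t < T) : ∫ r in (0 : ℝ)..t, (Ioo 0 T).indicator f r =
      if t ≤ 0 then 0 else ∫ r in (0 : ℝ)..t, f r := by
  split_ifs with h
  · rw [intervalIntegral.integral_of_ge h]
    have h0 : ∫ r in Ioc t 0, (Ioo 0 T).indicator f r = 0 := by
      refine setIntegral_eq_zero_of_forall_eq_zero fun r hr => ?_
      rw [indicator_of_notMem]
      exact fun hr' => absurd hr'.1 (not_lt.2 hr.2)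
    rw [h0, neg_zero]
  · push Not at h
    rw [intervalIntegral.integral_of_le h.le, intervalIntegral.integral_of_le h.le]
    refine setIntegral_congr_fun measurableSet_Ioc fun r hr => ?_
    rw [indicator_of_mem]
    exact ⟨hr.1, hr.2.trans_lt ht⟩

/-- The energy inequality for an abstract linear poroelastic system. -/
theorem ae_storedEnergy_le [CompleteSpace L] (εL : V →L[ℝ] S) (dL : V →L[ℝ] L) (vL : X →L[ℝ] L)
    (ℓ : V →L[ℝ] ℝ) {γ β a₀ b₀ lam T : ℝ} (hγ : 0 ≤ γ) (hβ : 0 ≤ β) (ha₀ : 0 ≤ a₀) (hT : 0 < T)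
    {τ : ℝ → V} {p : ℝ → X} {q : ℝ → L} {w : ℝ → X →L[ℝ] ℝ} {τ₀ : V} {p₀ : L}
    (hτ : MemLp τ ⊤ (timeMeasure T)) (hvp : MemLp (fun t => vL (p t)) ⊤ (timeMeasure T))
    (hp : MemLp p 2 (timeMeasure T)) (hq : MemLp q 2 (timeMeasure T))
    (hw : MemLp w 2 (timeMeasure T))
    (hmom : ∀ᵐ t ∂(timeMeasure T), ∀ v, γ * inner ℝ (εL (τ t)) (εL v) =
      inner ℝ (b₀ • vL (p t) - β • dL (τ t) - lam • q t) (dL v) + ℓ v)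
    (hmass : ∀ᵐ t ∂(timeMeasure T), ∀ x, inner ℝ (a₀ • vL (p t) + b₀ • dL (τ t)) (vL x) =
      inner ℝ (a₀ • p₀ + b₀ • dL τ₀) (vL x) + (∫ s in (0 : ℝ)..t, w s) x)
    (hdiv : lam ≠ 0 → ∀ᵐ t ∂(timeMeasure T), dL (τ t) = dL τ₀ + ∫ s in (0 : ℝ)..t, q s) :
    ∀ᵐ s ∂(timeMeasure T), storedEnergy εL dL ℓ γ β a₀ (τ s) (vL (p s)) +
        lam * ∫ r in Ioo 0 s, ‖q r‖ ^ 2 ≤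
      storedEnergy εL dL ℓ γ β a₀ τ₀ p₀ + ∫ r in Ioo 0 s, w r (p r) := by
  -- Extension by the initial data to `t ≤ 0`. Then the difference quotients are defined for every
  -- `t ∈ (0, T)` and every step, and the integrated equations hold at all negative times when `w`
  -- and `q` are extended by zero.
  set τ' : ℝ → V := fun t => if t ≤ 0 then τ₀ else τ t with hτ'
  set P' : ℝ → L := fun t => if t ≤ 0 then p₀ else vL (p t) with hP'
  set w' : ℝ → X →L[ℝ] ℝ := (Ioo 0 T).indicator w with hw'
  set q' : ℝ → L := (Ioo 0 T).indicator q with hq'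
  have hw2 : MemLp w' 2 volume := memLp_indicator_Ioo hw
  have hq2 : MemLp q' 2 volume := memLp_indicator_Ioo hq
  have hwi : ∀ a b, IntervalIntegrable w' volume a b := fun a b =>
    ((hw2.locallyIntegrable (by norm_num)).integrableOn_isCompact isCompact_uIcc).intervalIntegrable
  have hqi : ∀ a b, IntervalIntegrable q' volume a b := fun a b =>
    ((hq2.locallyIntegrable (by norm_num)).integrableOn_isCompact isCompact_uIcc).intervalIntegrable
  let Good : ℝ → Prop := fun s =>
    (∀ x, inner ℝ (a₀ • P' s + b₀ • dL (τ' s)) (vL x) =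
      inner ℝ (a₀ • p₀ + b₀ • dL τ₀) (vL x) + (∫ r in (0 : ℝ)..s, w' r) x) ∧
    (lam ≠ 0 → dL (τ' s) = dL τ₀ + ∫ r in (0 : ℝ)..s, q' r)
  have hgood0 : ∀ s ≤ 0, Good s := fun s hs => by
    refine ⟨fun x => ?_, fun _ => ?_⟩
    · rw [integral_indicator_Ioo_of_le w (hs.trans_lt hT)]
      simp [hP', hτ', hs]
    · rw [integral_indicator_Ioo_of_le q (hs.trans_lt hT)]
      simp [hτ', hs]
  have hgood : ∀ᵐ t ∂(timeMeasure T), Good t := by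
    have hdiv' : ∀ᵐ t ∂(timeMeasure T), lam ≠ 0 → dL (τ t) = dL τ₀ + ∫ s in (0 : ℝ)..t, q s := by
      by_cases h : lam = 0
      · exact Eventually.of_forall fun _ h' => absurd h h'
      · filter_upwards [hdiv h] with t ht _ using ht
    filter_upwards [hmass, hdiv', ae_restrict_mem measurableSet_Ioo] with t h1 h2 ht
    have ht0 : ¬ t ≤ 0 := not_le.2 ht.1
    refine ⟨fun x => ?_, fun h => ?_⟩
    · rw [integral_indicator_Ioo_of_le w ht.2]
      simpa [hP', hτ', ht0] using h1 x
    · rw [integral_indicator_Ioo_of_le q ht.2]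
      simpa [hτ', ht0] using h2 h
  have hfin : IsFiniteMeasure (timeMeasure T) := ⟨by simp [timeMeasure]⟩
  set E : ℝ → ℝ := fun t => storedEnergy εL dL ℓ γ β a₀ (τ' t) (P' t) with hE
  have hE₀ : ∀ t ≤ 0, E t = storedEnergy εL dL ℓ γ β a₀ τ₀ p₀ := fun t ht => by
    simp [hE, hτ', hP', ht]
  have hEpos : ∀ t ∈ Ioo 0 T, E t = storedEnergy εL dL ℓ γ β a₀ (τ t) (vL (p t)) := fun t ht => by
    simp [hE, hτ', hP', not_le.2 ht.1]
  have hEi : IntegrableOn E (Ioo 0 T) := by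
    have h3 : Integrable (fun t => storedEnergy εL dL ℓ γ β a₀ (τ t) (vL (p t)))
        (timeMeasure T) := by
      have i1 : Integrable (fun t => ‖εL (τ t)‖ ^ 2) (timeMeasure T) :=
        ((εL.comp_memLp' hτ).mono_exponent le_top).integrable_norm_pow (p := 2) (by norm_num)
      have i2 : Integrable (fun t => ‖dL (τ t)‖ ^ 2) (timeMeasure T) :=
        ((dL.comp_memLp' hτ).mono_exponent le_top).integrable_norm_pow (p := 2) (by norm_num)
      have i3 : Integrable (fun t => ‖vL (p t)‖ ^ 2) (timeMeasure T) :=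
        (hvp.mono_exponent le_top).integrable_norm_pow (p := 2) (by norm_num)
      have i4 : Integrable (fun t => ℓ (τ t)) (timeMeasure T) :=
        memLp_one_iff_integrable.1 ((ℓ.comp_memLp' hτ).mono_exponent le_top)
      exact (((((i1.const_mul (1 / 2)).const_mul γ).add ((i2.const_mul (1 / 2)).const_mul β)).add
        ((i3.const_mul (1 / 2)).const_mul a₀)).sub i4)
    refine h3.congr ?_
    filter_upwards [ae_restrict_mem measurableSet_Ioo] with t ht using (hEpos t ht).symm
  let B₁ : (X →L[ℝ] ℝ) →L[ℝ] X →L[ℝ] ℝ := ContinuousLinearMap.id ℝ _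
  let B₂ : L →L[ℝ] L →L[ℝ] ℝ := innerSL ℝ
  have hB₁ : ∀ a b, B₁ a b = a b := fun _ _ => rfl
  have hB₂ : ∀ a b, B₂ a b = inner ℝ a b := fun _ _ => rfl
  have hs1 := fun s (hs : s ∈ Ioo 0 T) => tendsto_integral_steklov B₁ hw2
    (hp.mono_measure (Measure.restrict_mono (Ioo_subset_Ioo_right hs.2.le) le_rfl))
    (Metric.isBounded_Ioo 0 s) measurableSet_Ioo
  have hs2 := fun s (hs : s ∈ Ioo 0 T) => tendsto_integral_steklov B₂ hq2
    (hq.mono_measure (Measure.restrict_mono (Ioo_subset_Ioo_right hs.2.le) le_rfl))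
    (Metric.isBounded_Ioo 0 s) measurableSet_Ioo
  have hmain := ae_le_of_differenceQuotient_le (E := E)
    (R := fun h t => B₁ (steklov w' h t) (p t) - lam * B₂ (steklov q' h t) (q t))
    (I := fun s => (∫ t in Ioo 0 s, B₁ (w' t) (p t)) - lam * ∫ t in Ioo 0 s, B₂ (q' t) (q t))
    hT hE₀ hEi (fun s hs h => ((hs1 s hs).1 h).sub (((hs2 s hs).1 h).const_mul lam))
    (fun s hs => by
      have h1 := (hs1 s hs).2.sub ((hs2 s hs).2.const_mul lam)
      refine h1.congr fun h => ?_
      rw [integral_sub ((hs1 s hs).1 h) (((hs2 s hs).1 h).const_mul lam), integral_const_mul]) ?_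
  · filter_upwards [hmain, ae_restrict_mem measurableSet_Ioo] with s hs hsT
    have e1 : ∫ t in Ioo 0 s, B₁ (w' t) (p t) = ∫ r in Ioo 0 s, w r (p r) :=
      setIntegral_congr_fun measurableSet_Ioo fun t ht => by
        simp only [hB₁, hw', indicator_of_mem (Ioo_subset_Ioo_right hsT.2.le ht)]
    have e2 : ∫ t in Ioo 0 s, B₂ (q' t) (q t) = ∫ r in Ioo 0 s, ‖q r‖ ^ 2 :=
      setIntegral_congr_fun measurableSet_Ioo fun t ht => by
        simp only [hB₂, hq', indicator_of_mem (Ioo_subset_Ioo_right hsT.2.le ht),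
          real_inner_self_eq_norm_sq]
    rw [hEpos s hsT, e1, e2] at hs
    linarith
  · intro h hh
    have hshift : ∀ᵐ t : ℝ, t - h ∈ Ioo 0 T → Good (t - h) := by
      have h1 : ∀ᵐ t : ℝ, t ∈ Ioo 0 T → Good t := (ae_restrict_iff' measurableSet_Ioo).1 hgood
      exact (measurePreserving_sub_right volume h).quasiMeasurePreserving.ae h1
    filter_upwards [hgood, hmom, ae_restrict_of_ae hshift, ae_restrict_mem measurableSet_Ioo]
      with t ht hmt hts htT
    have hgs : Good (t - h) := by
      rcases le_or_gt (t - h) 0 with h0 | h0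
      · exact hgood0 _ h0
      · exact hts ⟨h0, by linarith [htT.2]⟩
    have ht0 : ¬ t ≤ 0 := not_le.2 htT.1
    have hτt : τ' t = τ t := by simp [hτ', ht0]
    have hPt : P' t = vL (p t) := by simp [hP', ht0]
    have h1 := storedEnergy_sub_le (v' := τ' (t - h)) (P' := P' (t - h)) (a₀ := a₀) hγ hβ ha₀ hmt
    -- The increment of the fluid content is the integral of `w` over `(t - h, t)`; after division
    -- by `h` it is a Steklov average applied to `p t`.
    have h2 : inner ℝ ((a₀ • vL (p t) + b₀ • dL (τ t)) - (a₀ • P' (t - h) + b₀ • dL (τ' (t - h))))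
        (vL (p t)) = (∫ r in (t - h)..t, w' r) (p t) := by
      have h3 := ht.1 (p t)
      have h4 := hgs.1 (p t)
      rw [hτt, hPt] at h3
      rw [inner_sub_left, h3, h4, ← intervalIntegral.integral_interval_sub_left (hwi 0 t)
        (hwi 0 (t - h)), sub_apply]
      ring
    have h3 : lam * inner ℝ (dL (τ t) - dL (τ' (t - h))) (q t) =
        lam * inner ℝ (∫ r in (t - h)..t, q' r) (q t) := by
      by_cases hl : lam = 0
      · simp [hl]
      · have h4 := ht.2 hl
        have h5 := hgs.2 hl
        rw [hτt] at h4
        rw [h4, h5, ← intervalIntegral.integral_interval_sub_left (hqi 0 t) (hqi 0 (t - h))]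
        congr 2
        abel
    rw [h2, h3] at h1
    have h4 : E t - E (t - h) ≤ (∫ r in (t - h)..t, w' r) (p t) -
        lam * inner ℝ (∫ r in (t - h)..t, q' r) (q t) := by
      simpa only [hE, hτt, hPt] using h1
    have h5 := mul_le_mul_of_nonneg_left h4 (inv_nonneg.2 (le_of_lt hh))
    refine h5.trans (le_of_eq ?_)
    simp only [hB₁, hB₂, steklov, real_inner_smul_left, smul_apply, smul_eq_mul]
    ring

end Energy

/-! ### A priori bounds -/

section Apriori

/-- No Gronwall argument is needed: `P` is essentially bounded from the start, so its essential
supremum `M` is finite, `∫ P ≤ T M`, and the resulting quadratic inequality for `M` closes by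
Young's inequality. -/
theorem ae_le_and_integral_le {T a₀ lam k A Φ : ℝ} (hT : 0 < T) (ha₀ : 0 < a₀) (hlam : 0 ≤ lam)
    (hk : 0 ≤ k) (hA : 0 ≤ A) (hΦ : 0 ≤ Φ) {e P g r : ℝ → ℝ} (he : ∀ t, 0 ≤ e t) (hP0 : ∀ t, 0 ≤ P t)
    (hP : MemLp P ⊤ (timeMeasure T)) (hg0 : ∀ t, 0 ≤ g t) (hr0 : ∀ t, 0 ≤ r t)
    (hg : Integrable g (timeMeasure T)) (hr : Integrable r (timeMeasure T))
    (h : ∀ᵐ s ∂(timeMeasure T), e s + a₀ / 2 * P s ^ 2 + lam * (∫ t in Ioo 0 s, r t) +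
      k * (∫ t in Ioo 0 s, g t) ≤ A + Φ * ∫ t in Ioo 0 s, P t) :
    (∀ᵐ s ∂(timeMeasure T), e s ≤ 2 * (A + T ^ 2 * Φ ^ 2 / a₀) ∧
      a₀ / 2 * P s ^ 2 ≤ 2 * (A + T ^ 2 * Φ ^ 2 / a₀)) ∧
      lam * ∫ t in Ioo 0 T, r t ≤ 2 * (A + T ^ 2 * Φ ^ 2 / a₀) ∧
      k * ∫ t in Ioo 0 T, g t ≤ 2 * (A + T ^ 2 * Φ ^ 2 / a₀) := by
  set M := (eLpNorm P ⊤ (timeMeasure T)).toReal with hM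
  have hM0 : 0 ≤ M := ENNReal.toReal_nonneg
  have hfin : IsFiniteMeasure (timeMeasure T) := ⟨by simp [timeMeasure]⟩
  have hPM : ∀ᵐ t ∂(timeMeasure T), P t ≤ M := by
    filter_upwards [ae_le_eLpNormEssSup (f := P) (μ := timeMeasure T)] with t ht
    rw [← eLpNorm_exponent_top] at ht
    have h1 := ENNReal.toReal_mono hP.2.ne ht
    rwa [toReal_enorm, Real.norm_of_nonneg (hP0 t)] at h1
  have hPi : Integrable P (timeMeasure T) := memLp_one_iff_integrable.1 (hP.mono_exponent le_top)
  have hPint : ∀ s ∈ Ioo 0 T, ∫ t in Ioo 0 s, P t ≤ T * M := fun s hs => by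
    have hle : (volume : Measure ℝ).restrict (Ioo 0 s) ≤ timeMeasure T :=
      Measure.restrict_mono (Ioo_subset_Ioo_right hs.2.le) le_rfl
    have h1 : ∫ t in Ioo 0 s, P t ≤ ∫ _ in Ioo 0 s, M :=
      integral_mono_ae (hPi.mono_measure hle) (integrable_const M) (ae_mono hle hPM)
    refine h1.trans ?_
    rw [setIntegral_const, Measure.real, Real.volume_Ioo, smul_eq_mul, sub_zero,
      ENNReal.toReal_ofReal hs.1.le]
    exact mul_le_mul_of_nonneg_right hs.2.le hM0
  have hpos : ∀ {f : ℝ → ℝ} (s : ℝ), (∀ t, 0 ≤ f t) → 0 ≤ ∫ t in Ioo 0 s, f t := fun s hf =>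
    integral_nonneg hf
  have h1 : ∀ᵐ s ∂(timeMeasure T), e s + a₀ / 2 * P s ^ 2 + lam * (∫ t in Ioo 0 s, r t) +
      k * (∫ t in Ioo 0 s, g t) ≤ A + Φ * (T * M) := by
    filter_upwards [h, ae_restrict_mem measurableSet_Ioo] with s hs hsT
    have := mul_le_mul_of_nonneg_left (hPint s hsT) hΦ
    linarith
  have hMb : a₀ / 2 * M ^ 2 ≤ A + Φ * (T * M) := by
    have h2 : ∀ᵐ s ∂(timeMeasure T), ‖P s‖ ≤ √(2 / a₀ * (A + Φ * (T * M))) := by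
      filter_upwards [h1] with s hs
      rw [Real.norm_of_nonneg (hP0 s)]
      refine Real.le_sqrt_of_sq_le ?_
      have h3 := mul_nonneg hlam (hpos s hr0)
      have h4 := mul_nonneg hk (hpos s hg0)
      have h5 := he s
      have h6 : a₀ / 2 * P s ^ 2 ≤ A + Φ * (T * M) := by linarith
      calc P s ^ 2 = 2 / a₀ * (a₀ / 2 * P s ^ 2) := by field_simp
        _ ≤ _ := by gcongr
    have h3 : M ≤ √(2 / a₀ * (A + Φ * (T * M))) := by
      rw [hM, eLpNorm_exponent_top]
      exact ENNReal.toReal_le_of_le_ofReal (Real.sqrt_nonneg _) (eLpNormEssSup_le_of_ae_bound h2)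
    have h4 : 0 ≤ 2 / a₀ * (A + Φ * (T * M)) := by positivity
    have h5 : M ^ 2 ≤ 2 / a₀ * (A + Φ * (T * M)) := by
      rw [← Real.sq_sqrt h4]
      gcongr
    calc a₀ / 2 * M ^ 2 ≤ a₀ / 2 * (2 / a₀ * (A + Φ * (T * M))) := by gcongr
      _ = _ := by field_simp
  have hyoung : Φ * (T * M) ≤ a₀ / 4 * M ^ 2 + T ^ 2 * Φ ^ 2 / a₀ := by
    have h2 : 0 ≤ (a₀ / 2 * M - T * Φ) ^ 2 / a₀ := by positivity
    have h3 : (a₀ / 2 * M - T * Φ) ^ 2 / a₀ =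
        a₀ / 4 * M ^ 2 - Φ * (T * M) + T ^ 2 * Φ ^ 2 / a₀ := by
      field_simp
      ring
    linarith
  set R := 2 * (A + T ^ 2 * Φ ^ 2 / a₀) with hR
  have hAR : A + Φ * (T * M) ≤ R := by linarith
  have h2 : ∀ᵐ s ∂(timeMeasure T), (e s ≤ R ∧ a₀ / 2 * P s ^ 2 ≤ R) ∧
      lam * (∫ t in Ioo 0 s, r t) ≤ R ∧ k * (∫ t in Ioo 0 s, g t) ≤ R := by
    filter_upwards [h1] with s hs
    have h3 := mul_nonneg hlam (hpos s hr0)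
    have h4 := mul_nonneg hk (hpos s hg0)
    have h5 := he s
    have h6 : 0 ≤ a₀ / 2 * P s ^ 2 := by positivity
    refine ⟨⟨?_, ?_⟩, ?_, ?_⟩ <;> linarith
  -- The bound holds for almost every `s < T`, in particular for times arbitrarily close to `T`, and
  -- the primitive is continuous up to `T`.
  have hlimit : ∀ (f : ℝ → ℝ) (c : ℝ), Integrable f (timeMeasure T) →
      (∀ᵐ s ∂(timeMeasure T), c * (∫ t in Ioo 0 s, f t) ≤ R) → c * (∫ t in Ioo 0 T, f t) ≤ R := by
    intro f c hf hfR
    have hfreq : ∃ᶠ s in 𝓝[<] T, s ∈ Ioo 0 T ∧ c * (∫ t in Ioo 0 s, f t) ≤ R := by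
      rw [frequently_nhdsWithin_iff, frequently_iff]
      intro U hU
      obtain ⟨ε, hε, hball⟩ := Metric.mem_nhds_iff.1 hU
      have hmax : max 0 (T - ε) < T := max_lt hT (by linarith)
      have hne : (timeMeasure T) (Ioo (max 0 (T - ε)) T) ≠ 0 := by
        rw [timeMeasure, Measure.restrict_apply measurableSet_Ioo,
          inter_eq_left.2 (Ioo_subset_Ioo_left (le_max_left _ _)), Real.volume_Ioo]
        simpa using hmax
      obtain ⟨s, hs, hsR⟩ := (frequently_ae_iff.2 hne).and_eventually hfR |>.exists
      have hs1 := (max_lt_iff.1 hs.1)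
      refine ⟨s, hball ?_, ⟨⟨hs1.1, hs.2⟩, hsR⟩, hs.2⟩
      rw [Metric.mem_ball, Real.dist_eq, abs_lt]
      constructor <;> linarith [hs1.2, hs.2]
    have hii : IntervalIntegrable f volume 0 T := by
      rw [intervalIntegrable_iff_integrableOn_Ioo_of_le hT.le]
      exact hf
    have hcont : Tendsto (fun s => ∫ t in (0 : ℝ)..s, f t) (𝓝[<] T) (𝓝 (∫ t in (0 : ℝ)..T, f t)) := by
      have h3 := intervalIntegral.continuousOn_primitive_interval' hii left_mem_uIcc
      rw [uIcc_of_le hT.le] at h3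
      have h4 := h3 T ⟨hT.le, le_rfl⟩
      refine h4.mono_left ?_
      rw [← nhdsWithin_Ioo_eq_nhdsLT hT]
      exact nhdsWithin_mono _ Ioo_subset_Icc_self
    have e1 : ∀ s, 0 ≤ s → ∫ t in (0 : ℝ)..s, f t = ∫ t in Ioo 0 s, f t := fun s hs => by
      rw [intervalIntegral.integral_of_le hs, integral_Ioc_eq_integral_Ioo]
    rw [← e1 T hT.le]
    refine le_of_tendsto_of_frequently (hcont.const_mul c) (hfreq.mono fun s hs => ?_)
    rw [e1 s hs.1.1.le]
    exact hs.2
  exact ⟨h2.mono fun s hs => hs.1, hlimit r lam hr (h2.mono fun s hs => hs.2.1),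
    hlimit g k hg (h2.mono fun s hs => hs.2.2)⟩

variable {d : ℕ} {Ω : Set (Pt d)} {c : Coeffs d}

theorem mulVec_dotProduct_comm {A : Matrix (Fin d) (Fin d) ℝ} (hA : A.IsSymm) (x y : Fin d → ℝ) :
    (A *ᵥ x) ⬝ᵥ y = (A *ᵥ y) ⬝ᵥ x := by
  rw [dotProduct_comm, Matrix.dotProduct_mulVec, ← Matrix.mulVec_transpose, hA.eq]

/-- Nonnegativity of the form at `ζ - G` gives `AG ⬝ ζ ≤ ½ Aζ ⬝ ζ + ½ AG ⬝ G`, which keeps half of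
the coercivity. -/
theorem half_sub_half_le_mulVec_sub {A : Matrix (Fin d) (Fin d) ℝ} (hA : A.IsSymm) {k₁ k₂ : ℝ}
    (hk₁ : 0 ≤ k₁) (hA' : ∀ ζ : Fin d → ℝ, k₁ * (ζ ⬝ᵥ ζ) ≤ (A *ᵥ ζ) ⬝ᵥ ζ ∧
      (A *ᵥ ζ) ⬝ᵥ ζ ≤ k₂ * (ζ ⬝ᵥ ζ)) (ζ G : Fin d → ℝ) :
    k₁ / 2 * (ζ ⬝ᵥ ζ) - k₂ / 2 * (G ⬝ᵥ G) ≤ (A *ᵥ (ζ - G)) ⬝ᵥ ζ := by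
  have h1 : 0 ≤ (A *ᵥ (ζ - G)) ⬝ᵥ (ζ - G) := by
    refine le_trans (mul_nonneg hk₁ ?_) (hA' (ζ - G)).1
    exact Finset.sum_nonneg fun i _ => mul_self_nonneg _
  have h2 := (hA' ζ).1
  have h3 := (hA' G).2
  have h4 := mulVec_dotProduct_comm hA ζ G
  simp only [Matrix.mulVec_sub, sub_dotProduct, dotProduct_sub] at h1 ⊢
  linarith

/-- Polarisation: the form is nonnegative at `e i ± e j`. Bounded entries make the Darcy integrand
integrable, so that its integral may be compared pointwise. -/
theorem abs_entry_le {A : Matrix (Fin d) (Fin d) ℝ} (hA : A.IsSymm) {k₁ k₂ : ℝ}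
    (hk₁ : 0 ≤ k₁) (hA' : ∀ ζ : Fin d → ℝ, k₁ * (ζ ⬝ᵥ ζ) ≤ (A *ᵥ ζ) ⬝ᵥ ζ ∧
      (A *ᵥ ζ) ⬝ᵥ ζ ≤ k₂ * (ζ ⬝ᵥ ζ)) (i j : Fin d) : |A i j| ≤ |k₂| := by
  let e : Fin d → Fin d → ℝ := fun i => Pi.single i 1
  have hee : ∀ i, e i ⬝ᵥ e i = 1 := fun i => by simp [e]
  have hAe : ∀ i j, (A *ᵥ e j) ⬝ᵥ e i = A i j := fun i j => by simp [e]
  have hpos : ∀ ζ : Fin d → ℝ, 0 ≤ (A *ᵥ ζ) ⬝ᵥ ζ := fun ζ =>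
    le_trans (mul_nonneg hk₁ (Finset.sum_nonneg fun i _ => mul_self_nonneg _)) (hA' ζ).1
  have hij : A j i = A i j := hA.apply i j
  have h1 := hpos (e i + e j)
  have h2 := hpos (e i - e j)
  have h3 := (hA' (e i)).2
  have h4 := (hA' (e j)).2
  simp only [Matrix.mulVec_add, Matrix.mulVec_sub, add_dotProduct, sub_dotProduct, dotProduct_add,
    dotProduct_sub, hAe, hee, hij] at h1 h2 h3 h4
  have h5 := le_abs_self k₂
  rw [abs_le]
  constructor <;> linarith

theorem norm_sq_eq_integral {α ι : Type*} [MeasurableSpace α] [Fintype ι] {μ : Measure α}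
    (w : PiLp 2 fun _ : ι => Lp ℝ 2 μ) : ‖w‖ ^ 2 = ∫ x, ∑ i, w i x ^ 2 ∂μ := by
  rw [integral_finsetSum _ fun i _ => (Lp.memLp (w i)).integrable_sq, PiLp.norm_sq_eq_of_L2]
  refine Finset.sum_congr rfl fun i _ => ?_
  rw [← real_inner_self_eq_norm_sq, L2.inner_def]
  refine integral_congr_ae (Eventually.of_forall fun x => ?_)
  simp [sq]

/-- Coercivity of the Darcy form. -/
theorem Coeffs.Admissible.exists_le_darcyForm (hc : c.Admissible Ω) (hΩ : Bornology.IsBounded Ω) :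
    ∃ G : ℝ, 0 ≤ G ∧ ∀ p : H1 Ω, c.K₁ / 2 * ‖grad p‖ ^ 2 - G ≤ c.darcyForm p p := by
  have hfin : IsFiniteMeasure ((volume : Measure (Pt d)).restrict Ω) :=
    ⟨by simpa using hΩ.measure_lt_top⟩
  have hρ : MemLp c.ρf 2 (volume.restrict Ω) := hc.ρf_bdd.mono_exponent le_top
  have hG : ∀ j, MemLp (fun x => c.ρf x * c.g j) 2 (volume.restrict Ω) := fun j => hρ.mul_const _
  have hGi : Integrable (fun x => ∑ j, (c.ρf x * c.g j) ^ 2) (volume.restrict Ω) :=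
    integrable_finsetSum _ fun j _ => (hG j).integrable_sq
  refine ⟨|c.K₂| / 2 * ∫ x in Ω, ∑ j, (c.ρf x * c.g j) ^ 2, mul_nonneg (by positivity)
    (integral_nonneg fun x => Finset.sum_nonneg fun j _ => sq_nonneg _), fun p => ?_⟩
  have hK : ∀ i j, ∀ᵐ x ∂(volume.restrict Ω), |c.K x i j| ≤ |c.K₂| := fun i j => by
    filter_upwards [hc.K_symm, hc.K_bounds] with x h1 h2
    exact abs_entry_le h1 hc.K₁_pos.le h2 i j
  have hz : ∀ j, MemLp (fun x => grad p j x - c.ρf x * c.g j) 2 (volume.restrict Ω) := fun j =>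
    (Lp.memLp (grad p j)).sub (hG j)
  have hint : Integrable (fun x => (c.K x *ᵥ fun j => grad p j x - c.ρf x * c.g j) ⬝ᵥ
      fun i => grad p i x) (volume.restrict Ω) := by
    unfold dotProduct Matrix.mulVec dotProduct
    refine integrable_finsetSum _ fun i _ => ?_
    have h1 : MemLp (fun x => ∑ j, c.K x i j * (grad p j x - c.ρf x * c.g j)) 2
        (volume.restrict Ω) :=
      memLp_finsetSum _ fun j _ => memLp_bdd_mul (hc.K_meas i j) (hK i j) (hz j)
    exact h1.integrable_mul (Lp.memLp (grad p i))
  have hgi : Integrable (fun x => ∑ i, grad p i x ^ 2) (volume.restrict Ω) :=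
    integrable_finsetSum _ fun i _ => (Lp.memLp (grad p i)).integrable_sq
  rw [norm_sq_eq_integral, ← integral_const_mul, ← integral_const_mul,
    ← integral_sub (hgi.const_mul _) (hGi.const_mul _), Coeffs.darcyForm]
  refine integral_mono_ae ((hgi.const_mul _).sub (hGi.const_mul _)) hint ?_
  filter_upwards [hc.K_symm, hc.K_bounds] with x h1 h2
  have h3 := half_sub_half_le_mulVec_sub h1 hc.K₁_pos.le h2 (fun i => grad p i x)
    fun j => c.ρf x * c.g j
  have h4 : 0 ≤ ∑ j, (c.ρf x * c.g j) ^ 2 := Finset.sum_nonneg fun j _ => sq_nonneg _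
  have h5 : c.K₂ / 2 * ∑ j, (c.ρf x * c.g j) ^ 2 ≤ |c.K₂| / 2 * ∑ j, (c.ρf x * c.g j) ^ 2 := by
    gcongr
    exact le_abs_self _
  simp only [dotProduct, ← sq] at h3
  simp only [dotProduct]
  refine le_trans ?_ h3
  linarith

end Apriori

/-! ### A priori bounds for weak solutions -/

section WeakSolution

variable {d : ℕ} {Ω : Set (Pt d)} {c : Coeffs d} {T : ℝ} {D : Data Ω} {τ : ℝ → H1Vec Ω}
  {δ ϖ : ℝ → L2 Ω} {p : ℝ → H1 Ω} {q qt : ℝ → L2 Ω} {ϖt : ℝ → (H1 Ω →L[ℝ] ℝ)}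

/-- A shortcut for instance search. -/
abbrev H1Vec.normedAddCommGroup : NormedAddCommGroup (H1Vec Ω) :=
  PiLp.normedAddCommGroup 2 fun _ : Fin d => H1 Ω

attribute [local instance] H1Vec.normedAddCommGroup

/-- A shortcut for instance search. -/
abbrev H1Vec.normedSpace : NormedSpace ℝ (H1Vec Ω) := PiLp.normedSpace 2 ℝ fun _ : Fin d => H1 Ω

attribute [local instance] H1Vec.normedSpace

theorem exists_norm_apply_le {V W : Type*} [NormedAddCommGroup V] [NormedSpace ℝ V]
    [NormedAddCommGroup W] [NormedSpace ℝ W] (f : V →L[ℝ] W) :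
    ∃ n : ℝ, 0 ≤ n ∧ ∀ v, ‖f v‖ ≤ n * ‖v‖ := ⟨‖f‖, norm_nonneg f, f.le_opNorm⟩

theorem exists_strainL (Ω : Set (Pt d)) :
    ∃ e : H1Vec Ω →L[ℝ] StrainSpace Ω, ∀ v, e v = strain v := ⟨strainL, fun _ => rfl⟩

theorem exists_divL (Ω : Set (Pt d)) : ∃ e : H1Vec Ω →L[ℝ] L2 Ω, ∀ v, e v = div v :=
  ⟨divL, divL_apply⟩

theorem exists_norm_strain_le (Ω : Set (Pt d)) :
    ∃ n : ℝ, 0 ≤ n ∧ ∀ v : H1Vec Ω, ‖strain v‖ ≤ n * ‖v‖ :=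
  exists_norm_apply_le (strainL : H1Vec Ω →L[ℝ] StrainSpace Ω)

theorem exists_norm_valVec_le (Ω : Set (Pt d)) :
    ∃ n : ℝ, 0 ≤ n ∧ ∀ v : H1Vec Ω, ‖valVec v‖ ≤ n * ‖v‖ :=
  exists_norm_apply_le (valVecL : H1Vec Ω →L[ℝ] L2Vec Ω)

theorem exists_norm_div_le (Ω : Set (Pt d)) :
    ∃ n : ℝ, 0 ≤ n ∧ ∀ v : H1Vec Ω, ‖div v‖ ≤ n * ‖v‖ := by
  obtain ⟨b, hb⟩ := exists_divL Ω
  obtain ⟨n, h0, hn⟩ := exists_norm_apply_le b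
  exact ⟨n, h0, fun v => hb v ▸ hn v⟩

theorem Coeffs.Admissible.denom_pos (hc : c.Admissible Ω) : 0 < c.b₀ ^ 2 + c.β * c.a₀ := by
  have h1 := hc.b₀_pos
  have h2 := mul_nonneg hc.β_nonneg hc.a₀_pos.le
  positivity

theorem Coeffs.Admissible.χ₁_pos (hc : c.Admissible Ω) : 0 < c.χ₁ :=
  div_pos hc.b₀_pos hc.denom_pos

theorem Coeffs.Admissible.χ₂_nonneg (hc : c.Admissible Ω) : 0 ≤ c.χ₂ :=
  div_nonneg hc.β_nonneg hc.denom_pos.le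

theorem Coeffs.Admissible.χ₃_pos (hc : c.Admissible Ω) : 0 < c.χ₃ :=
  div_pos hc.a₀_pos hc.denom_pos

/-- The constraint solved for the fluid content and the total pressure. -/
theorem IsWeakSolution.ae_eq_add_and_eq_sub (hs : IsWeakSolution T c D τ δ ϖ p q qt ϖt)
    (hc : c.Admissible Ω) : ∀ᵐ t ∂(timeMeasure T),
      ϖ t = c.a₀ • val (p t) + c.b₀ • div (τ t) ∧
      δ t = c.b₀ • val (p t) - c.β • div (τ t) - c.lamStar • qt t := by
  have hN := hc.denom_pos.ne'
  filter_upwards [hs.constraint, hs.p_eq] with t h1 h2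
  have h3 : div (τ t) = c.χ₁ • ϖ t - c.χ₃ • δ t - (c.lamStar * c.χ₃) • qt t := by
    refine ext_inner_right ℝ fun η => ?_
    have h4 := h1 η
    rw [inner_sub_left, inner_sub_left, inner_smul_left, inner_smul_left, inner_smul_left]
    simp only [conj_trivial]
    linarith
  rw [h2, h3]
  have e1 : c.a₀ * c.χ₁ = c.b₀ * c.χ₃ := by unfold Coeffs.χ₁ Coeffs.χ₃; ring
  have e2 : c.a₀ * c.χ₂ + c.b₀ * c.χ₁ = 1 := by
    have h : c.a₀ * c.χ₂ + c.b₀ * c.χ₁ =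
        (c.b₀ ^ 2 + c.β * c.a₀) / (c.b₀ ^ 2 + c.β * c.a₀) := by
      unfold Coeffs.χ₁ Coeffs.χ₂; ring
    rw [h, div_self hN]
  have e3 : c.b₀ * c.χ₁ + c.β * c.χ₃ = 1 := by
    have h : c.b₀ * c.χ₁ + c.β * c.χ₃ =
        (c.b₀ ^ 2 + c.β * c.a₀) / (c.b₀ ^ 2 + c.β * c.a₀) := by
      unfold Coeffs.χ₁ Coeffs.χ₃; ring
    rw [h, div_self hN]
  have e4 : c.b₀ * c.χ₂ = c.β * c.χ₁ := by unfold Coeffs.χ₁ Coeffs.χ₂; ring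
  constructor
  · have : c.a₀ • (c.χ₁ • δ t + c.χ₂ • ϖ t + (c.lamStar * c.χ₁) • qt t) +
        c.b₀ • (c.χ₁ • ϖ t - c.χ₃ • δ t - (c.lamStar * c.χ₃) • qt t) =
        (c.a₀ * c.χ₂ + c.b₀ * c.χ₁) • ϖ t + (c.a₀ * c.χ₁ - c.b₀ * c.χ₃) • δ t +
        (c.lamStar * (c.a₀ * c.χ₁ - c.b₀ * c.χ₃)) • qt t := by module
    rw [this, e2, e1, sub_self, mul_zero, zero_smul, zero_smul, one_smul, add_zero, add_zero]
  · have : c.b₀ • (c.χ₁ • δ t + c.χ₂ • ϖ t + (c.lamStar * c.χ₁) • qt t) -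
        c.β • (c.χ₁ • ϖ t - c.χ₃ • δ t - (c.lamStar * c.χ₃) • qt t) - c.lamStar • qt t =
        (c.b₀ * c.χ₁ + c.β * c.χ₃) • δ t + (c.b₀ * c.χ₂ - c.β * c.χ₁) • ϖ t +
        (c.lamStar * (c.b₀ * c.χ₁ + c.β * c.χ₃ - 1)) • qt t := by module
    rw [this, e3, e4, sub_self, sub_self, mul_zero, zero_smul, zero_smul, one_smul, add_zero,
      add_zero]

theorem integrable_apply {X : Type*} [NormedAddCommGroup X] [NormedSpace ℝ X]
    {w : ℝ → X →L[ℝ] ℝ} {p : ℝ → X} {μ : Measure ℝ} (hw : MemLp w 2 μ) (hp : MemLp p 2 μ) :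
    Integrable (fun t => w t (p t)) μ :=
  integrable_bilin (ContinuousLinearMap.id ℝ (X →L[ℝ] ℝ)) hw hp

theorem timeMeasure_ne_zero (hT : 0 < T) : timeMeasure T ≠ 0 := by
  rw [timeMeasure, Ne, Measure.restrict_eq_zero, Real.volume_Ioo]
  simpa using hT

theorem exists_clm_eq_inner_sub_inner {V S L : Type*} [NormedAddCommGroup V] [NormedSpace ℝ V]
    [NormedAddCommGroup S] [InnerProductSpace ℝ S] [NormedAddCommGroup L] [InnerProductSpace ℝ L]
    (e : V →L[ℝ] S) (b : V →L[ℝ] L) (γ : ℝ) (x : S) (y : L) :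
    ∃ ℓ : V →L[ℝ] ℝ, ∀ v, ℓ v = γ * inner ℝ x (e v) - inner ℝ y (b v) :=
  ⟨γ • (innerSL ℝ x).comp e - (innerSL ℝ y).comp b, fun _ => rfl⟩

set_option maxHeartbeats 1000000 in
/-- The load functional. -/
theorem IsWeakSolution.exists_load (hs : IsWeakSolution T c D τ δ ϖ p q qt ϖt) (hT : 0 < T)
    {C : ℝ} (hC : ∀ v : H1Vec Ω, ∃ g : L2BdVec Ω, IsTraceVec v g ∧
      ‖g‖ ≤ C * (‖valVec v‖ + ‖strain v‖)) :
    ∃ ℓ : H1Vec Ω →L[ℝ] ℝ,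
      (∀ v, |ℓ v| ≤ (‖D.F‖ + C * ‖D.F₁‖) * (‖valVec v‖ + ‖strain v‖)) ∧
      ∀ᵐ t ∂(timeMeasure T), ∀ v,
        c.γ * inner ℝ (strain (τ t)) (strain v) - inner ℝ (δ t) (div v) = ℓ v := by
  have hne : (ae (timeMeasure T)).NeBot := ae_neBot.2 (timeMeasure_ne_zero hT)
  -- The loads do not depend on time, so the left-hand side at one good time `s` defines the
  -- functional for all times. It is linear by construction, and neither uniqueness nor linearity of
  -- traces is needed.
  obtain ⟨s, hs1⟩ := hs.momentum.exists
  obtain ⟨e, he⟩ := exists_strainL Ω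
  obtain ⟨b, hb⟩ := exists_divL Ω
  obtain ⟨ℓ, hℓ'⟩ := exists_clm_eq_inner_sub_inner e b c.γ (strain (τ s)) (δ s)
  have hℓ : ∀ v, ℓ v = c.γ * inner ℝ (strain (τ s)) (strain v) - inner ℝ (δ s) (div v) :=
    fun v => (hℓ' v).trans (congrArg₂
      (fun x y => c.γ * inner ℝ (strain (τ s)) x - inner ℝ (δ s) y) (he v) (hb v))
  refine ⟨ℓ, fun v => ?_, ?_⟩
  · obtain ⟨g, hg, hgC⟩ := hC v
    have h0 : ℓ v = inner ℝ D.F (valVec v) + inner ℝ D.F₁ g := (hℓ v).trans (hs1 v g hg)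
    rw [h0]
    have h1 := abs_real_inner_le_norm D.F (valVec v)
    have h2 := abs_real_inner_le_norm D.F₁ g
    have h3 := mul_le_mul_of_nonneg_left hgC (norm_nonneg D.F₁)
    have h4 := mul_nonneg (norm_nonneg D.F) (norm_nonneg (strain v))
    refine (abs_add_le _ _).trans ?_
    linarith
  · filter_upwards [hs.momentum] with t ht v
    obtain ⟨g, hg, -⟩ := hC v
    exact (ht v g hg).trans ((hs1 v g hg).symm.trans (hℓ v).symm)

set_option maxHeartbeats 1000000 in
/-- The energy inequality for weak solutions. -/
theorem IsWeakSolution.ae_storedEnergy_le (hs : IsWeakSolution T c D τ δ ϖ p q qt ϖt)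
    (hc : c.Admissible Ω) (hT : 0 < T) {ℓ : H1Vec Ω →L[ℝ] ℝ}
    (hℓ : ∀ᵐ t ∂(timeMeasure T), ∀ v,
      c.γ * inner ℝ (strain (τ t)) (strain v) - inner ℝ (δ t) (div v) = ℓ v) :
    ∀ᵐ s ∂(timeMeasure T),
      c.γ * (1 / 2 * ‖strain (τ s)‖ ^ 2) + c.β * (1 / 2 * ‖div (τ s)‖ ^ 2) +
        c.a₀ * (1 / 2 * ‖val (p s)‖ ^ 2) - ℓ (τ s) + c.lamStar * ∫ r in Ioo 0 s, ‖qt r‖ ^ 2 ≤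
      c.γ * (1 / 2 * ‖strain D.τ₀‖ ^ 2) + c.β * (1 / 2 * ‖div D.τ₀‖ ^ 2) +
        c.a₀ * (1 / 2 * ‖D.p₀‖ ^ 2) - ℓ D.τ₀ + ∫ r in Ioo 0 s, ϖt r (p r) := by
  have hrel := hs.ae_eq_add_and_eq_sub hc
  obtain ⟨e, he⟩ := exists_strainL Ω
  obtain ⟨b, hb⟩ := exists_divL Ω
  have hmom : ∀ᵐ t ∂(timeMeasure T), ∀ v, c.γ * inner ℝ (e (τ t)) (e v) =
      inner ℝ (c.b₀ • val (p t) - c.β • b (τ t) - c.lamStar • qt t) (b v) + ℓ v := by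
    filter_upwards [hℓ, hrel] with t h1 h2 v
    have h3 := h1 v
    have e1 : c.γ * inner ℝ (e (τ t)) (e v) = c.γ * inner ℝ (strain (τ t)) (strain v) :=
      congrArg₂ (fun x y => c.γ * inner ℝ x y) (he _) (he _)
    have e2 : c.b₀ • val (p t) - c.β • b (τ t) - c.lamStar • qt t = δ t :=
      (congrArg (fun x => c.b₀ • val (p t) - c.β • x - c.lamStar • qt t) (hb _)).trans h2.2.symm
    have e3 : inner ℝ (c.b₀ • val (p t) - c.β • b (τ t) - c.lamStar • qt t) (b v) =
        inner ℝ (δ t) (div v) := congrArg₂ (fun x y : L2 Ω => inner ℝ x y) e2 (hb v)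
    linarith
  have hmass : ∀ᵐ t ∂(timeMeasure T), ∀ x, inner ℝ (c.a₀ • val (p t) + c.b₀ • b (τ t)) (val x) =
      inner ℝ (c.a₀ • D.p₀ + c.b₀ • b D.τ₀) (val x) + (∫ s in (0 : ℝ)..t, ϖt s) x := by
    filter_upwards [hs.ϖ_deriv, hrel] with t h1 h2 x
    have h3 := congrArg (fun f : H1 Ω →L[ℝ] ℝ => f x) h1
    have e1 : c.a₀ • val (p t) + c.b₀ • b (τ t) = ϖ t :=
      (congrArg (fun x => c.a₀ • val (p t) + c.b₀ • x) (hb _)).trans h2.1.symm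
    have e2 : c.a₀ • D.p₀ + c.b₀ • b D.τ₀ = c.a₀ • D.p₀ + c.b₀ • div D.τ₀ :=
      congrArg (fun x => c.a₀ • D.p₀ + c.b₀ • x) (hb _)
    rw [e1, e2]
    exact h3
  have hdiv : c.lamStar ≠ 0 → ∀ᵐ t ∂(timeMeasure T),
      b (τ t) = b D.τ₀ + ∫ s in (0 : ℝ)..t, qt s := by
    intro hlam
    simp only [hb]
    exact hs.div_deriv (lt_of_le_of_ne hc.lamStar_nonneg (Ne.symm hlam))
  have h := Biot.ae_storedEnergy_le e b val ℓ hc.γ_pos.le hc.β_nonneg hc.a₀_pos.le hT hs.τ_mem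
    hs.p_mem hs.p_mem_H1 hs.qt_mem hs.ϖt_mem hmom hmass hdiv
  filter_upwards [h] with s h1
  simpa only [storedEnergy, he, hb] using h1

/-- The pressure is an admissible test function in the diffusion equation. -/
theorem IsWeakSolution.ae_apply_le (hs : IsWeakSolution T c D τ δ ϖ p q qt ϖt)
    (hc : c.Admissible Ω) {C G : ℝ} (hC : ∀ u : H1 Ω, ∃ g : L2Bd Ω, IsTrace u g ∧
      ‖g‖ ≤ C * (‖val u‖ + ‖grad u‖))
    (hG : ∀ p : H1 Ω, c.K₁ / 2 * ‖grad p‖ ^ 2 - G ≤ c.darcyForm p p) :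
    ∀ᵐ t ∂(timeMeasure T), ϖt t (p t) ≤ (‖D.φ‖ + C * ‖D.φ₁‖) * ‖val (p t)‖ +
      (c.θf / c.K₁ * (C * ‖D.φ₁‖) ^ 2 + G / c.θf) - c.K₁ / (4 * c.θf) * ‖grad (p t)‖ ^ 2 := by
  have hθ := hc.θf_pos
  have hK := hc.K₁_pos
  filter_upwards [hs.diffusion] with t ht
  obtain ⟨g, hg, hgC⟩ := hC (p t)
  have h0 := ht (p t) g hg
  have h1 := real_inner_le_norm D.φ (val (p t))
  have h2 := real_inner_le_norm D.φ₁ g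
  have h3 := mul_le_mul_of_nonneg_left hgC (norm_nonneg D.φ₁)
  have h4 : 1 / c.θf * (c.K₁ / 2 * ‖grad (p t)‖ ^ 2 - G) ≤ 1 / c.θf * c.darcyForm (p t) (p t) :=
    mul_le_mul_of_nonneg_left (hG (p t)) (by positivity)
  -- Completing the square absorbs the boundary flux into half of the dissipation, which leaves the
  -- coefficient `K₁ / (4 θ_f)`.
  have h5 : 0 ≤ c.θf / c.K₁ * (C * ‖D.φ₁‖ - c.K₁ / (2 * c.θf) * ‖grad (p t)‖) ^ 2 := by positivity
  have h6 : c.θf / c.K₁ * (C * ‖D.φ₁‖ - c.K₁ / (2 * c.θf) * ‖grad (p t)‖) ^ 2 =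
      c.θf / c.K₁ * (C * ‖D.φ₁‖) ^ 2 - C * ‖D.φ₁‖ * ‖grad (p t)‖ +
        c.K₁ / (4 * c.θf) * ‖grad (p t)‖ ^ 2 := by
    field_simp
    ring
  have h7 : 1 / c.θf * (c.K₁ / 2 * ‖grad (p t)‖ ^ 2 - G) =
      2 * (c.K₁ / (4 * c.θf) * ‖grad (p t)‖ ^ 2) - G / c.θf := by
    field_simp
    ring
  linarith

/-- The total bound for the energy in terms of norms of the data. -/
def energyBound (γ β a₀ T ne nd nv CK Λ Φ Q r₁ r₂ : ℝ) : ℝ :=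
  2 * (γ * (1 / 2 * (ne * r₁) ^ 2) + β * (1 / 2 * (nd * r₁) ^ 2) + a₀ * (1 / 2 * r₂ ^ 2) +
    Λ * ((nv + ne) * r₁) + (Λ * (CK + 1)) ^ 2 / γ + T * Q + T ^ 2 * Φ ^ 2 / a₀)

theorem integral_Ioo_le_of_ae_le {T Φ Q k : ℝ} (hQ : 0 ≤ Q) {W P g : ℝ → ℝ}
    (hW : Integrable W (timeMeasure T)) (hP : Integrable P (timeMeasure T))
    (hg : Integrable g (timeMeasure T))
    (h : ∀ᵐ t ∂(timeMeasure T), W t ≤ Φ * P t + Q - k * g t) {s : ℝ} (hs : s ∈ Ioo 0 T) :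
    ∫ t in Ioo 0 s, W t ≤
      Φ * (∫ t in Ioo 0 s, P t) + T * Q - k * ∫ t in Ioo 0 s, g t := by
  have hle : (volume : Measure ℝ).restrict (Ioo 0 s) ≤ timeMeasure T :=
    Measure.restrict_mono (Ioo_subset_Ioo_right hs.2.le) le_rfl
  have i1 := (hP.mono_measure hle).const_mul Φ
  have i2 := (hg.mono_measure hle).const_mul k
  have i3 : Integrable (fun _ : ℝ => Q) (volume.restrict (Ioo 0 s)) := integrable_const Q
  have i4 : Integrable (fun t => Φ * P t + Q) (volume.restrict (Ioo 0 s)) := i1.add i3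
  have h1 := integral_mono_ae (hW.mono_measure hle) (i4.sub i2) (ae_mono hle h)
  have h2 : ∫ _ in Ioo 0 s, Q ≤ T * Q := by
    rw [setIntegral_const, Measure.real, Real.volume_Ioo, smul_eq_mul, sub_zero,
      ENNReal.toReal_ofReal hs.1.le]
    exact mul_le_mul_of_nonneg_right hs.2.le hQ
  have h3 : ∫ t in Ioo 0 s, (Φ * P t + Q - k * g t) =
      Φ * (∫ t in Ioo 0 s, P t) + (∫ _ in Ioo 0 s, Q) - k * ∫ t in Ioo 0 s, g t := by
    rw [integral_sub i4 i2, integral_add i1 i3, integral_const_mul, integral_const_mul]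
  have h4 := h1.trans_eq h3
  linarith

/-- A priori bounds from an energy inequality. -/
theorem ae_le_energyBound {γ β a₀ lam k T ne nd nv CK Λ Φ Q r₁ r₂ x₀ y₀ z₀ l₀ : ℝ} (hγ : 0 < γ)
    (hβ : 0 ≤ β) (ha₀ : 0 < a₀) (hlam : 0 ≤ lam) (hk : 0 ≤ k) (hT : 0 < T) (hne : 0 ≤ ne)
    (hnv : 0 ≤ nv) (hΛ : 0 ≤ Λ) (hΦ : 0 ≤ Φ) (hQ : 0 ≤ Q) (hr₁ : 0 ≤ r₁)
    (hx₀ : 0 ≤ x₀) (hy₀ : 0 ≤ y₀) (hxr : x₀ ≤ ne * r₁) (hyr : y₀ ≤ nd * r₁) (hzr : z₀ ≤ nv * r₁)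
    (hl₀ : |l₀| ≤ Λ * (z₀ + x₀)) {x y z l P g r W : ℝ → ℝ} (hP0 : ∀ t, 0 ≤ P t)
    (hg0 : ∀ t, 0 ≤ g t) (hr0 : ∀ t, 0 ≤ r t) (hP : MemLp P ⊤ (timeMeasure T))
    (hg : Integrable g (timeMeasure T)) (hr : Integrable r (timeMeasure T))
    (hW : Integrable W (timeMeasure T)) (hl : ∀ t, |l t| ≤ Λ * (z t + x t))
    (hz : ∀ᵐ t ∂(timeMeasure T), z t ≤ CK * x t)
    (hWle : ∀ᵐ t ∂(timeMeasure T), W t ≤ Φ * P t + Q - k * g t)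
    (hen : ∀ᵐ s ∂(timeMeasure T),
      γ * (1 / 2 * x s ^ 2) + β * (1 / 2 * y s ^ 2) + a₀ * (1 / 2 * P s ^ 2) - l s +
        lam * ∫ t in Ioo 0 s, r t ≤
      γ * (1 / 2 * x₀ ^ 2) + β * (1 / 2 * y₀ ^ 2) + a₀ * (1 / 2 * r₂ ^ 2) - l₀ +
        ∫ t in Ioo 0 s, W t) :
    (∀ᵐ s ∂(timeMeasure T),
      γ / 4 * x s ^ 2 ≤ energyBound γ β a₀ T ne nd nv CK Λ Φ Q r₁ r₂ ∧
      a₀ / 2 * P s ^ 2 ≤ energyBound γ β a₀ T ne nd nv CK Λ Φ Q r₁ r₂) ∧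
      lam * ∫ t in Ioo 0 T, r t ≤ energyBound γ β a₀ T ne nd nv CK Λ Φ Q r₁ r₂ ∧
      k * ∫ t in Ioo 0 T, g t ≤ energyBound γ β a₀ T ne nd nv CK Λ Φ Q r₁ r₂ := by
  have hfin : IsFiniteMeasure (timeMeasure T) := ⟨by simp [timeMeasure]⟩
  have hPi : Integrable P (timeMeasure T) := memLp_one_iff_integrable.1 (hP.mono_exponent le_top)
  refine ae_le_and_integral_le (e := fun t => γ / 4 * x t ^ 2) hT ha₀ hlam hk ?_ hΦ
    (fun t => by positivity) hP0 hP hg0 hr0 hg hr ?_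
  · positivity
  · filter_upwards [hen, hz, ae_restrict_mem measurableSet_Ioo] with s h1 h2 hsT
    have h3 := integral_Ioo_le_of_ae_le hQ hW hPi hg hWle hsT
    have e1 := (le_abs_self (l s)).trans (hl s)
    have e2 := (neg_le_abs l₀).trans hl₀
    have e3 : Λ * (z s + x s) ≤ Λ * ((CK + 1) * x s) :=
      mul_le_mul_of_nonneg_left (by linarith) hΛ
    have e4 : Λ * (z₀ + x₀) ≤ Λ * ((nv + ne) * r₁) :=
      mul_le_mul_of_nonneg_left (by linarith) hΛ
    -- By Korn's inequality the load is linear in the strain norm, and Young's inequality absorbs it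
    -- into half of the elastic energy.
    have e5 : Λ * ((CK + 1) * x s) ≤ γ / 4 * x s ^ 2 + (Λ * (CK + 1)) ^ 2 / γ := by
      have f1 : 0 ≤ (γ / 2 * x s - Λ * (CK + 1)) ^ 2 / γ := by positivity
      have f2 : (γ / 2 * x s - Λ * (CK + 1)) ^ 2 / γ =
          γ / 4 * x s ^ 2 - Λ * ((CK + 1) * x s) + (Λ * (CK + 1)) ^ 2 / γ := by
        field_simp
        ring
      linarith
    have e6 : 0 ≤ β * (1 / 2 * y s ^ 2) := by positivity
    have e7 : γ * (1 / 2 * x₀ ^ 2) ≤ γ * (1 / 2 * (ne * r₁) ^ 2) := by gcongr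
    have e8 : β * (1 / 2 * y₀ ^ 2) ≤ β * (1 / 2 * (nd * r₁) ^ 2) := by gcongr
    linarith

set_option maxHeartbeats 1000000 in
/-- A priori bounds for weak solutions in terms of the norms of the data. -/
theorem IsPolygonalDomain.exists_apriori (hd : 0 < d) (hΩ : IsPolygonalDomain Ω) (hT : 0 < T)
    (hc : c.Admissible Ω) :
    ∃ (Y : ℝ → ℝ → ℝ → ℝ → ℝ → ℝ → ℝ) (CK : ℝ), 0 ≤ CK ∧
      ∀ (D : Data Ω) (τ : ℝ → H1Vec Ω) (δ ϖ : ℝ → L2 Ω) (p : ℝ → H1 Ω) (q qt : ℝ → L2 Ω)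
        (ϖt : ℝ → (H1 Ω →L[ℝ] ℝ)), IsWeakSolution T c D τ δ ϖ p q qt ϖt →
      ∀ M, M = Y ‖D.τ₀‖ ‖D.p₀‖ ‖D.F‖ ‖D.F₁‖ ‖D.φ‖ ‖D.φ₁‖ →
        (∀ᵐ t ∂(timeMeasure T), ‖valVec (τ t)‖ ≤ CK * ‖strain (τ t)‖) ∧
        (∀ᵐ t ∂(timeMeasure T), c.γ / 4 * ‖strain (τ t)‖ ^ 2 ≤ M ∧
          c.a₀ / 2 * ‖val (p t)‖ ^ 2 ≤ M) ∧
        c.lamStar * ∫ t in Ioo 0 T, ‖qt t‖ ^ 2 ≤ M ∧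
        c.K₁ / (4 * c.θf) * ∫ t in Ioo 0 T, ‖grad (p t)‖ ^ 2 ≤ M := by
  have hθ := hc.θf_pos
  have hK := hc.K₁_pos
  obtain ⟨CK, hCK0, hCK⟩ := IsPolygonalDomain.exists_norm_valVec_le hd hΩ
  obtain ⟨Cv, hCv0, hCv⟩ := IsPolygonalDomain.exists_traceVec hd hΩ
  obtain ⟨Ct, hCt0, hCt⟩ := IsPolygonalDomain.exists_trace hd hΩ
  obtain ⟨G, hG0, hG⟩ := hc.exists_le_darcyForm hΩ.isBounded
  obtain ⟨ne, hne0, hne⟩ := exists_norm_strain_le Ω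
  obtain ⟨nd, hnd0, hnd⟩ := exists_norm_div_le Ω
  obtain ⟨nv, hnv0, hnv⟩ := Biot.exists_norm_valVec_le Ω
  refine ⟨fun r₁ r₂ r₃ r₄ r₅ r₆ => energyBound c.γ c.β c.a₀ T ne nd nv CK (r₃ + Cv * r₄)
    (r₅ + Ct * r₆) (c.θf / c.K₁ * (Ct * r₆) ^ 2 + G / c.θf) r₁ r₂, CK, hCK0,
    fun D τ δ ϖ p q qt ϖt hs M hM => ?_⟩
  obtain ⟨ℓ, hℓ1, hℓ2⟩ := hs.exists_load hT hCv
  have hcK := hs.τ_perp.mono fun t ht => hCK (τ t) ht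
  have hgm : MemLp (fun t => grad (p t)) 2 (timeMeasure T) := grad.comp_memLp' hs.p_mem_H1
  refine ⟨hcK, ?_⟩
  rw [hM]
  exact ae_le_energyBound (y := fun t => ‖div (τ t)‖) hc.γ_pos hc.β_nonneg hc.a₀_pos
    hc.lamStar_nonneg (by positivity) hT hne0 hnv0 (by positivity) (by positivity) (by positivity)
    (norm_nonneg _) (norm_nonneg _) (norm_nonneg _) (hne _) (hnd _) (hnv _) (hℓ1 _)
    (fun t => norm_nonneg _) (fun t => sq_nonneg _) (fun t => sq_nonneg _) (MemLp.norm hs.p_mem)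
    (hgm.integrable_norm_pow (p := 2) (by norm_num))
    (MemLp.integrable_norm_pow (p := 2) hs.qt_mem (by norm_num))
    (integrable_apply hs.ϖt_mem hs.p_mem_H1) (fun t => hℓ1 (τ t)) hcK (hs.ae_apply_le hc hCt hG)
    (hs.ae_storedEnergy_le hc hT hℓ2)

end WeakSolution

/-! ### Norms in time -/

section TimeNorm

variable {X : Type*} [NormedAddCommGroup X] {T : ℝ} {w : ℝ → X}

theorem ofReal_mul_timeNorm_top_le {a B C : ℝ} (ha : 0 ≤ a) (hB : a * B ≤ C)
    (h : ∀ᵐ t ∂(timeMeasure T), ‖w t‖ ≤ B) :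
    ENNReal.ofReal a * timeNorm ⊤ T w ≤ ENNReal.ofReal C := by
  rw [timeNorm, eLpNorm_exponent_top]
  refine (mul_le_mul_right (eLpNormEssSup_le_of_ae_bound h) _).trans ?_
  rw [← ENNReal.ofReal_mul ha]
  exact ENNReal.ofReal_le_ofReal hB

theorem timeNorm_top_le {B : ℝ} (h : ∀ᵐ t ∂(timeMeasure T), ‖w t‖ ≤ B) :
    timeNorm ⊤ T w ≤ ENNReal.ofReal B := by
  rw [timeNorm, eLpNorm_exponent_top]
  exact eLpNormEssSup_le_of_ae_bound h

theorem timeNorm_two_le (hT : 0 ≤ T) {B : ℝ} (h : ∀ᵐ t ∂(timeMeasure T), ‖w t‖ ≤ B) :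
    timeNorm 2 T w ≤ ENNReal.ofReal (√T * B) := by
  refine (eLpNorm_le_of_ae_bound h).trans_eq ?_
  rw [ENNReal.ofReal_mul (Real.sqrt_nonneg _), timeMeasure, Measure.restrict_apply_univ,
    Real.volume_Ioo, sub_zero, ENNReal.toReal_ofNat, Real.sqrt_eq_rpow,
    ← ENNReal.ofReal_rpow_of_nonneg hT (by norm_num)]
  norm_num

theorem ofReal_sqrt_mul_timeNorm_two_le {a M : ℝ} (ha : 0 ≤ a) (hw : MemLp w 2 (timeMeasure T))
    (h : a * ∫ t in Ioo 0 T, ‖w t‖ ^ 2 ≤ M) :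
    ENNReal.ofReal √a * timeNorm 2 T w ≤ ENNReal.ofReal √M := by
  have h1 : timeNorm 2 T w = ENNReal.ofReal √(∫ t in Ioo 0 T, ‖w t‖ ^ 2) := by
    rw [timeNorm, hw.eLpNorm_eq_integral_rpow_norm (by norm_num) (by norm_num), Real.sqrt_eq_rpow]
    norm_num [timeMeasure]
  rw [h1, ← ENNReal.ofReal_mul (Real.sqrt_nonneg _), ← Real.sqrt_mul ha]
  exact ENNReal.ofReal_le_ofReal (Real.sqrt_le_sqrt h)

end TimeNorm

/-! ### From the energy bound to the norms of the theorem -/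

section Estimates

variable {d : ℕ} {Ω : Set (Pt d)} {c : Coeffs d} {T : ℝ} {D : Data Ω} {τ : ℝ → H1Vec Ω}
  {δ ϖ : ℝ → L2 Ω} {p : ℝ → H1 Ω} {q qt : ℝ → L2 Ω} {ϖt : ℝ → (H1 Ω →L[ℝ] ℝ)}

theorem norm_div_le (v : H1Vec Ω) : ‖div v‖ ≤ √d * ‖strain v‖ := by
  refine le_of_sq_le_sq ?_ (by positivity)
  rw [mul_pow, Real.sq_sqrt (Nat.cast_nonneg d)]
  exact norm_div_sq_le v

theorem le_sqrt_mul_sqrt {a x M : ℝ} (ha : 0 < a) (h : a * x ^ 2 ≤ M) : x ≤ √(1 / a) * √M := by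
  rw [← Real.sqrt_mul (by positivity)]
  refine Real.le_sqrt_of_sq_le ?_
  calc x ^ 2 = 1 / a * (a * x ^ 2) := by field_simp
    _ ≤ _ := by gcongr

theorem norm_add_smul_le {V : Type*} [NormedAddCommGroup V] [NormedSpace ℝ V] {a b A B : ℝ}
    (ha : 0 ≤ a) (hb : 0 ≤ b) {x y : V} (hx : ‖x‖ ≤ A) (hy : ‖y‖ ≤ B) :
    ‖a • x + b • y‖ ≤ a * A + b * B ∧ ‖a • x - b • y‖ ≤ a * A + b * B := by
  have h : ‖a • x‖ + ‖b • y‖ ≤ a * A + b * B := by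
    rw [norm_smul_of_nonneg ha, norm_smul_of_nonneg hb]
    gcongr
  exact ⟨(norm_add_le _ _).trans h, (norm_sub_le _ _).trans h⟩

set_option maxHeartbeats 1000000 in
/-- The estimates for the first group of norms, with one constant. -/
theorem IsPolygonalDomain.exists_bound (hd : 0 < d) (hΩ : IsPolygonalDomain Ω) (hT : 0 < T)
    (hc : c.Admissible Ω) :
    ∃ C : ℝ → ℝ → ℝ → ℝ → ℝ → ℝ → ℝ, (∀ r₁ r₂ r₃ r₄ r₅ r₆, 0 < C r₁ r₂ r₃ r₄ r₅ r₆) ∧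
      ∀ (D : Data Ω) (τ : ℝ → H1Vec Ω) (δ ϖ : ℝ → L2 Ω) (p : ℝ → H1 Ω) (q qt : ℝ → L2 Ω)
        (ϖt : ℝ → (H1 Ω →L[ℝ] ℝ)), IsWeakSolution T c D τ δ ϖ p q qt ϖt →
      ∀ c₁, c₁ = C ‖D.τ₀‖ ‖D.p₀‖ ‖D.F‖ ‖D.F₁‖ ‖D.φ‖ ‖D.φ₁‖ →
        ENNReal.ofReal √c.lamStar * timeNorm 2 T qt
            + ENNReal.ofReal √c.γ * timeNorm ⊤ T (fun t => strain (τ t))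
            + ENNReal.ofReal √c.χ₂ * timeNorm ⊤ T ϖ
            + ENNReal.ofReal √c.χ₃ * timeNorm ⊤ T (fun t => c.lamStar • qt t + δ t)
            + ENNReal.ofReal √(c.K₁ / c.θf) * timeNorm 2 T (fun t => grad (p t))
          ≤ ENNReal.ofReal c₁ ∧
        timeNorm ⊤ T (fun t => valVec (τ t)) ≤ ENNReal.ofReal c₁ ∧
        timeNorm 2 T (fun t => val (p t)) ≤ ENNReal.ofReal c₁ ∧
        (∀ᵐ t ∂(timeMeasure T), √c.χ₂ * ‖ϖ t‖ ≤ c₁ ∧ √c.χ₃ * ‖c.lamStar • qt t + δ t‖ ≤ c₁) ∧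
        ENNReal.ofReal √c.lamStar * timeNorm 2 T qt ≤ ENNReal.ofReal c₁ := by
  obtain ⟨Y, CK, hCK, hY⟩ := IsPolygonalDomain.exists_apriori hd hΩ hT hc
  have hγ := hc.γ_pos
  have ha₀ := hc.a₀_pos
  have hb₀ := hc.b₀_pos
  have hβ := hc.β_nonneg
  have hlam := hc.lamStar_nonneg
  have hθ := hc.θf_pos
  have hK := hc.K₁_pos
  set e := √(1 / (c.γ / 4))
  set f := √(1 / (c.a₀ / 2))
  set wB := c.a₀ * f + c.b₀ * (√d * e)
  set dB := c.b₀ * f + c.β * (√d * e)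
  have he0 : 0 ≤ e := Real.sqrt_nonneg _
  have hf0 : 0 ≤ f := Real.sqrt_nonneg _
  have hw0 : 0 ≤ wB := by positivity
  have hd0 : 0 ≤ dB := by positivity
  refine ⟨fun r₁ r₂ r₃ r₄ r₅ r₆ =>
    -- One summand for each norm to be bounded; the final `1` makes the constant strictly positive.
    (1 + √c.γ * e + √c.χ₂ * wB + √c.χ₃ * dB + 2 + CK * e + √T * f) * √(Y r₁ r₂ r₃ r₄ r₅ r₆) + 1,
    fun _ _ _ _ _ _ => by positivity, fun D τ δ ϖ p q qt ϖt hs c₁ hc₁ => ?_⟩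
  obtain ⟨h1, h2, h3, h4⟩ := hY D τ δ ϖ p q qt ϖt hs _ rfl
  set M := Y ‖D.τ₀‖ ‖D.p₀‖ ‖D.F‖ ‖D.F₁‖ ‖D.φ‖ ‖D.φ₁‖
  have hc₁' : c₁ = (1 + √c.γ * e + √c.χ₂ * wB + √c.χ₃ * dB + 2 + CK * e + √T * f) * √M + 1 := hc₁
  have hM : 0 ≤ √M := Real.sqrt_nonneg _
  have q1 : 0 ≤ √c.γ * e * √M := by positivity
  have q2 : 0 ≤ √c.χ₂ * wB * √M := by positivity
  have q3 : 0 ≤ √c.χ₃ * dB * √M := by positivity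
  have q4 : 0 ≤ CK * e * √M := by positivity
  have q5 : 0 ≤ √T * f * √M := by positivity
  have k1 : ∀ᵐ t ∂(timeMeasure T), ‖strain (τ t)‖ ≤ e * √M :=
    h2.mono fun t ht => le_sqrt_mul_sqrt (by positivity) ht.1
  have k2 : ∀ᵐ t ∂(timeMeasure T), ‖val (p t)‖ ≤ f * √M :=
    h2.mono fun t ht => le_sqrt_mul_sqrt (by positivity) ht.2
  have k3 : ∀ᵐ t ∂(timeMeasure T), ‖div (τ t)‖ ≤ √d * (e * √M) := by
    filter_upwards [k1] with t ht
    exact (norm_div_le (τ t)).trans (mul_le_mul_of_nonneg_left ht (Real.sqrt_nonneg _))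
  have k4 : ∀ᵐ t ∂(timeMeasure T), ‖ϖ t‖ ≤ wB * √M ∧ ‖c.lamStar • qt t + δ t‖ ≤ dB * √M := by
    filter_upwards [k2, k3, hs.ae_eq_add_and_eq_sub hc] with t g1 g2 g3
    -- In this combination `(div τ)_t` cancels, so it is bounded at almost every time although `(div
    -- τ)_t` is only square integrable in time.
    have e1 : c.lamStar • qt t + δ t = c.b₀ • val (p t) - c.β • div (τ t) := by
      rw [g3.2]
      abel
    rw [g3.1, e1]
    refine ⟨(norm_add_smul_le ha₀.le hb₀.le g1 g2).1.trans_eq ?_,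
      (norm_add_smul_le hb₀.le hβ g1 g2).2.trans_eq ?_⟩ <;> ring
  have k5 : ∀ᵐ t ∂(timeMeasure T), ‖valVec (τ t)‖ ≤ CK * e * √M := by
    filter_upwards [k1, h1] with t g1 g2
    rw [mul_assoc]
    exact g2.trans (mul_le_mul_of_nonneg_left g1 hCK)
  have k6 : ENNReal.ofReal √c.lamStar * timeNorm 2 T qt ≤ ENNReal.ofReal √M :=
    ofReal_sqrt_mul_timeNorm_two_le hlam hs.qt_mem h3
  have k7 : ENNReal.ofReal √(c.K₁ / c.θf) * timeNorm 2 T (fun t => grad (p t)) ≤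
      ENNReal.ofReal (2 * √M) := by
    have g1 : c.K₁ / c.θf * ∫ t in Ioo 0 T, ‖grad (p t)‖ ^ 2 ≤ 2 ^ 2 * M := by
      have : c.K₁ / c.θf = 4 * (c.K₁ / (4 * c.θf)) := by field_simp
      rw [this]
      linarith
    have g2 : √(2 ^ 2 * M) = 2 * √M := by
      rw [Real.sqrt_mul (by norm_num), Real.sqrt_sq (by norm_num)]
    rw [← g2]
    exact ofReal_sqrt_mul_timeNorm_two_le (by positivity) (grad.comp_memLp' hs.p_mem_H1) g1
  have k8 := ofReal_mul_timeNorm_top_le (Real.sqrt_nonneg c.γ) (mul_assoc _ _ _).ge k1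
  have k9 := ofReal_mul_timeNorm_top_le (Real.sqrt_nonneg c.χ₂) (mul_assoc _ _ _).ge
    (k4.mono fun t ht => ht.1)
  have k10 := ofReal_mul_timeNorm_top_le (Real.sqrt_nonneg c.χ₃) (mul_assoc _ _ _).ge
    (k4.mono fun t ht => ht.2)
  refine ⟨?_, ?_, ?_, ?_, ?_⟩
  · refine (add_le_add (add_le_add (add_le_add (add_le_add k6 k8) k9) k10) k7).trans ?_
    rw [← ENNReal.ofReal_add hM q1, ← ENNReal.ofReal_add (by positivity) q2,
      ← ENNReal.ofReal_add (by positivity) q3, ← ENNReal.ofReal_add (by positivity) (by positivity)]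
    refine ENNReal.ofReal_le_ofReal ?_
    rw [hc₁']
    linarith
  · refine (timeNorm_top_le k5).trans (ENNReal.ofReal_le_ofReal ?_)
    rw [hc₁']
    linarith
  · refine (timeNorm_two_le hT.le k2).trans (ENNReal.ofReal_le_ofReal ?_)
    rw [hc₁']
    linarith
  · filter_upwards [k4] with t ht
    have g1 := mul_le_mul_of_nonneg_left ht.1 (Real.sqrt_nonneg c.χ₂)
    have g2 := mul_le_mul_of_nonneg_left ht.2 (Real.sqrt_nonneg c.χ₃)
    rw [hc₁']
    constructor <;> linarith
  · refine k6.trans (ENNReal.ofReal_le_ofReal ?_)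
    rw [hc₁']
    linarith

/-- `p = χ₂ ϖ + χ₁ (λ* (div τ)_t + δ)`. Splitting `χ₂ = √χ₂ √χ₂` leaves one root for the weighted
bound on `ϖ`. -/
theorem IsWeakSolution.norm_val_le (hs : IsWeakSolution T c D τ δ ϖ p q qt ϖt)
    (hc : c.Admissible Ω) {c₁ : ℝ} (h : ∀ᵐ t ∂(timeMeasure T),
      √c.χ₂ * ‖ϖ t‖ ≤ c₁ ∧ √c.χ₃ * ‖c.lamStar • qt t + δ t‖ ≤ c₁) :
    ∀ᵐ t ∂(timeMeasure T), ‖val (p t)‖ ≤ c₁ * (√c.χ₂ + c.χ₁ * (√c.χ₃)⁻¹) := by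
  have h1 := hc.χ₁_pos
  have h2 := hc.χ₂_nonneg
  have h3 := Real.sqrt_pos.2 hc.χ₃_pos
  filter_upwards [hs.p_eq, h] with t e1 e2
  have e3 : val (p t) = c.χ₂ • ϖ t + c.χ₁ • (c.lamStar • qt t + δ t) := by
    rw [e1]
    module
  rw [e3]
  refine (norm_add_smul_le h2 h1.le le_rfl le_rfl).1.trans ?_
  have e4 : c.χ₂ * ‖ϖ t‖ ≤ √c.χ₂ * c₁ := by
    calc c.χ₂ * ‖ϖ t‖ = √c.χ₂ * (√c.χ₂ * ‖ϖ t‖) := by rw [← mul_assoc, Real.mul_self_sqrt h2]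
      _ ≤ _ := mul_le_mul_of_nonneg_left e2.1 (Real.sqrt_nonneg _)
  have e5 : ‖c.lamStar • qt t + δ t‖ ≤ (√c.χ₃)⁻¹ * c₁ := by
    rw [← div_eq_inv_mul, le_div_iff₀' h3]
    exact e2.2
  have e6 := mul_le_mul_of_nonneg_left e5 h1.le
  linarith

/-- `δ` is the difference of `λ* (div τ)_t + δ`, bounded in time, and `λ* (div τ)_t`, for which one
factor `√λ*` goes with the dissipation bound. -/
theorem IsWeakSolution.timeNorm_le (hs : IsWeakSolution T c D τ δ ϖ p q qt ϖt) (hT : 0 ≤ T)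
    (hc : c.Admissible Ω) {c₁ : ℝ} (hc₁ : 0 ≤ c₁) (h : ∀ᵐ t ∂(timeMeasure T),
      √c.χ₃ * ‖c.lamStar • qt t + δ t‖ ≤ c₁)
    (hq : ENNReal.ofReal √c.lamStar * timeNorm 2 T qt ≤ ENNReal.ofReal c₁) :
    timeNorm 2 T δ ≤ ENNReal.ofReal (c₁ * (√T * (√c.χ₃)⁻¹ + √c.lamStar)) := by
  have h3 := Real.sqrt_pos.2 hc.χ₃_pos
  have e1 : timeNorm 2 T (fun t => c.lamStar • qt t + δ t) ≤
      ENNReal.ofReal (√T * ((√c.χ₃)⁻¹ * c₁)) := by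
    refine timeNorm_two_le hT (h.mono fun t ht => ?_)
    rw [← div_eq_inv_mul, le_div_iff₀' h3]
    exact ht
  have e2 : timeNorm 2 T (fun t => c.lamStar • qt t) ≤ ENNReal.ofReal (√c.lamStar * c₁) := by
    have e3 : timeNorm 2 T (fun t => c.lamStar • qt t) =
        ENNReal.ofReal c.lamStar * timeNorm 2 T qt := by
      refine (eLpNorm_const_smul c.lamStar qt 2 (timeMeasure T)).trans ?_
      rw [Real.enorm_of_nonneg hc.lamStar_nonneg]
      rfl
    have e4 : ENNReal.ofReal c.lamStar = ENNReal.ofReal √c.lamStar * ENNReal.ofReal √c.lamStar := by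
      rw [← ENNReal.ofReal_mul (Real.sqrt_nonneg _), Real.mul_self_sqrt hc.lamStar_nonneg]
    rw [e3, e4, mul_assoc, ENNReal.ofReal_mul (Real.sqrt_nonneg _)]
    gcongr
  have e5 : δ = (fun t => c.lamStar • qt t + δ t) - fun t => c.lamStar • qt t := by
    funext t
    simp
  have hm1 : AEStronglyMeasurable (fun t => c.lamStar • qt t) (timeMeasure T) :=
    AEStronglyMeasurable.const_smul hs.qt_mem.1 c.lamStar
  have hm2 : AEStronglyMeasurable (fun t => c.lamStar • qt t + δ t) (timeMeasure T) :=
    hm1.add hs.δ_mem.1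
  calc timeNorm 2 T δ ≤ timeNorm 2 T (fun t => c.lamStar • qt t + δ t) +
        timeNorm 2 T (fun t => c.lamStar • qt t) := by
        nth_rewrite 1 [e5]
        exact eLpNorm_sub_le hm2 hm1 (by norm_num)
    _ ≤ ENNReal.ofReal (√T * ((√c.χ₃)⁻¹ * c₁)) + ENNReal.ofReal (√c.lamStar * c₁) :=
        add_le_add e1 e2
    _ = _ := by
        rw [← ENNReal.ofReal_add (by positivity) (by positivity)]
        congr 1
        ring

end Estimates

end Biot

end

/-! ### The main estimate -/

set_option maxHeartbeats 1000000 in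
theorem mainTheorem8 {d : ℕ} (hd : d = 2 ∨ d = 3) (Ω : Set (Biot.Pt d))
    (hΩ : Biot.IsPolygonalDomain Ω) (T : ℝ) (hT : 0 < T) (c : Biot.Coeffs d)
    (hc : c.Admissible Ω) :
    ∃ (C₁ : ℝ → ℝ → ℝ → ℝ → ℝ → ℝ → ℝ) (C₂ : ℝ → ℝ≥0∞ → ℝ),
      (∀ r₁ r₂ r₃ r₄ r₅ r₆, 0 < C₁ r₁ r₂ r₃ r₄ r₅ r₆) ∧ (∀ r s, 0 < C₂ r s) ∧
      ∀ D : Biot.Data Ω, D.Compatible →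
      ∀ (τ : ℝ → Biot.H1Vec Ω) (δ ϖ : ℝ → Biot.L2 Ω) (p : ℝ → Biot.H1 Ω) (q qt : ℝ → Biot.L2 Ω)
        (ϖt : ℝ → (Biot.H1 Ω →L[ℝ] ℝ)),
      Biot.IsWeakSolution T c D τ δ ϖ p q qt ϖt →
      ∀ c₁ c₂ : ℝ, c₁ = C₁ ‖D.τ₀‖ ‖D.p₀‖ ‖D.F‖ ‖D.F₁‖ ‖D.φ‖ ‖D.φ₁‖ →
        c₂ = C₂ c₁ (Biot.gradNorm D.p₀) →
        ENNReal.ofReal √c.lamStar * Biot.timeNorm 2 T qt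
            + ENNReal.ofReal √c.γ * Biot.timeNorm ∞ T (fun t => Biot.strain (τ t))
            + ENNReal.ofReal √c.χ₂ * Biot.timeNorm ∞ T ϖ
            + ENNReal.ofReal √c.χ₃ * Biot.timeNorm ∞ T (fun t => c.lamStar • qt t + δ t)
            + ENNReal.ofReal √(c.K₁ / c.θf) * Biot.timeNorm 2 T (fun t => Biot.grad (p t))
          ≤ ENNReal.ofReal c₁ ∧
        Biot.timeNorm ∞ T (fun t => Biot.valVec (τ t)) ≤ ENNReal.ofReal c₁ ∧
        Biot.timeNorm ∞ T (fun t => Biot.val (p t))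
          ≤ ENNReal.ofReal (c₂ * (√c.χ₂ + c.χ₁ * (√c.χ₃)⁻¹)) ∧
        Biot.timeNorm 2 T (fun t => Biot.val (p t)) ≤ ENNReal.ofReal c₁ ∧
        Biot.timeNorm 2 T δ ≤ ENNReal.ofReal (c₂ * c.χ₁⁻¹ * (1 + √c.χ₂)) := by
  have hd0 : 0 < d := by omega
  obtain ⟨C, hC0, hC⟩ := Biot.IsPolygonalDomain.exists_bound hd0 hΩ hT hc
  have hχ₁ := hc.χ₁_pos
  set k := √T * (√c.χ₃)⁻¹ + √c.lamStar
  have hk : 0 ≤ k := by positivity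
  -- The energy inequality already bounds `p` uniformly in time through `p₀` alone, so `C₂` can be
  -- chosen constant in `‖∇p₀‖`. The factor `1 + χ₁ k` covers both uses: `c₁ ≤ c₂` for the pressure
  -- and `c₁ k ≤ c₂ / χ₁` for `δ`.
  refine ⟨C, fun r _ => |r| * (1 + c.χ₁ * k) + 1, hC0, fun r s => by positivity, ?_⟩
  intro D _ τ δ ϖ p q qt ϖt hs c₁ c₂ hc₁ hc₂
  have hc₁0 : 0 < c₁ := hc₁ ▸ hC0 _ _ _ _ _ _
  obtain ⟨h1, h2, h3, h4, h5⟩ := hC D τ δ ϖ p q qt ϖt hs c₁ hc₁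
  have hc₂' : c₂ = |c₁| * (1 + c.χ₁ * k) + 1 := hc₂
  rw [abs_of_pos hc₁0] at hc₂'
  have hck : 0 ≤ c₁ * (c.χ₁ * k) := by positivity
  refine ⟨h1, h2, ?_, h3, ?_⟩
  · refine (Biot.timeNorm_top_le (hs.norm_val_le hc h4)).trans (ENNReal.ofReal_le_ofReal ?_)
    refine mul_le_mul_of_nonneg_right ?_ (by positivity)
    rw [hc₂']
    linarith
  · refine (hs.timeNorm_le hT.le hc hc₁0.le (h4.mono fun t ht => ht.2) h5).trans
      (ENNReal.ofReal_le_ofReal ?_)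
    have e1 : c₁ * k ≤ c₂ * c.χ₁⁻¹ := by
      rw [← div_eq_mul_inv, le_div_iff₀ hχ₁, hc₂']
      linarith
    have e2 : 0 ≤ c₂ * c.χ₁⁻¹ := le_trans (by positivity) e1
    have e3 := mul_nonneg e2 (Real.sqrt_nonneg c.χ₂)
    linarith
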